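/- Let $\{U_w : w\in\mathbb Z^2\}$ be i.i.d. random variables, each uniformly distributed on $[-1,1]^2$, and let $V=\{w+U_w : w\in\mathbb Z^2\}$ be the perturbed lattice. For $x\in\mathbb R^2$ let $h(x)$ be the (almost surely unique) point of $V$ that is closest to $x$ in the $\ell^1$ distance among the points $y \in V$ with $y(2)>x(2)$, and let $h^0(x)=x$, $h^{k}(x)=h(h^{k-1}(x))$ for $k\ge 1$. The directed spanning forest (DSF) path $\pi^x$ started at $x$ is obtained by linearly joining the successive points $h^k(x)$, $k\ge 0$; it is viewed as a function of the second coordinate, so that $\pi^x(h^k(x)(2))=h^k(x)(1)$. For $u,v\in\mathbb Z^2$ with $u(2)=v(2)$ put $$T(u,v)=\inf\{t\ge u(2) : \pi^u(t)=\pi^v(t)\},\qquad \inf\emptyset=\infty .$$ There is a constant $C_0>0$ such that for all $u,v\in\mathbb Z^2$ with $u(1)<v(1)$ and $u(2)=v(2)$ and all $t>0$, $$\mathbb P\bigl(T(u,v)-u(2)>t\bigr)\le \frac{C_0\,(v(1)-u(1))}{\sqrt t}.$$ In particular, if $u(2)=v(2)=0$, then $\mathbb P(T(u,v)>t)\le C_0(v(1)-u(1))/\sqrt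 t$. -/

import Mathlib

open MeasureTheory ProbabilityTheory Set

namespace PerturbedDSF

/-- A lattice point of `ℤ²`, viewed as a point of the plane `ℝ²`. -/
def latticePoint (w : ℤ × ℤ) : ℝ × ℝ := ((w.1 : ℝ), (w.2 : ℝ))

/-- The closed box `[-1, 1]²`. -/
def box : Set (ℝ × ℝ) := Icc (-1 : ℝ) 1 ×ˢ Icc (-1 : ℝ) 1

/-- The vertex set `V = {w + U_w : w ∈ ℤ²}` of the lattice perturbed by the displacements `U`. -/
def vertexSet (U : ℤ × ℤ → ℝ × ℝ) : Set (ℝ × ℝ) :=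
  range fun w => latticePoint w + U w

/-- The `ℓ¹` distance `‖y - x‖₁` in the plane. -/
def l1Dist (x y : ℝ × ℝ) : ℝ := |y.1 - x.1| + |y.2 - x.2|

/-- `y` is a closest point to `x`, for the `ℓ¹` distance, among the points of `V` whose second
coordinate is strictly larger than that of `x`. -/
def IsNextStep (V : Set (ℝ × ℝ)) (x y : ℝ × ℝ) : Prop :=
  y ∈ V ∧ x.2 < y.2 ∧ ∀ z ∈ V, x.2 < z.2 → l1Dist x y ≤ l1Dist x z

open Classical in
/-- The next step `h(x)`: the closest point of `V` strictly above `x`. For the random vertex set it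
exists and is unique almost surely; on the exceptional configurations the value is `x` itself, so
that the path stops there. -/
noncomputable def nextStep (V : Set (ℝ × ℝ)) (x : ℝ × ℝ) : ℝ × ℝ :=
  if hx : ∃! y, IsNextStep V x y then hx.choose else x

/-- The path `π^x` started at `x`, as a curve in the plane: the successive steps
`x = h⁰(x), h¹(x), h²(x), …` joined linearly. Since the heights of the steps increase, it is the
graph of a function of the height: `(a, t) ∈ path V x` says that `π^x(t) = a`. -/
def path (V : Set (ℝ × ℝ)) (x : ℝ × ℝ) : Set (ℝ × ℝ) :=
  ⋃ k : ℕ, segment ℝ ((nextStep V)^[k] x) ((nextStep V)^[k + 1] x)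

/-- The coalescing time `T(x, y) = inf {t ≥ x(2) : π^x(t) = π^y(t)}` of the paths started at `x` and
`y`, an extended real number which is `⊤` if the paths never meet. -/
noncomputable def coalescingTime (V : Set (ℝ × ℝ)) (x y : ℝ × ℝ) : EReal :=
  sInf ((fun t : ℝ => (t : EReal)) ''
    {t : ℝ | x.2 ≤ t ∧ ∃ a : ℝ, (a, t) ∈ path V x ∧ (a, t) ∈ path V y})

end PerturbedDSF

/-!
Cut the plane at the heights `20 j` and follow the path from a lattice point `x` of height `0` at the
points `levelPoint x j` where it leaves the height `20 j - 7`. A step is at most `9 / 2` long in the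
`ℓ¹` norm, so `levelPoint x j` depends only on the rows up to `20 j` (`exitPoint_rowsLE`), and steps
do not cross, so two paths stay ordered up to a bounded error until they merge
(`Generic.exitPoint_order`). Two difficulties remain: the horizontal range of the path between two
levels is unbounded, and the part of the environment that is not yet explored, seen from the path,
is not independent of the past. Both are handled by explicit local events of positive probability.

* A *wall* is a strip of columns in which the perturbations build a dense vertical line of vertices
  with empty space next to it; no path crosses it (`Generic.exitPoint_between_walls`). The number
  of blocks in which walls have to be searched around the path, the *gap*, bounds the displacement
  of the path (`Typical.ofReal_abs_sub_le`). Walls of consecutive levels use disjoint sites, and this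
  makes the expected gap contract from one level to the next (`exists_lintegral_gapAt_succ_le`).
* A *trap* is a configuration of the next twenty rows which forces every path that is confined by
  walls to pass through one and the same vertex (`IsTrap.catches`). It is symmetric about its
  centre, and so is the law of the rows above, so the path has no drift after it has been caught
  (`setIntegral_topExit`). As a consequence the conditional drift of a single path over any number
  of levels is bounded in terms of the gap, uniformly in the past
  (`exists_abs_setIntegral_pos_sub_le`).

For two paths, let `M_j` be the conditional expectation, given the rows up to `20 j`, of their
distance at a final level `N`. This is a martingale, bounded below by `-9`, with mean of the order
of the initial distance `d`. At each level at which the gaps are moderate, which is the case for a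
positive fraction of the levels, there is a positive conditional probability that

* if the paths are close, one trap catches both of them and they merge;
* if they are far apart, two traps pull them away from each other, which increases `M_j` by at
  least `1`, because the later drifts are bounded (`le_setIntegral_meanSep_sub`).

Hence the potential `2 R M_j - M_j ^ 2`, stopped when the paths merge or when `M_j` comes near `R`,
decreases on average by a fixed amount per surviving level (`mul_law_good_le`), and its
initial value is of order `R d`. This bounds the expected number of surviving levels by a multiple
of `R d` (`exists_sum_law_surviving_le`), so that survival up to level `N` has probability of order
at most `R d / N`, while the maximal inequality bounds the probability that `M_j` reaches `R` by a
multiple of `d / R`. The choice `R = √N` gives the rate `d / √N` (`exists_law_compl_merged_le`).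
-/

namespace PerturbedDSF

/-! ### Vertices, steps and exit points -/

/-- The vertex `w + U_w` of the site `w`. -/
def vertex (U : ℤ × ℤ → ℝ × ℝ) (w : ℤ × ℤ) : ℝ × ℝ := latticePoint w + U w

/-- The vertices of the sites in `A`. -/
def vertices (U : ℤ × ℤ → ℝ × ℝ) (A : Set (ℤ × ℤ)) : Set (ℝ × ℝ) := vertex U '' A

lemma vertex_mem (U : ℤ × ℤ → ℝ × ℝ) (w : ℤ × ℤ) : vertex U w ∈ vertexSet U := ⟨w, rfl⟩

lemma vertex_fst (U : ℤ × ℤ → ℝ × ℝ) (w : ℤ × ℤ) : (vertex U w).1 = w.1 + (U w).1 := rfl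

lemma vertex_snd (U : ℤ × ℤ → ℝ × ℝ) (w : ℤ × ℤ) : (vertex U w).2 = w.2 + (U w).2 := rfl

lemma mem_box {a : ℝ × ℝ} : a ∈ box ↔ (-1 ≤ a.1 ∧ a.1 ≤ 1) ∧ (-1 ≤ a.2 ∧ a.2 ≤ 1) := Iff.rfl

lemma vertex_bounds {U : ℤ × ℤ → ℝ × ℝ} (hU : ∀ w, U w ∈ box) (w : ℤ × ℤ) :
    ((w.1 : ℝ) - 1 ≤ (vertex U w).1 ∧ (vertex U w).1 ≤ w.1 + 1) ∧
      ((w.2 : ℝ) - 1 ≤ (vertex U w).2 ∧ (vertex U w).2 ≤ w.2 + 1) := by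
  have h := mem_box.1 (hU w)
  rw [vertex_fst, vertex_snd]
  refine ⟨⟨?_, ?_⟩, ?_, ?_⟩ <;> linarith [h.1.1, h.1.2, h.2.1, h.2.2]

lemma nextStep_spec {V : Set (ℝ × ℝ)} {x : ℝ × ℝ} (h : ∃! y, IsNextStep V x y) :
    IsNextStep V x (nextStep V x) := by
  rw [nextStep, dif_pos h]
  exact h.choose_spec.1

lemma nextStep_eq {V : Set (ℝ × ℝ)} {x y : ℝ × ℝ} (h : ∃! y, IsNextStep V x y)
    (hy : IsNextStep V x y) : nextStep V x = y :=
  h.unique (nextStep_spec h) hy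

lemma snd_le_nextStep (V : Set (ℝ × ℝ)) (x : ℝ × ℝ) : x.2 ≤ (nextStep V x).2 := by
  by_cases h : ∃! y, IsNextStep V x y
  · exact (nextStep_spec h).2.1.le
  · rw [nextStep, dif_neg h]

lemma snd_le_iterate (V : Set (ℝ × ℝ)) (x : ℝ × ℝ) (k : ℕ) :
    x.2 ≤ ((nextStep V)^[k] x).2 := by
  induction k with
  | zero => simp
  | succ k ih =>
    rw [Function.iterate_succ_apply']
    exact ih.trans (snd_le_nextStep V _)

lemma iterate_snd_mono (V : Set (ℝ × ℝ)) (x : ℝ × ℝ) :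
    Monotone fun k => ((nextStep V)^[k] x).2 :=
  monotone_nat_of_le_succ fun k => by
    rw [Function.iterate_succ_apply']
    exact snd_le_nextStep V _

lemma nextStep_congr {V V' : Set (ℝ × ℝ)} {x : ℝ × ℝ}
    (h : ∀ y, IsNextStep V x y ↔ IsNextStep V' x y) : nextStep V x = nextStep V' x := by
  by_cases h' : ∃! y, IsNextStep V x y
  · exact nextStep_eq h' ((h _).2 (nextStep_spec ((existsUnique_congr h).1 h')))
  · rw [nextStep, dif_neg h', nextStep, dif_neg fun h'' => h' ((existsUnique_congr h).2 h'')]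

lemma l1Dist_of_lt {x y : ℝ × ℝ} (h : x.2 < y.2) : l1Dist x y = |y.1 - x.1| + (y.2 - x.2) := by
  rw [l1Dist, abs_of_pos (sub_pos.2 h)]

/-- Above every point there is a vertex at `ℓ¹` distance at most `9/2`, two rows higher. -/
lemma exists_vertex_near {U : ℤ × ℤ → ℝ × ℝ} (hU : ∀ w, U w ∈ box) (x : ℝ × ℝ) :
    ∃ w : ℤ × ℤ, w.2 = ⌊x.2⌋ + 2 ∧ x.2 < (vertex U w).2 ∧ l1Dist x (vertex U w) ≤ 9 / 2 := by
  refine ⟨(round x.1, ⌊x.2⌋ + 2), rfl, ?_, ?_⟩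
  · have h := (vertex_bounds hU (round x.1, ⌊x.2⌋ + 2)).2.1
    push_cast at h
    linarith [Int.lt_floor_add_one x.2]
  · have h := mem_box.1 (hU (round x.1, ⌊x.2⌋ + 2))
    have h1 := abs_sub_round x.1
    have h2 := Int.lt_floor_add_one x.2
    have h3 := Int.floor_le x.2
    rw [abs_le] at h1
    rw [l1Dist, vertex_fst, vertex_snd]
    push_cast
    have e1 : |(round x.1 : ℝ) + (U (round x.1, ⌊x.2⌋ + 2)).1 - x.1| ≤ 3 / 2 := by
      rw [abs_le]; constructor <;> linarith
    have e2 : |(⌊x.2⌋ : ℝ) + 2 + (U (round x.1, ⌊x.2⌋ + 2)).2 - x.2| ≤ 3 := by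
      rw [abs_le]; constructor <;> linarith
    linarith

lemma IsNextStep.dist_le {U : ℤ × ℤ → ℝ × ℝ} (hU : ∀ w, U w ∈ box) {x y : ℝ × ℝ}
    (h : IsNextStep (vertexSet U) x y) : l1Dist x y ≤ 9 / 2 := by
  obtain ⟨w, -, h1, h2⟩ := exists_vertex_near hU x
  exact (h.2.2 _ (vertex_mem U w) h1).trans h2

lemma finite_sites {U : ℤ × ℤ → ℝ × ℝ} (hU : ∀ w, U w ∈ box) (a b c d : ℝ) :
    {w | a ≤ (vertex U w).1 ∧ (vertex U w).1 ≤ b ∧ c ≤ (vertex U w).2 ∧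
      (vertex U w).2 ≤ d}.Finite := by
  refine ((Set.finite_Icc (⌈a - 1⌉) (⌊b + 1⌋)).prod (Set.finite_Icc (⌈c - 1⌉) (⌊d + 1⌋))).subset ?_
  rintro w ⟨h1, h2, h3, h4⟩
  have h := vertex_bounds hU w
  refine ⟨⟨Int.ceil_le.2 ?_, Int.le_floor.2 ?_⟩, Int.ceil_le.2 ?_, Int.le_floor.2 ?_⟩ <;>
    linarith [h.1.1, h.1.2, h.2.1, h.2.2]

lemma exists_isNextStep {U : ℤ × ℤ → ℝ × ℝ} (hU : ∀ w, U w ∈ box) (x : ℝ × ℝ) :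
    ∃ y, IsNextStep (vertexSet U) x y := by
  obtain ⟨w₀, -, h1, h2⟩ := exists_vertex_near hU x
  have hfin : {w | x.2 < (vertex U w).2 ∧ l1Dist x (vertex U w) ≤ 9 / 2}.Finite := by
    refine (finite_sites hU (x.1 - 9 / 2) (x.1 + 9 / 2) x.2 (x.2 + 9 / 2)).subset ?_
    rintro w ⟨h3, h4⟩
    rw [l1Dist_of_lt h3] at h4
    have h5 := abs_le.1 (show |(vertex U w).1 - x.1| ≤ 9 / 2 by linarith)
    have h6 := abs_nonneg ((vertex U w).1 - x.1)
    exact ⟨by linarith [h5.1], by linarith [h5.2], h3.le, by linarith⟩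
  obtain ⟨w, hw, hmin⟩ := hfin.exists_minimalFor (fun w => l1Dist x (vertex U w)) _ ⟨w₀, h1, h2⟩
  refine ⟨vertex U w, vertex_mem U w, hw.1, ?_⟩
  rintro _ ⟨w', rfl⟩ h3
  change l1Dist x (vertex U w) ≤ l1Dist x (vertex U w')
  by_contra! hlt
  exact absurd (hmin ⟨h3, hlt.le.trans hw.2⟩ hlt.le) (not_le.2 hlt)

/-- The points from which paths are followed: the lattice points and the vertices. -/
def starts (U : ℤ × ℤ → ℝ × ℝ) : Set (ℝ × ℝ) := range latticePoint ∪ vertexSet U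

/-- A configuration is generic if the next step is well defined from every lattice point and from
every vertex. -/
def Generic (U : ℤ × ℤ → ℝ × ℝ) : Prop :=
  ∀ x ∈ starts U, ∃! y, IsNextStep (vertexSet U) x y

lemma Generic.isNextStep {U : ℤ × ℤ → ℝ × ℝ} (hG : Generic U) {x : ℝ × ℝ} (hx : x ∈ starts U) :
    IsNextStep (vertexSet U) x (nextStep (vertexSet U) x) := nextStep_spec (hG x hx)

lemma Generic.nextStep_mem {U : ℤ × ℤ → ℝ × ℝ} (hG : Generic U) {x : ℝ × ℝ} (hx : x ∈ starts U) :
    nextStep (vertexSet U) x ∈ starts U := Or.inr (hG.isNextStep hx).1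

lemma Generic.iterate_mem {U : ℤ × ℤ → ℝ × ℝ} (hG : Generic U) {x : ℝ × ℝ} (hx : x ∈ starts U)
    (k : ℕ) : (nextStep (vertexSet U))^[k] x ∈ starts U := by
  induction k with
  | zero => simpa using hx
  | succ k ih =>
    rw [Function.iterate_succ_apply']
    exact hG.nextStep_mem ih

/-- The path from `x` reaches heights above `s`. -/
def Exits (V : Set (ℝ × ℝ)) (s : ℝ) (x : ℝ × ℝ) : Prop := ∃ k, s < ((nextStep V)^[k] x).2

/-- The first point of the path from `x` whose height exceeds `s`; it is `x` itself if there is no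
such point. -/
noncomputable def exitPoint (V : Set (ℝ × ℝ)) (s : ℝ) (x : ℝ × ℝ) : ℝ × ℝ :=
  (nextStep V)^[sInf {k | s < ((nextStep V)^[k] x).2}] x

lemma exits_of_lt {V : Set (ℝ × ℝ)} {s : ℝ} {x : ℝ × ℝ} (h : s < x.2) : Exits V s x := ⟨0, h⟩

lemma exitPoint_of_lt {V : Set (ℝ × ℝ)} {s : ℝ} {x : ℝ × ℝ} (h : s < x.2) :
    exitPoint V s x = x := by
  have : sInf {k | s < ((nextStep V)^[k] x).2} = 0 := Nat.sInf_eq_zero.2 (Or.inl h)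
  rw [exitPoint, this, Function.iterate_zero, id]

lemma Exits.lt_exitPoint {V : Set (ℝ × ℝ)} {s : ℝ} {x : ℝ × ℝ} (h : Exits V s x) :
    s < (exitPoint V s x).2 :=
  Nat.sInf_mem (s := {k | s < ((nextStep V)^[k] x).2}) h

lemma exists_iterate_eq_exitPoint (V : Set (ℝ × ℝ)) (s : ℝ) (x : ℝ × ℝ) :
    ∃ k, (nextStep V)^[k] x = exitPoint V s x ∧ ∀ i < k, ((nextStep V)^[i] x).2 ≤ s :=
  ⟨_, rfl, fun _ hi => not_lt.1 (Nat.notMem_of_lt_sInf hi)⟩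

lemma exitPoint_eq_iterate {V : Set (ℝ × ℝ)} {s : ℝ} {x : ℝ × ℝ} {k : ℕ}
    (hk : s < ((nextStep V)^[k] x).2) (h : ∀ i < k, ((nextStep V)^[i] x).2 ≤ s) :
    exitPoint V s x = (nextStep V)^[k] x := by
  have : sInf {k | s < ((nextStep V)^[k] x).2} = k :=
    (IsLeast.csInf_eq ⟨hk, fun i hi => not_lt.1 fun hik => absurd hi (not_lt.2 (h i hik))⟩)
  rw [exitPoint, this]

lemma Exits.iterate {V : Set (ℝ × ℝ)} {s : ℝ} {x : ℝ × ℝ} (h : Exits V s x) (k : ℕ) :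
    Exits V s ((nextStep V)^[k] x) := by
  obtain ⟨m, hm⟩ := h
  refine ⟨m, ?_⟩
  rw [← Function.iterate_add_apply]
  exact hm.trans_le (iterate_snd_mono V x (Nat.le_add_right m k))

/-- Following the path below the level `s` does not change the exit point. -/
lemma Exits.exitPoint_iterate {V : Set (ℝ × ℝ)} {s : ℝ} {x : ℝ × ℝ} (h : Exits V s x) {k : ℕ}
    (hk : ∀ i < k, ((nextStep V)^[i] x).2 ≤ s) :
    exitPoint V s ((nextStep V)^[k] x) = exitPoint V s x := by
  obtain ⟨m, hm, hm'⟩ := exists_iterate_eq_exitPoint V s x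
  have hkm : k ≤ m := by
    by_contra! hlt
    exact absurd (hk m hlt) (not_le.2 (hm ▸ h.lt_exitPoint))
  have e : (nextStep V)^[m - k] ((nextStep V)^[k] x) = exitPoint V s x := by
    rw [← Function.iterate_add_apply, Nat.sub_add_cancel hkm, hm]
  rw [← e]
  refine exitPoint_eq_iterate (e ▸ h.lt_exitPoint) fun i hi => ?_
  rw [← Function.iterate_add_apply]
  exact hm' _ (by omega)

lemma Exits.exitPoint_iterate_of_le {V : Set (ℝ × ℝ)} {s : ℝ} {x : ℝ × ℝ} (h : Exits V s x) {k : ℕ}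
    (hk : ((nextStep V)^[k] x).2 ≤ s) :
    exitPoint V s ((nextStep V)^[k] x) = exitPoint V s x :=
  h.exitPoint_iterate fun _ hi => (iterate_snd_mono V x hi.le).trans hk

lemma Exits.exitPoint_exitPoint {V : Set (ℝ × ℝ)} {s s' : ℝ} {x : ℝ × ℝ} (h : Exits V s' x)
    (hs : s ≤ s') : exitPoint V s' (exitPoint V s x) = exitPoint V s' x := by
  obtain ⟨k, hk, hk'⟩ := exists_iterate_eq_exitPoint V s x
  rw [← hk]
  exact h.exitPoint_iterate fun i hi => (hk' i hi).trans hs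

lemma Exits.exits_exitPoint {V : Set (ℝ × ℝ)} {s s' : ℝ} {x : ℝ × ℝ} (h : Exits V s' x) :
    Exits V s' (exitPoint V s x) := h.iterate _

lemma Exits.of_iterate {V : Set (ℝ × ℝ)} {s : ℝ} {x : ℝ × ℝ} {k : ℕ}
    (h : Exits V s ((nextStep V)^[k] x)) : Exits V s x := by
  obtain ⟨m, hm⟩ := h
  exact ⟨m + k, by rwa [Function.iterate_add_apply]⟩

/-- A property that persists along the steps made from heights at most `s` holds at the exit
point. -/
lemma exitPoint_induction {V : Set (ℝ × ℝ)} {s : ℝ} {x : ℝ × ℝ} {p : ℝ × ℝ → Prop} (h0 : p x)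
    (hp : ∀ y, p y → y.2 ≤ s → p (nextStep V y)) : p (exitPoint V s x) := by
  obtain ⟨k, hk, hk'⟩ := exists_iterate_eq_exitPoint V s x
  rw [← hk]
  clear hk
  induction k with
  | zero => simpa using h0
  | succ k ih =>
    rw [Function.iterate_succ_apply']
    exact hp _ (ih fun i hi => hk' i (hi.trans (Nat.lt_succ_self k))) (hk' k (Nat.lt_succ_self k))

lemma exitPoint_congr {V V' : Set (ℝ × ℝ)} {s h : ℝ} {x : ℝ × ℝ} (hx : h ≤ x.2)
    (H : ∀ y : ℝ × ℝ, h ≤ y.2 → y.2 ≤ s → nextStep V y = nextStep V' y) :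
    exitPoint V s x = exitPoint V' s x := by
  have key : ∀ k, (∀ i < k, ((nextStep V)^[i] x).2 ≤ s) →
      (nextStep V)^[k] x = (nextStep V')^[k] x := by
    intro k
    induction k with
    | zero => simp
    | succ k ih =>
      intro hk
      have e := ih fun i hi => hk i (hi.trans (Nat.lt_succ_self k))
      rw [Function.iterate_succ_apply', Function.iterate_succ_apply', ← e]
      exact H _ (hx.trans (snd_le_iterate V x k)) (hk k (Nat.lt_succ_self k))
  by_cases hE : Exits V s x
  · obtain ⟨k, hk, hk'⟩ := exists_iterate_eq_exitPoint V s x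
    rw [← hk, key k hk']
    refine (exitPoint_eq_iterate ?_ fun i hi => ?_).symm
    · rw [← key k hk', hk]; exact hE.lt_exitPoint
    · rw [← key i fun i' hi' => hk' i' (hi'.trans hi)]; exact hk' i hi
  · have h1 : ∀ k, ((nextStep V)^[k] x).2 ≤ s := fun k => not_lt.1 fun hk => hE ⟨k, hk⟩
    have e1 : {k | s < ((nextStep V)^[k] x).2} = ∅ :=
      eq_empty_of_forall_notMem fun k hk => absurd hk (not_lt.2 (h1 k))
    have e2 : {k | s < ((nextStep V')^[k] x).2} = ∅ :=
      eq_empty_of_forall_notMem fun k hk => absurd hk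
        (not_lt.2 ((key k fun i _ => h1 i) ▸ h1 k))
    rw [exitPoint, exitPoint, e1, e2, Nat.sInf_empty]
    simp

/-- A path that stays in a bounded range of abscissae reaches every height, since a bounded region
contains finitely many vertices. -/
lemma Generic.exits_of_confined {U : ℤ × ℤ → ℝ × ℝ} (hU : ∀ w, U w ∈ box) (hG : Generic U)
    {x : ℝ × ℝ} (hx : x ∈ starts U) {s a b : ℝ} {p : ℝ × ℝ → Prop} (h0 : p x)
    (hp : ∀ y ∈ starts U, p y → y.2 ≤ s → p (nextStep (vertexSet U) y))
    (hab : ∀ y, p y → a ≤ y.1 ∧ y.1 ≤ b) : Exits (vertexSet U) s x := by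
  by_contra hE
  set f := fun k => (nextStep (vertexSet U))^[k] x with hf
  have h1 : ∀ k, (f k).2 ≤ s := fun k => not_lt.1 fun hk => hE ⟨k, hk⟩
  have h2 : ∀ k, p (f k) := by
    intro k
    induction k with
    | zero => simpa [hf] using h0
    | succ k ih =>
      simp only [hf, Function.iterate_succ_apply']
      exact hp _ (hG.iterate_mem hx k) ih (h1 k)
  have hmono : StrictMono fun k => (f k).2 := strictMono_nat_of_lt_succ fun k => by
    simp only [hf, Function.iterate_succ_apply']
    exact (hG.isNextStep (hG.iterate_mem hx k)).2.1
  have h3 : ∀ k, ∃ w, vertex U w = f (k + 1) := fun k => by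
    have := (hG.isNextStep (hG.iterate_mem hx k)).1
    simp only [hf, Function.iterate_succ_apply']
    exact this
  choose w hw using h3
  have hinj : Function.Injective w := fun i j hij => by
    have : f (i + 1) = f (j + 1) := by rw [← hw, ← hw, hij]
    have := hmono.injective (congrArg Prod.snd this)
    omega
  refine Set.infinite_range_of_injective hinj ((finite_sites hU a b x.2 s).subset ?_)
  rintro _ ⟨k, rfl⟩
  simp only [mem_ofPred_eq, hw]
  exact ⟨(hab _ (h2 _)).1, (hab _ (h2 _)).2, snd_le_iterate _ _ _, h1 _⟩

/-! ### Locality and reflection -/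

/-- The sites in the rows up to `n`. -/
def rowsLE (n : ℤ) : Set (ℤ × ℤ) := {w | w.2 ≤ n}

/-- The sites in the rows above `n`. -/
def rowsGT (n : ℤ) : Set (ℤ × ℤ) := {w | n < w.2}

lemma nextStep_rowsLE {U : ℤ × ℤ → ℝ × ℝ} (hU : ∀ w, U w ∈ box) {n : ℤ} {x : ℝ × ℝ}
    (hx : x.2 ≤ n - 7) : nextStep (vertexSet U) x = nextStep (vertices U (rowsLE n)) x := by
  obtain ⟨w₀, h0, h1, h2⟩ := exists_vertex_near hU x
  have hw₀ : w₀ ∈ rowsLE n := by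
    have h3 := Int.floor_le x.2
    have h4 : ((⌊x.2⌋ + 2 : ℤ) : ℝ) ≤ n := by push_cast; linarith
    rw [rowsLE, mem_ofPred_eq, h0]
    exact_mod_cast h4
  refine nextStep_congr fun y => ⟨fun hy => ⟨?_, hy.2.1, ?_⟩, fun hy => ⟨?_, hy.2.1, ?_⟩⟩
  · obtain ⟨w, rfl⟩ := hy.1
    refine ⟨w, ?_, rfl⟩
    have h3 := hy.dist_le hU
    rw [l1Dist_of_lt hy.2.1] at h3
    have h4 := abs_nonneg ((latticePoint w + U w).1 - x.1)
    have h5 := (vertex_bounds hU w).2.1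
    rw [vertex] at h5
    have h6 : (w.2 : ℝ) ≤ n := by linarith
    exact_mod_cast h6
  · rintro z ⟨w, -, rfl⟩ hz
    exact hy.2.2 _ (vertex_mem U w) hz
  · obtain ⟨w, -, rfl⟩ := hy.1
    exact vertex_mem U w
  · rintro z ⟨w, rfl⟩ hz
    by_cases hw : w ∈ rowsLE n
    · exact hy.2.2 _ ⟨w, hw, rfl⟩ hz
    · have h3 := hy.2.2 _ ⟨w₀, hw₀, rfl⟩ h1
      have h4 : (n : ℝ) + 1 ≤ w.2 := by
        have : n + 1 ≤ w.2 := by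
          simp only [rowsLE, mem_ofPred_eq, not_le] at hw
          omega
        exact_mod_cast this
      have h5 := (vertex_bounds hU w).2.1
      rw [vertex] at h5
      have h6 := abs_nonneg ((latticePoint w + U w).1 - x.1)
      change l1Dist x y ≤ l1Dist x (latticePoint w + U w)
      rw [l1Dist_of_lt hz]
      linarith

lemma nextStep_rowsGT {U : ℤ × ℤ → ℝ × ℝ} (hU : ∀ w, U w ∈ box) {n : ℤ} {x : ℝ × ℝ}
    (hx : (n : ℝ) + 1 ≤ x.2) : nextStep (vertexSet U) x = nextStep (vertices U (rowsGT n)) x := by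
  have key : ∀ w, x.2 < (vertex U w).2 → w ∈ rowsGT n := fun w hw => by
    have h5 := (vertex_bounds hU w).2.2
    have h6 : (n : ℝ) < w.2 := by linarith
    exact_mod_cast h6
  refine nextStep_congr fun y => ⟨fun hy => ⟨?_, hy.2.1, ?_⟩, fun hy => ⟨?_, hy.2.1, ?_⟩⟩
  · obtain ⟨w, rfl⟩ := hy.1
    exact ⟨w, key w hy.2.1, rfl⟩
  · rintro z ⟨w, -, rfl⟩ hz
    exact hy.2.2 _ (vertex_mem U w) hz
  · obtain ⟨w, -, rfl⟩ := hy.1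
    exact vertex_mem U w
  · rintro z ⟨w, rfl⟩ hz
    exact hy.2.2 _ ⟨w, key w hz, rfl⟩ hz

lemma exitPoint_rowsLE {U : ℤ × ℤ → ℝ × ℝ} (hU : ∀ w, U w ∈ box) {n : ℤ} {s : ℝ}
    (hs : s ≤ n - 7) (x : ℝ × ℝ) :
    exitPoint (vertexSet U) s x = exitPoint (vertices U (rowsLE n)) s x :=
  exitPoint_congr le_rfl fun _ _ hy => nextStep_rowsLE hU (hy.trans hs)

lemma exitPoint_rowsGT {U : ℤ × ℤ → ℝ × ℝ} (hU : ∀ w, U w ∈ box) {n : ℤ} {s : ℝ}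
    {x : ℝ × ℝ} (hx : (n : ℝ) + 1 ≤ x.2) :
    exitPoint (vertexSet U) s x = exitPoint (vertices U (rowsGT n)) s x :=
  exitPoint_congr hx fun _ hy _ => nextStep_rowsGT hU hy

/-- The reflection of the plane about the vertical line of abscissa `c`. -/
def reflect (c : ℝ) (x : ℝ × ℝ) : ℝ × ℝ := (2 * c - x.1, x.2)

lemma reflect_reflect (c : ℝ) (x : ℝ × ℝ) : reflect c (reflect c x) = x := by
  ext <;> simp [reflect]

lemma l1Dist_reflect (c : ℝ) (x y : ℝ × ℝ) : l1Dist (reflect c x) (reflect c y) = l1Dist x y := by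
  simp only [l1Dist, reflect]
  congr 1
  rw [← abs_neg]
  congr 1
  ring

lemma isNextStep_reflect {V : Set (ℝ × ℝ)} (c : ℝ) {x y : ℝ × ℝ} (h : IsNextStep V x y) :
    IsNextStep (reflect c '' V) (reflect c x) (reflect c y) := by
  refine ⟨⟨y, h.1, rfl⟩, h.2.1, ?_⟩
  rintro _ ⟨z, hz, rfl⟩ hlt
  rw [l1Dist_reflect, l1Dist_reflect]
  exact h.2.2 z hz hlt

lemma isNextStep_reflect_iff {V : Set (ℝ × ℝ)} (c : ℝ) {x y : ℝ × ℝ} :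
    IsNextStep (reflect c '' V) (reflect c x) (reflect c y) ↔ IsNextStep V x y := by
  refine ⟨fun h => ?_, isNextStep_reflect c⟩
  have := isNextStep_reflect c h
  rwa [← image_comp, show reflect c ∘ reflect c = id from funext (reflect_reflect c), image_id,
    reflect_reflect, reflect_reflect] at this

lemma nextStep_reflect (V : Set (ℝ × ℝ)) (c : ℝ) (x : ℝ × ℝ) :
    nextStep (reflect c '' V) (reflect c x) = reflect c (nextStep V x) := by
  by_cases h : ∃! y, IsNextStep V x y
  · have h' : ∃! y, IsNextStep (reflect c '' V) (reflect c x) y := by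
      obtain ⟨y, hy, hy'⟩ := h
      refine ⟨reflect c y, isNextStep_reflect c hy, fun z hz => ?_⟩
      rw [← reflect_reflect c z, isNextStep_reflect_iff] at hz
      rw [← hy' _ hz, reflect_reflect]
    exact nextStep_eq h' (isNextStep_reflect c (nextStep_spec h))
  · have h' : ¬ ∃! y, IsNextStep (reflect c '' V) (reflect c x) y := by
      rintro ⟨y, hy, hy'⟩
      refine h ⟨reflect c y, ?_, fun z hz => ?_⟩
      · change IsNextStep V x (reflect c y)
        rwa [← isNextStep_reflect_iff c, reflect_reflect]
      · rw [← hy' _ (isNextStep_reflect c hz), reflect_reflect]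
    rw [nextStep, dif_neg h', nextStep, dif_neg h]

lemma exitPoint_reflect (V : Set (ℝ × ℝ)) (c s : ℝ) (x : ℝ × ℝ) :
    exitPoint (reflect c '' V) s (reflect c x) = reflect c (exitPoint V s x) := by
  have key : ∀ k, (nextStep (reflect c '' V))^[k] (reflect c x) =
      reflect c ((nextStep V)^[k] x) := by
    intro k
    induction k with
    | zero => rfl
    | succ k ih => rw [Function.iterate_succ_apply', Function.iterate_succ_apply', ih,
        nextStep_reflect]
  simp only [exitPoint, key]
  rfl

/-! ### Paths do not cross -/

/-- The abscissa at height `t` of the line through `x` and `y`. -/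
noncomputable def lineAt (x y : ℝ × ℝ) (t : ℝ) : ℝ :=
  x.1 + (t - x.2) / (y.2 - x.2) * (y.1 - x.1)

lemma lineAt_left (x y : ℝ × ℝ) : lineAt x y x.2 = x.1 := by simp [lineAt]

lemma lineAt_right {x y : ℝ × ℝ} (h : x.2 < y.2) : lineAt x y y.2 = y.1 := by
  rw [lineAt, div_self (sub_pos.2 h).ne']; ring

lemma continuous_lineAt (x y : ℝ × ℝ) : Continuous (lineAt x y) := by
  unfold lineAt; fun_prop

/-- A point of a segment splits its `ℓ¹` length. -/
lemma l1Dist_lineAt_add {x y : ℝ × ℝ} (h : x.2 < y.2) {t : ℝ} (h1 : x.2 ≤ t) (h2 : t ≤ y.2) :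
    l1Dist x (lineAt x y t, t) + l1Dist (lineAt x y t, t) y = l1Dist x y := by
  have hp : 0 < y.2 - x.2 := sub_pos.2 h
  set r := (t - x.2) / (y.2 - x.2) with hr
  have hr0 : 0 ≤ r := div_nonneg (sub_nonneg.2 h1) hp.le
  have hr1 : r ≤ 1 := (div_le_one hp).2 (by linarith)
  have ht : t = x.2 + r * (y.2 - x.2) := by rw [hr, div_mul_cancel₀ _ hp.ne']; ring
  have e1 : lineAt x y t - x.1 = r * (y.1 - x.1) := by rw [lineAt]; ring
  have e2 : y.1 - lineAt x y t = (1 - r) * (y.1 - x.1) := by rw [lineAt]; ring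
  have e3 : t - x.2 = r * (y.2 - x.2) := by linarith
  have e4 : y.2 - t = (1 - r) * (y.2 - x.2) := by linarith
  simp only [l1Dist, e1, e2, e3, e4, abs_mul, abs_of_nonneg hr0, abs_of_nonneg (sub_nonneg.2 hr1)]
  ring

lemma l1Dist_triangle (x y z : ℝ × ℝ) : l1Dist x z ≤ l1Dist x y + l1Dist y z := by
  simp only [l1Dist]
  have h1 := abs_sub_le z.1 y.1 x.1
  have h2 := abs_sub_le z.2 y.2 x.2
  linarith

lemma l1Dist_nonneg (x y : ℝ × ℝ) : 0 ≤ l1Dist x y := by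
  unfold l1Dist; positivity

lemma abs_lineAt_sub_le {x y : ℝ × ℝ} (h : x.2 < y.2) {t : ℝ} (h1 : x.2 ≤ t) (h2 : t ≤ y.2) :
    |y.1 - lineAt x y t| ≤ l1Dist x y := by
  have := l1Dist_lineAt_add h h1 h2
  have h3 := l1Dist_nonneg x (lineAt x y t, t)
  have h4 : |y.1 - lineAt x y t| ≤ l1Dist (lineAt x y t, t) y := by
    rw [l1Dist]; simp
  linarith

lemma eq_or_eq_of_meet_at_top {V : Set (ℝ × ℝ)} {x x' y y' : ℝ × ℝ} (hy : ∃! z, IsNextStep V y z)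
    (hx' : IsNextStep V x x') (hy' : IsNextStep V y y') (h1 : y.2 ≤ x'.2) (h2 : x'.2 ≤ y'.2)
    (hm : lineAt x x' x'.2 = lineAt y y' x'.2) : x' = y' ∨ x' = y := by
  rw [lineAt_right hx'.2.1] at hm
  rcases h1.lt_or_eq with h | h
  · left
    have h3 := l1Dist_lineAt_add hy'.2.1 h1 h2
    rw [← hm] at h3
    have h4 := l1Dist_nonneg (x'.1, x'.2) y'
    refine hy.unique ⟨hx'.1, h, fun z hz hlt => le_trans ?_ (hy'.2.2 z hz hlt)⟩ hy'
    change l1Dist y (x'.1, x'.2) ≤ _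
    linarith
  · right
    rw [← h, lineAt_left] at hm
    exact Prod.ext hm h.symm

/-- Two edges that meet have the same upper endpoint, or one starts where the other ends. -/
lemma eq_or_eq_or_eq_of_meet {V : Set (ℝ × ℝ)} {x x' y y' : ℝ × ℝ}
    (hx : ∃! z, IsNextStep V x z) (hy : ∃! z, IsNextStep V y z)
    (hx' : IsNextStep V x x') (hy' : IsNextStep V y y') {t : ℝ} (h1 : x.2 ≤ t) (h2 : y.2 ≤ t)
    (h3 : t ≤ x'.2) (h4 : t ≤ y'.2) (hm : lineAt x x' t = lineAt y y' t) :
    x' = y' ∨ x' = y ∨ y' = x := by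
  rcases h3.lt_or_eq with h3' | rfl
  · rcases h4.lt_or_eq with h4' | rfl
    · left
      have e1 := l1Dist_lineAt_add hx'.2.1 h1 h3
      have e2 := l1Dist_lineAt_add hy'.2.1 h2 h4
      rw [← hm] at e2
      have t1 := l1Dist_triangle x (lineAt x x' t, t) y'
      have t2 := l1Dist_triangle y (lineAt x x' t, t) x'
      have m1 := hx'.2.2 y' hy'.1 (h1.trans_lt h4')
      have m2 := hy'.2.2 x' hx'.1 (h2.trans_lt h3')
      refine hx.unique hx' ⟨hy'.1, h1.trans_lt h4', fun z hz hlt =>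
        le_trans ?_ (hx'.2.2 z hz hlt)⟩
      linarith
    · rcases eq_or_eq_of_meet_at_top hx hy' hx' h1 h3 hm.symm with h | h
      · exact Or.inl h.symm
      · exact Or.inr (Or.inr h)
  · rcases eq_or_eq_of_meet_at_top hy hx' hy' h2 h4 hm with h | h
    · exact Or.inl h
    · exact Or.inr (Or.inl h)

/-- The edge `x x'` passes strictly to the left of the edge `y y'` at the lowest height that both
reach. -/
def EdgeLeft (x x' y y' : ℝ × ℝ) : Prop :=
  x.2 ≤ y'.2 ∧ y.2 ≤ x'.2 ∧ lineAt x x' (max x.2 y.2) < lineAt y y' (max x.2 y.2)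

/-- Two paths are followed edge by edge, the lower one being advanced. As long as no two edges meet,
the order of the edges persists. -/
lemma edgeLeft_induction {a b : ℕ → ℝ × ℝ} {s : ℝ} {I J : ℕ} {P : Prop}
    (ha : ∀ i, (a i).2 < (a (i + 1)).2) (hb : ∀ j, (b j).2 < (b (j + 1)).2)
    (haI : ∀ i ≤ I, (a i).2 ≤ s) (hbJ : ∀ j ≤ J, (b j).2 ≤ s) (haI' : s < (a (I + 1)).2)
    (hbJ' : s < (b (J + 1)).2)
    (hmeet : ∀ i ≤ I, ∀ j ≤ J, ∀ t, (a i).2 ≤ t → (b j).2 ≤ t → t ≤ (a (i + 1)).2 →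
      t ≤ (b (j + 1)).2 → lineAt (a i) (a (i + 1)) t = lineAt (b j) (b (j + 1)) t → P) :
    ∀ n i j, i ≤ I → j ≤ J → (I - i) + (J - j) = n →
      EdgeLeft (a i) (a (i + 1)) (b j) (b (j + 1)) →
      P ∨ EdgeLeft (a I) (a (I + 1)) (b J) (b (J + 1)) := by
  intro n
  induction n with
  | zero =>
    intro i j hi hj hn h
    obtain rfl : i = I := by omega
    obtain rfl : j = J := by omega
    exact Or.inr h
  | succ n ih =>
    intro i j hi hj hn h
    set t₀ := max (a i).2 (b j).2 with ht₀
    set t₁ := min (a (i + 1)).2 (b (j + 1)).2 with ht₁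
    have h01 : t₀ ≤ t₁ := max_le (le_min (ha i).le h.1) (le_min h.2.1 (hb j).le)
    -- If the order persists up to `t₁`, the edge that ends there is replaced by its successor.
    by_cases hlt : lineAt (a i) (a (i + 1)) t₁ < lineAt (b j) (b (j + 1)) t₁
    · rcases le_total (a (i + 1)).2 (b (j + 1)).2 with hle | hle
      · have e : t₁ = (a (i + 1)).2 := min_eq_left hle
        have hiI : i < I := by
          by_contra! hcon
          obtain rfl : i = I := by omega
          have : s < (b (j + 1)).2 := haI'.trans_le hle
          have : ¬ j + 1 ≤ J := fun hc => absurd (hbJ _ hc) (not_le.2 this)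
          omega
        refine ih (i + 1) j hiI hj (by omega) ⟨hle, h.2.1.trans (ha (i + 1)).le, ?_⟩
        rw [max_eq_left h.2.1, lineAt_left, ← lineAt_right (ha i), ← e]
        exact hlt
      · have e : t₁ = (b (j + 1)).2 := min_eq_right hle
        have hjJ : j < J := by
          by_contra! hcon
          obtain rfl : j = J := by omega
          have : s < (a (i + 1)).2 := hbJ'.trans_le hle
          have : ¬ i + 1 ≤ I := fun hc => absurd (haI _ hc) (not_le.2 this)
          omega
        refine ih i (j + 1) hi hjJ (by omega) ⟨h.1.trans (hb (j + 1)).le, hle, ?_⟩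
        rw [max_eq_right h.1, lineAt_left, ← lineAt_right (hb j), ← e]
        exact hlt
    · left
      -- The order of the two edges is reversed at `t₁`, so they meet.
      have hcont : ContinuousOn (fun t => lineAt (b j) (b (j + 1)) t - lineAt (a i) (a (i + 1)) t)
          (Icc t₀ t₁) :=
        ((continuous_lineAt _ _).sub (continuous_lineAt _ _)).continuousOn
      obtain ⟨t, ht, ht'⟩ := intermediate_value_Icc' h01 hcont
        (show (0 : ℝ) ∈ Icc _ _ from ⟨by linarith [not_lt.1 hlt], by linarith [h.2.2]⟩)
      exact hmeet i hi j hj t ((le_max_left _ _).trans ht.1) ((le_max_right _ _).trans ht.1)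
        (ht.2.trans (min_le_left _ _)) (ht.2.trans (min_le_right _ _))
        (by linarith [show lineAt (b j) (b (j + 1)) t - lineAt (a i) (a (i + 1)) t = 0 from ht'])

lemma Exits.exists_last {V : Set (ℝ × ℝ)} {s : ℝ} {x : ℝ × ℝ} (h : Exits V s x) (hx : x.2 ≤ s) :
    ∃ I, exitPoint V s x = (nextStep V)^[I + 1] x ∧ ∀ i ≤ I, ((nextStep V)^[i] x).2 ≤ s := by
  obtain ⟨k, hk, hk'⟩ := exists_iterate_eq_exitPoint V s x
  cases k with
  | zero =>
    have := h.lt_exitPoint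
    rw [← hk] at this
    exact absurd this (not_lt.2 hx)
  | succ I => exact ⟨I, hk.symm, fun i hi => hk' i (Nat.lt_succ_of_le hi)⟩

/-- Two paths started at the same height leave every level at the same vertex or, up to the length
of two steps, in the order in which they started. -/
lemma Generic.exitPoint_order {U : ℤ × ℤ → ℝ × ℝ} (hU : ∀ w, U w ∈ box) (hG : Generic U) {s : ℝ}
    {x y : ℝ × ℝ} (hx : x ∈ starts U) (hy : y ∈ starts U) (hxy : x.2 = y.2) (hlt : x.1 < y.1)
    (hEx : Exits (vertexSet U) s x) (hEy : Exits (vertexSet U) s y) :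
    exitPoint (vertexSet U) s x = exitPoint (vertexSet U) s y ∨
      (exitPoint (vertexSet U) s x).1 ≤ (exitPoint (vertexSet U) s y).1 + 9 := by
  rcases lt_or_ge s x.2 with hs | hs
  · right
    rw [exitPoint_of_lt hs, exitPoint_of_lt (hxy ▸ hs)]
    linarith
  obtain ⟨I, hI, hI'⟩ := hEx.exists_last hs
  obtain ⟨J, hJ, hJ'⟩ := hEy.exists_last (hxy ▸ hs)
  set V := vertexSet U with hV
  set a := fun i => (nextStep V)^[i] x with ha
  set b := fun i => (nextStep V)^[i] y with hb
  have sa : ∀ i, IsNextStep V (a i) (a (i + 1)) := fun i => by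
    simp only [ha, Function.iterate_succ_apply']
    exact hG.isNextStep (hG.iterate_mem hx i)
  have sb : ∀ i, IsNextStep V (b i) (b (i + 1)) := fun i => by
    simp only [hb, Function.iterate_succ_apply']
    exact hG.isNextStep (hG.iterate_mem hy i)
  have ea : ∀ i ≤ I + 1, exitPoint V s (a i) = exitPoint V s x := fun i hi =>
    hEx.exitPoint_iterate fun i' hi' => hI' _ (by omega)
  have eb : ∀ i ≤ J + 1, exitPoint V s (b i) = exitPoint V s y := fun i hi =>
    hEy.exitPoint_iterate fun i' hi' => hJ' _ (by omega)
  have haI : s < (a (I + 1)).2 := by have := hEx.lt_exitPoint; rwa [hI] at this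
  have hbJ : s < (b (J + 1)).2 := by have := hEy.lt_exitPoint; rwa [hJ] at this
  have key := edgeLeft_induction (P := exitPoint V s x = exitPoint V s y)
    (fun i => (sa i).2.1) (fun j => (sb j).2.1) hI' hJ' haI hbJ
    (fun i hi j hj t h1 h2 h3 h4 hm => by
      rcases eq_or_eq_or_eq_of_meet (hG _ (hG.iterate_mem hx i)) (hG _ (hG.iterate_mem hy j))
        (sa i) (sb j) h1 h2 h3 h4 hm with h | h | h
      · rw [← ea (i + 1) (by omega), h, eb (j + 1) (by omega)]
      · rw [← ea (i + 1) (by omega), h, eb j (by omega)]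
      · exact (ea i (by omega)).symm.trans ((congrArg _ h.symm).trans (eb (j + 1) (by omega))))
    _ 0 0 (Nat.zero_le _) (Nat.zero_le _) rfl
    ⟨by have := (sb 0).2.1; simp only [hb, ha, Function.iterate_zero, id] at this ⊢; linarith,
     by have := (sa 0).2.1; simp only [hb, ha, Function.iterate_zero, id] at this ⊢; linarith,
     by
      have e1 : max (a 0).2 (b 0).2 = (a 0).2 := by
        simp [ha, hb, hxy]
      have e2 : (a 0).2 = (b 0).2 := hxy
      rw [e1, lineAt_left, e2, lineAt_left]
      exact hlt⟩
  refine key.imp id fun h => ?_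
  have m1 : max (a I).2 (b J).2 ≤ s := max_le (hI' I le_rfl) (hJ' J le_rfl)
  have d1 := (abs_le.1 ((abs_lineAt_sub_le (sa I).2.1 (le_max_left _ (b J).2)
    (m1.trans haI.le)).trans ((sa I).dist_le hU))).2
  have d2 := (abs_le.1 ((abs_lineAt_sub_le (sb J).2.1 (le_max_right (a I).2 _)
    (m1.trans hbJ.le)).trans ((sb J).dist_le hU))).1
  have h3 := h.2.2
  rw [hI, hJ]
  change (a (I + 1)).1 ≤ (b (J + 1)).1 + 9
  linarith

lemma Generic.exitPoint_snd_le {U : ℤ × ℤ → ℝ × ℝ} (hU : ∀ w, U w ∈ box) (hG : Generic U) {s : ℝ}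
    {x : ℝ × ℝ} (hx : x ∈ starts U) (hs : x.2 ≤ s) :
    (exitPoint (vertexSet U) s x).2 ≤ s + 9 / 2 := by
  refine (exitPoint_induction (p := fun y => y ∈ starts U ∧ y.2 ≤ s + 9 / 2)
    ⟨hx, by linarith⟩ fun y hy hys => ⟨hG.nextStep_mem hy.1, ?_⟩).2
  have h := hG.isNextStep hy.1
  have h1 := h.dist_le hU
  rw [l1Dist_of_lt h.2.1] at h1
  have h2 := abs_nonneg ((nextStep (vertexSet U) y).1 - y.1)
  linarith

lemma exitPoint_mem_path (V : Set (ℝ × ℝ)) (s : ℝ) (x : ℝ × ℝ) :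
    exitPoint V s x ∈ path V x :=
  mem_iUnion.2 ⟨_, left_mem_segment ℝ _ _⟩

/-- Paths that leave a level at the same vertex have met by the height of that vertex. -/
lemma coalescingTime_le_of_exitPoint_eq {V : Set (ℝ × ℝ)} {s : ℝ} {x y : ℝ × ℝ}
    (h : exitPoint V s x = exitPoint V s y) :
    coalescingTime V x y ≤ ((exitPoint V s x).2 : EReal) := by
  refine sInf_le ⟨(exitPoint V s x).2, ⟨snd_le_iterate V x _, (exitPoint V s x).1, ?_, ?_⟩, rfl⟩
  · exact exitPoint_mem_path V s x
  · rw [h]; exact exitPoint_mem_path V s y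

/-! ### Columns and walls -/

/-- A vertical line of abscissa `c` that is densely occupied by vertices between the heights `h₁`
and `h₂`, while no other vertex is within distance `3 / 2` of it. -/
structure IsColumn (V : Set (ℝ × ℝ)) (c h₁ h₂ : ℝ) : Prop where
  dense : ∀ y, h₁ ≤ y → y ≤ h₂ → ∃ z ∈ V, |z.1 - c| ≤ 1 / 16 ∧ y < z.2 ∧ z.2 ≤ y + 13 / 10
  gap : ∀ z ∈ V, h₁ < z.2 → z.2 ≤ h₂ + 3 / 2 → |z.1 - c| < 3 / 2 → |z.1 - c| ≤ 1 / 16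

/-- A step cannot cross a column from left to right: a vertex of the column would be closer than
the endpoint of the step. -/
lemma IsColumn.fst_le {V : Set (ℝ × ℝ)} {c h₁ h₂ : ℝ} (hC : IsColumn V c h₁ h₂) {x y : ℝ × ℝ}
    (h : IsNextStep V x y) (h1 : h₁ ≤ x.2) (h2 : x.2 ≤ h₂) (hx : x.1 ≤ c + 1 / 16) :
    y.1 ≤ c + 1 / 16 := by
  by_contra! hlt
  obtain ⟨z, hz, hzc, hz1, hz2⟩ := hC.dense x.2 h1 h2
  have hd := h.2.2 z hz hz1
  rw [l1Dist_of_lt h.2.1, l1Dist_of_lt hz1] at hd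
  have hy := h.2.1
  have e1 : |y.1 - x.1| = y.1 - x.1 := abs_of_nonneg (by linarith)
  have hzc' := abs_le.1 hzc
  have e2 : |z.1 - x.1| ≤ max (c + 1 / 16 - x.1) (1 / 8) := by
    rcases le_total x.1 z.1 with h3 | h3
    · rw [abs_of_nonneg (by linarith)]; exact le_max_of_le_left (by linarith)
    · rw [abs_of_nonpos (by linarith)]; exact le_max_of_le_right (by linarith)
  have e3 : y.2 ≤ h₂ + 3 / 2 := by
    rcases max_cases (c + 1 / 16 - x.1) (1 / 8 : ℝ) with h3 | h3 <;> linarith [h3.1]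
  have e4 : ¬ |y.1 - c| < 3 / 2 := fun h3 => by
    have := (abs_le.1 (hC.gap y h.1 (h1.trans_lt hy) e3 h3)).2
    linarith
  have e5 : c + 3 / 2 ≤ y.1 := by
    by_contra! h3
    exact e4 (abs_lt.2 ⟨by linarith, by linarith⟩)
  rcases max_cases (c + 1 / 16 - x.1) (1 / 8 : ℝ) with h3 | h3 <;> linarith [h3.1]

lemma IsColumn.reflect {V : Set (ℝ × ℝ)} {c h₁ h₂ : ℝ} (hC : IsColumn V c h₁ h₂) :
    IsColumn (PerturbedDSF.reflect 0 '' V) (-c) h₁ h₂ := by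
  have e : ∀ z : ℝ × ℝ, |(PerturbedDSF.reflect 0 z).1 - -c| = |z.1 - c| := fun z => by
    rw [← abs_neg]; congr 1; simp only [PerturbedDSF.reflect]; ring
  refine ⟨fun y h1 h2 => ?_, ?_⟩
  · obtain ⟨z, hz, h3⟩ := hC.dense y h1 h2
    exact ⟨_, ⟨z, hz, rfl⟩, by rw [e]; exact h3⟩
  · rintro _ ⟨z, hz, rfl⟩ h1 h2 h3
    rw [e] at h3 ⊢
    exact hC.gap z hz h1 h2 h3

lemma IsColumn.le_fst {V : Set (ℝ × ℝ)} {c h₁ h₂ : ℝ} (hC : IsColumn V c h₁ h₂) {x y : ℝ × ℝ}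
    (h : IsNextStep V x y) (h1 : h₁ ≤ x.2) (h2 : x.2 ≤ h₂) (hx : c - 1 / 16 ≤ x.1) :
    c - 1 / 16 ≤ y.1 := by
  have := hC.reflect.fst_le (isNextStep_reflect 0 h) h1 h2
    (show 2 * 0 - x.1 ≤ -c + 1 / 16 by linarith)
  change 2 * 0 - y.1 ≤ -c + 1 / 16 at this
  linarith

/-- The perturbations that build a column out of the sites at horizontal offset `d`, `|d| ≤ 5`,
from it: the central sites stay near their lattice points, the others are pushed away from the
column and downwards. -/
def columnSet (d : ℤ) : Set (ℝ × ℝ) :=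
  if d = 0 then Icc (-1 / 16) (1 / 16) ×ˢ Icc (-1 / 16) (1 / 16)
  else if 0 < d then Icc (1 / 2) 1 ×ˢ Icc (-1) (-1 / 2)
  else Icc (-1) (-1 / 2) ×ˢ Icc (-1) (-1 / 2)

lemma columnSet_zero {a : ℝ × ℝ} (h : a ∈ columnSet 0) :
    (-1 / 16 ≤ a.1 ∧ a.1 ≤ 1 / 16) ∧ (-1 / 16 ≤ a.2 ∧ a.2 ≤ 1 / 16) := by
  rw [columnSet, if_pos rfl] at h; exact h

lemma columnSet_pos {d : ℤ} (hd : 0 < d) {a : ℝ × ℝ} (h : a ∈ columnSet d) :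
    (1 / 2 ≤ a.1 ∧ a.1 ≤ 1) ∧ (-1 ≤ a.2 ∧ a.2 ≤ -1 / 2) := by
  rw [columnSet, if_neg hd.ne', if_pos hd] at h; exact h

lemma columnSet_neg {d : ℤ} (hd : d < 0) {a : ℝ × ℝ} (h : a ∈ columnSet d) :
    (-1 ≤ a.1 ∧ a.1 ≤ -1 / 2) ∧ (-1 ≤ a.2 ∧ a.2 ≤ -1 / 2) := by
  rw [columnSet, if_neg hd.ne, if_neg hd.not_gt] at h; exact h

/-- The sites in the rows `a + 1, …, b` at horizontal distance at most `5` from `c`. -/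
def strip (c a b : ℤ) : Set (ℤ × ℤ) := {w | (a < w.2 ∧ w.2 ≤ b) ∧ |w.1 - c| ≤ 5}

/-- The configuration has a wall at abscissa `c` in the rows `a + 1, …, b`. -/
def IsWall (U : ℤ × ℤ → ℝ × ℝ) (c a b : ℤ) : Prop := ∀ w ∈ strip c a b, U w ∈ columnSet (w.1 - c)

lemma IsWall.mono {U : ℤ × ℤ → ℝ × ℝ} {c a b b' : ℤ} (h : IsWall U c a b) (hb : b' ≤ b) :
    IsWall U c a b' := fun w hw => h w ⟨⟨hw.1.1, hw.1.2.trans hb⟩, hw.2⟩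

lemma IsWall.dense {U : ℤ × ℤ → ℝ × ℝ} {c a b : ℤ} (hW : IsWall U c a b) {y : ℝ}
    (h1 : (a : ℝ) ≤ y) (h2 : y + 1 / 16 < b) :
    ∃ z ∈ vertexSet U, |z.1 - c| ≤ 1 / 16 ∧ y < z.2 ∧ z.2 ≤ y + 13 / 10 := by
  have f1 := Int.floor_le (y + 1 / 16)
  have f2 := Int.lt_floor_add_one (y + 1 / 16)
  have g1 : a ≤ ⌊y + 1 / 16⌋ := Int.le_floor.2 (by linarith)
  have g2 : ⌊y + 1 / 16⌋ < b := Int.floor_lt.2 h2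
  have h := hW (c, ⌊y + 1 / 16⌋ + 1) ⟨⟨by change a < ⌊y + 1 / 16⌋ + 1; omega,
    by change ⌊y + 1 / 16⌋ + 1 ≤ b; omega⟩, by simp⟩
  rw [show ((c, ⌊y + 1 / 16⌋ + 1) : ℤ × ℤ).1 - c = 0 from sub_self c] at h
  replace h := columnSet_zero h
  refine ⟨vertex U (c, ⌊y + 1 / 16⌋ + 1), vertex_mem _ _, ?_, ?_, ?_⟩
  · rw [vertex_fst, abs_le]; constructor <;> simp <;> linarith
  · rw [vertex_snd]; push_cast; linarith
  · rw [vertex_snd]; push_cast; linarith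

/-- A perturbed site whose vertex is close to the abscissa `c` is at horizontal offset `0`. -/
lemma abs_fst_le_of_columnSet {U : ℤ × ℤ → ℝ × ℝ} {c : ℤ} {w : ℤ × ℤ}
    (h : U w ∈ columnSet (w.1 - c)) (hlt : |(vertex U w).1 - c| < 3 / 2) :
    w.1 = c ∧ |(vertex U w).1 - c| ≤ 1 / 16 := by
  rw [vertex_fst] at hlt ⊢
  have hlt' := abs_lt.1 hlt
  rcases lt_trichotomy (w.1 - c) 0 with hd | hd | hd
  · have h1 := columnSet_neg hd h
    have h2 : (w.1 : ℝ) + 1 ≤ c := by exact_mod_cast (by omega : w.1 + 1 ≤ c)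
    linarith [h1.1.2]
  · have hc : w.1 = c := by omega
    rw [hd] at h
    have h1 := columnSet_zero h
    refine ⟨hc, ?_⟩
    rw [hc, abs_le]; constructor <;> linarith
  · have h1 := columnSet_pos hd h
    have h2 : (c : ℝ) + 1 ≤ w.1 := by exact_mod_cast (by omega : c + 1 ≤ w.1)
    linarith [h1.1.1]

lemma abs_sub_le_five {U : ℤ × ℤ → ℝ × ℝ} (hU : ∀ w, U w ∈ box) {c : ℤ} {w : ℤ × ℤ}
    (hlt : |(vertex U w).1 - c| < 5) : |w.1 - c| ≤ 5 := by
  have h1 := (vertex_bounds hU w).1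
  have h2 := abs_lt.1 hlt
  have h3 : (w.1 : ℝ) < c + 6 := by linarith
  have h4 : (c : ℝ) < w.1 + 6 := by linarith
  have h3' : w.1 < c + 6 := by exact_mod_cast h3
  have h4' : c < w.1 + 6 := by exact_mod_cast h4
  rw [abs_le]; constructor <;> omega

lemma IsWall.gap {U : ℤ × ℤ → ℝ × ℝ} (hU : ∀ w, U w ∈ box) {c a b : ℤ} (hW : IsWall U c a b)
    {w : ℤ × ℤ} (h1 : a < w.2) (h2 : w.2 ≤ b) (hlt : |(vertex U w).1 - c| < 3 / 2) :
    |(vertex U w).1 - c| ≤ 1 / 16 :=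
  (abs_fst_le_of_columnSet (hW w ⟨⟨h1, h2⟩, abs_sub_le_five hU (hlt.trans (by norm_num))⟩) hlt).2

/-- Near the top of a wall, the column is isolated from the other vertices of the same rows. -/
lemma IsWall.cap {U : ℤ × ℤ → ℝ × ℝ} (hU : ∀ w, U w ∈ box) {c a b : ℤ} (hW : IsWall U c a b)
    (hab : a + 2 ≤ b) {w : ℤ × ℤ} (h2 : w.2 ≤ b) (h3 : (b : ℝ) - 1 / 2 < (vertex U w).2)
    (hlt : |(vertex U w).1 - c| < 5) : |(vertex U w).1 - c| ≤ 1 / 16 := by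
  have h4 := (vertex_bounds hU w).2.2
  have h5 : (b : ℝ) - 2 < w.2 := by linarith
  have h5' : b - 2 < w.2 := by exact_mod_cast h5
  have h := hW w ⟨⟨by omega, h2⟩, abs_sub_le_five hU hlt⟩
  have h2' : (w.2 : ℝ) ≤ b := by exact_mod_cast h2
  rw [vertex_snd] at h3
  rcases lt_trichotomy (w.1 - c) 0 with hd | hd | hd
  · linarith [(columnSet_neg hd h).2.2]
  · have hc : w.1 = c := by omega
    rw [hd] at h
    have h1 := columnSet_zero h
    rw [vertex_fst, hc, abs_le]; constructor <;> linarith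
  · linarith [(columnSet_pos hd h).2.2]

lemma IsWall.isColumn {U : ℤ × ℤ → ℝ × ℝ} (hU : ∀ w, U w ∈ box) {c a b : ℤ}
    (hW : IsWall U c a b) : IsColumn (vertexSet U) c (a + 1) (b - 5 / 2) := by
  refine ⟨fun y h1 h2 => hW.dense (by linarith) (by linarith), ?_⟩
  rintro _ ⟨w, rfl⟩ h1 h2 h3
  have h4 := (vertex_bounds hU w).2
  change _ < (vertex U w).2 at h1
  change (vertex U w).2 ≤ _ at h2
  have h5 : (a : ℝ) < w.2 := by linarith
  have h6 : (w.2 : ℝ) ≤ b := by linarith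
  exact hW.gap hU (by exact_mod_cast h5) (by exact_mod_cast h6) h3

/-- Between two walls the path leaves the level `s`, and does so between the walls. -/
lemma Generic.exitPoint_between_walls {U : ℤ × ℤ → ℝ × ℝ} (hU : ∀ w, U w ∈ box) (hG : Generic U)
    {c c' a b : ℤ} (hW : IsWall U c a b) (hW' : IsWall U c' a b) {x : ℝ × ℝ} (hx : x ∈ starts U)
    (h1 : (a : ℝ) + 1 ≤ x.2) (hc : (c : ℝ) ≤ x.1) (hc' : x.1 ≤ c') {s : ℝ}
    (hs : s ≤ b - 5 / 2) :
    Exits (vertexSet U) s x ∧ (c : ℝ) - 1 / 16 ≤ (exitPoint (vertexSet U) s x).1 ∧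
      (exitPoint (vertexSet U) s x).1 ≤ c' + 1 / 16 := by
  let p : ℝ × ℝ → Prop := fun y => y ∈ starts U ∧ (a : ℝ) + 1 ≤ y.2 ∧ (c : ℝ) - 1 / 16 ≤ y.1 ∧
    y.1 ≤ c' + 1 / 16
  have h0 : p x := ⟨hx, h1, by linarith, by linarith⟩
  have hp : ∀ y, p y → y.2 ≤ s → p (nextStep (vertexSet U) y) := fun y hy hys => by
    have hn := hG.isNextStep hy.1
    exact ⟨hG.nextStep_mem hy.1, hy.2.1.trans hn.2.1.le,
      (hW.isColumn hU).le_fst hn hy.2.1 (hys.trans hs) hy.2.2.1,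
      (hW'.isColumn hU).fst_le hn hy.2.1 (hys.trans hs) hy.2.2.2⟩
  refine ⟨hG.exits_of_confined hU hx h0 (fun y _ => hp y) fun y hy => hy.2.2, ?_⟩
  exact (exitPoint_induction (V := vertexSet U) (s := s) h0 hp).2.2

/-! ### Traps -/

/-- The slope of the roof of a trap of half-width `l`. -/
noncomputable def roofSlope (l : ℤ) : ℝ := 1 / (16 * ((l : ℝ) + 1))

/-- The perturbations that build a trap of half-width `l`, for the sites at horizontal offset `d`
from its centre in its `r`-th row. The first row is a roof that rises slowly towards the centre, the
next two rows are kept out of reach of the roof, and the remaining rows form a column. -/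
noncomputable def trapSet (l d r : ℤ) : Set (ℝ × ℝ) :=
  if r = 1 then Icc (-1 / 16) (1 / 16) ×ˢ
    Icc (1 / 2 - (|(d : ℝ)| + 1 / 4) * roofSlope l) (1 / 2 - (|(d : ℝ)| - 1 / 4) * roofSlope l)
  else if r ≤ 3 then
    if d = 0 then Icc (-1 / 16) (1 / 16) ×ˢ Icc (7 / 16) (9 / 16)
    else if 0 < d then Icc (1 / 2) 1 ×ˢ Icc (9 / 10) 1
    else Icc (-1) (-1 / 2) ×ˢ Icc (9 / 10) 1
  else columnSet d

/-- The sites that take part in the trap of half-width `l` centred at abscissa `c` in the rows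
`n + 1, …, n + 20`. -/
def trapSites (c n l : ℤ) : Set (ℤ × ℤ) :=
  {w | ((n < w.2 ∧ w.2 ≤ n + 3) ∧ |w.1 - c| ≤ l) ∨ ((n + 3 < w.2 ∧ w.2 ≤ n + 20) ∧ |w.1 - c| ≤ 5)}

/-- The configuration has a trap of half-width `l` at abscissa `c` above the row `n`. -/
def IsTrap (U : ℤ × ℤ → ℝ × ℝ) (c n l : ℤ) : Prop :=
  ∀ w ∈ trapSites c n l, U w ∈ trapSet l (w.1 - c) (w.2 - n)

lemma roofSlope_pos {l : ℤ} (hl : 0 ≤ l) : 0 < roofSlope l := by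
  have : (0 : ℝ) ≤ l := by exact_mod_cast hl
  unfold roofSlope; positivity

lemma mul_roofSlope_le {l : ℤ} (hl : 0 ≤ l) {d : ℝ} (hd : d ≤ l + 1) :
    d * roofSlope l ≤ 1 / 16 := by
  have : (0 : ℝ) ≤ l := by exact_mod_cast hl
  rw [roofSlope, mul_one_div, div_le_iff₀ (by positivity)]
  linarith

section Trap

variable {U : ℤ × ℤ → ℝ × ℝ} {c n l : ℤ}

lemma IsTrap.roof (hT : IsTrap U c n l) {i : ℤ} (hi : |i - c| ≤ l) :
    |(vertex U (i, n + 1)).1 - i| ≤ 1 / 16 ∧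
      (n : ℝ) + 3 / 2 - (|(i : ℝ) - c| + 1 / 4) * roofSlope l ≤ (vertex U (i, n + 1)).2 ∧
      (vertex U (i, n + 1)).2 ≤ n + 3 / 2 - (|(i : ℝ) - c| - 1 / 4) * roofSlope l := by
  have h := hT (i, n + 1) (Or.inl ⟨⟨by simp, by simp⟩, hi⟩)
  simp only [add_sub_cancel_left, trapSet, if_true] at h
  obtain ⟨⟨h1, h2⟩, h3, h4⟩ := h
  push_cast at h3 h4
  rw [vertex_fst, vertex_snd]
  push_cast
  refine ⟨?_, by linarith, by linarith⟩
  rw [abs_le]; constructor <;> simp <;> linarith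

lemma IsTrap.roof_bounds (hl : 0 ≤ l) (hT : IsTrap U c n l) {i : ℤ} (hi : |i - c| ≤ l) :
    (n : ℝ) + 7 / 5 ≤ (vertex U (i, n + 1)).2 ∧ (vertex U (i, n + 1)).2 ≤ n + 38 / 25 := by
  have h := (hT.roof hi).2
  have h1 : |(i : ℝ) - c| ≤ l := by exact_mod_cast hi
  have h2 := mul_roofSlope_le hl (d := |(i : ℝ) - c| + 1 / 4) (by linarith)
  have h3 : 0 ≤ |(i : ℝ) - c| * roofSlope l := mul_nonneg (abs_nonneg _) (roofSlope_pos hl).le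
  have h4 := mul_roofSlope_le hl (d := 1) (by
    have : (0 : ℝ) ≤ l := by exact_mod_cast hl
    linarith)
  constructor <;> nlinarith [h.1, h.2]

lemma IsTrap.middle (hT : IsTrap U c n l) {w : ℤ × ℤ} (h1 : n + 2 ≤ w.2) (h2 : w.2 ≤ n + 3)
    (hw : |w.1 - c| ≤ l) :
    (w.1 = c ∧ |(vertex U w).1 - c| ≤ 1 / 16 ∧ (w.2 : ℝ) + 7 / 16 ≤ (vertex U w).2 ∧
      (vertex U w).2 ≤ w.2 + 9 / 16) ∨
    (3 / 2 ≤ |(vertex U w).1 - c| ∧ (w.2 : ℝ) + 9 / 10 ≤ (vertex U w).2) := by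
  have h := hT w (Or.inl ⟨⟨by omega, h2⟩, hw⟩)
  rw [trapSet, if_neg (by omega), if_pos (by omega)] at h
  rw [vertex_fst, vertex_snd]
  rcases lt_trichotomy (w.1 - c) 0 with hd | hd | hd
  · right
    rw [if_neg hd.ne, if_neg hd.not_gt] at h
    obtain ⟨⟨h3, h4⟩, h5, h6⟩ := h
    have h7 : (w.1 : ℝ) + 1 ≤ c := by exact_mod_cast (by omega : w.1 + 1 ≤ c)
    exact ⟨le_abs.2 (Or.inr (by linarith)), by linarith⟩
  · left
    rw [if_pos hd] at h
    obtain ⟨⟨h3, h4⟩, h5, h6⟩ := h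
    have hc : w.1 = c := by omega
    refine ⟨hc, ?_, by linarith, by linarith⟩
    rw [hc, abs_le]; constructor <;> linarith
  · right
    rw [if_neg hd.ne', if_pos hd] at h
    obtain ⟨⟨h3, h4⟩, h5, h6⟩ := h
    have h7 : (c : ℝ) + 1 ≤ w.1 := by exact_mod_cast (by omega : c + 1 ≤ w.1)
    exact ⟨le_abs.2 (Or.inl (by linarith)), by linarith⟩

lemma IsTrap.le_snd (hU : ∀ w, U w ∈ box) (hT : IsTrap U c n l) {w : ℤ × ℤ} (h1 : n + 2 ≤ w.2)
    (hw : |w.1 - c| ≤ l) : (n : ℝ) + 12 / 5 ≤ (vertex U w).2 := by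
  rcases le_or_gt w.2 (n + 3) with h2 | h2
  · have h3 : (n : ℝ) + 2 ≤ w.2 := by exact_mod_cast h1
    rcases hT.middle h1 h2 hw with h | h <;> linarith [h.2]
  · have h3 : (n : ℝ) + 4 ≤ w.2 := by exact_mod_cast (by omega : n + 4 ≤ w.2)
    linarith [(vertex_bounds hU w).2.1]

/-- From a vertex of the roof the path moves to the next vertex towards the centre. -/
lemma IsTrap.nextStep_roof (hU : ∀ w, U w ∈ box) (hl : 0 ≤ l) (hT : IsTrap U c n l) {i i' : ℤ}
    (hi : |i - c| ≤ l - 5) (hi' : |i' - c| + 1 = |i - c|) (hii : |i' - i| = 1) {y : ℝ × ℝ}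
    (hy : IsNextStep (vertexSet U) (vertex U (i, n + 1)) y) : y = vertex U (i', n + 1) := by
  have hs := roofSlope_pos hl
  have r := hT.roof (i := i) (by omega)
  have r' := hT.roof (i := i') (by omega)
  have rb := hT.roof_bounds hl (i := i) (by omega)
  have rb' := hT.roof_bounds hl (i := i') (by omega)
  have hab : |(i' : ℝ) - c| + 1 = |(i : ℝ) - c| := by exact_mod_cast hi'
  have habi : |(i' : ℝ) - i| = 1 := by exact_mod_cast hii
  have hlt : (vertex U (i, n + 1)).2 < (vertex U (i', n + 1)).2 := by
    rw [← hab] at r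
    nlinarith [r.2.2, r'.2.1]
  have hd := hy.2.2 _ (vertex_mem U (i', n + 1)) hlt
  set x := vertex U (i, n + 1) with hx
  -- A step of length at most `5 / 4` cannot leave the roof: the rows above are too far away.
  have hlen : l1Dist x (vertex U (i', n + 1)) ≤ 5 / 4 := by
    rw [l1Dist_of_lt hlt]
    have e1 : |(vertex U (i', n + 1)).1 - x.1| ≤ 9 / 8 := by
      have := abs_sub_le ((vertex U (i', n + 1)).1) i' x.1
      have h2 := abs_sub_le (i' : ℝ) i x.1
      have h3 := r.1
      rw [abs_sub_comm] at h3
      linarith [r'.1]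
    have e2 : (vertex U (i', n + 1)).2 - x.2 ≤ 3 / 2 * roofSlope l := by
      rw [← hab] at r
      nlinarith [r.2.1, r'.2.2]
    have e3 := mul_roofSlope_le hl (d := 1) (by
      have : (0 : ℝ) ≤ l := by exact_mod_cast hl
      linarith)
    linarith
  have hd' : l1Dist x y ≤ 5 / 4 := hd.trans hlen
  have hyx := hy.2.1
  rw [l1Dist_of_lt hyx] at hd'
  obtain ⟨w, rfl⟩ := hy.1
  change x.2 < (vertex U w).2 at hyx
  change |(vertex U w).1 - x.1| + ((vertex U w).2 - x.2) ≤ 5 / 4 at hd'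
  change vertex U w = _
  have hb := vertex_bounds hU w
  have hxi := abs_le.1 r.1
  have habs := abs_le.1 (show |(vertex U w).1 - x.1| ≤ 5 / 4 by linarith)
  have hwi : |w.1 - i| ≤ 2 := by
    have h1 : (w.1 : ℝ) < i + 3 := by linarith
    have h2 : (i : ℝ) < w.1 + 3 := by linarith
    have h1' : w.1 < i + 3 := by exact_mod_cast h1
    have h2' : i < w.1 + 3 := by exact_mod_cast h2
    rw [abs_le]; constructor <;> omega
  have hwl : |w.1 - c| ≤ l := by
    have := abs_sub_le w.1 i c
    omega
  have hn1 : n + 1 ≤ w.2 := by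
    have h1 : (n : ℝ) < w.2 := by linarith
    have : n < w.2 := by exact_mod_cast h1
    omega
  rcases hn1.lt_or_eq with hn2 | hn1
  · exfalso
    rcases le_or_gt w.2 (n + 3) with hn3 | hn3
    · have hw2 : (n : ℝ) + 2 ≤ w.2 := by exact_mod_cast (by omega : n + 2 ≤ w.2)
      rcases hT.middle (by omega) hn3 hwl with h | h
      · have hic : (1 : ℝ) ≤ |(i : ℝ) - c| := by
          have := abs_nonneg ((i' : ℝ) - c)
          linarith
        have t1 := abs_sub_le (i : ℝ) x.1 c
        have t2 := abs_sub_le x.1 (vertex U w).1 c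
        have t3 := r.1
        rw [abs_sub_comm] at t3
        rw [abs_sub_comm x.1 (vertex U w).1] at t2
        linarith [h.2.1, h.2.2.1]
      · have := abs_nonneg ((vertex U w).1 - x.1)
        linarith [h.2]
    · have h3 : (n : ℝ) + 4 ≤ w.2 := by exact_mod_cast (by omega : n + 4 ≤ w.2)
      have := abs_nonneg ((vertex U w).1 - x.1)
      linarith
  · obtain ⟨j, m⟩ := w
    simp only at hn1 hwl hwi
    subst hn1
    have rj := hT.roof (i := j) hwl
    have rj1 := abs_le.1 rj.1
    have hji : |j - i| ≤ 1 := by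
      have h1 : (j : ℝ) < i + 2 := by linarith
      have h2 : (i : ℝ) < j + 2 := by linarith
      have h1' : j < i + 2 := by exact_mod_cast h1
      have h2' : i < j + 2 := by exact_mod_cast h2
      rw [abs_le]; constructor <;> omega
    -- The roof rises strictly towards its centre, and a step goes up.
    have hjc : |j - c| < |i - c| := by
      by_contra! hge
      rcases hge.lt_or_eq with h1 | h1
      · have h2 : |(i : ℝ) - c| + 1 ≤ |(j : ℝ) - c| := by exact_mod_cast h1
        nlinarith [rj.2.2, r.2.1]
      · have hji' : j = i := by
          rcases abs_cases (j - i) with h | h <;> rcases abs_cases (j - c) with h' | h' <;>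
          rcases abs_cases (i - c) with h'' | h'' <;> rcases abs_cases (i' - c) with h3 | h3 <;>
            omega
        rw [hji'] at hyx
        exact lt_irrefl _ hyx
    have : j = i' := by
      rcases abs_cases (j - i) with h | h <;> rcases abs_cases (j - c) with h' | h' <;>
      rcases abs_cases (i - c) with h'' | h'' <;> rcases abs_cases (i' - c) with h3 | h3 <;>
      rcases abs_cases (i' - i) with h4 | h4 <;> omega
    rw [this]

/-- The path from a vertex of the roof reaches the central vertex of the roof. -/
lemma IsTrap.roof_to_centre (hU : ∀ w, U w ∈ box) (hG : Generic U) (hl : 0 ≤ l)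
    (hT : IsTrap U c n l) {i : ℤ} (hi : |i - c| ≤ l - 5) :
    ∃ k, (nextStep (vertexSet U))^[k] (vertex U (i, n + 1)) = vertex U (c, n + 1) := by
  obtain ⟨m, hm⟩ : ∃ m : ℕ, |i - c| = m := ⟨(i - c).natAbs, (Int.natCast_natAbs _).symm⟩
  induction m generalizing i with
  | zero =>
    have : i = c := by
      have : i - c = 0 := by simpa using hm
      omega
    exact ⟨0, by rw [this]; rfl⟩
  | succ m ih =>
    obtain ⟨i', h1, h2⟩ : ∃ i', |i' - c| + 1 = |i - c| ∧ |i' - i| = 1 := by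
      rcases abs_cases (i - c) with h | h
      · refine ⟨i - 1, ?_, by simp⟩
        rw [abs_of_nonneg (by omega), h.1]; omega
      · refine ⟨i + 1, ?_, by simp⟩
        rw [abs_of_nonpos (by omega), h.1]; omega
    have hs := hG.isNextStep (x := vertex U (i, n + 1)) (Or.inr (vertex_mem _ _))
    have := hT.nextStep_roof hU hl hi h1 h2 hs
    obtain ⟨k, hk⟩ := ih (i := i') (by omega) (by omega)
    exact ⟨k + 1, by rw [Function.iterate_succ_apply, this, hk]⟩

/-- A path that runs below a trap, between two walls that end at the trap, is caught by the centre
of the trap. -/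
lemma IsTrap.catches (hU : ∀ w, U w ∈ box) (hG : Generic U) (hl : 0 ≤ l) (hT : IsTrap U c n l)
    {cL cR a : ℤ} (ha : a + 2 ≤ n) (hL : IsWall U cL a n) (hR : IsWall U cR a n)
    (hcL : c - l + 12 ≤ cL) (hcR : cR ≤ c + l - 12) {x : ℝ × ℝ} (hx : x ∈ starts U)
    (h1 : (a : ℝ) + 1 ≤ x.2) (h2 : x.2 ≤ n + 1) (hxL : (cL : ℝ) ≤ x.1) (hxR : x.1 ≤ cR) :
    ∃ k, (nextStep (vertexSet U))^[k] x = vertex U (c, n + 1) := by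
  have hcL' : (c : ℝ) - l + 12 ≤ cL := by exact_mod_cast hcL
  have hcR' : (cR : ℝ) ≤ c + l - 12 := by exact_mod_cast hcR
  have col : ∀ c' : ℤ, IsWall U c' a n → c - l + 12 ≤ c' → c' ≤ c + l - 12 →
      IsColumn (vertexSet U) c' (a + 1) (n - 1 / 2) := by
    intro c' hW e1 e2
    refine ⟨fun y h1 h2 => hW.dense (by linarith) (by linarith), ?_⟩
    rintro _ ⟨w, rfl⟩ h3 h4 h5
    change _ < (vertex U w).2 at h3
    change (vertex U w).2 ≤ _ at h4
    change |(vertex U w).1 - c'| < _ at h5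
    have hb := vertex_bounds hU w
    have h6 : (a : ℝ) < w.2 := by linarith
    have h6' : a < w.2 := by exact_mod_cast h6
    have h7 := abs_sub_le_five hU (h5.trans (by norm_num))
    have h8 : |w.1 - c| ≤ l := by
      have := abs_le.1 h7
      rw [abs_le]; constructor <;> omega
    rcases le_or_gt w.2 n with h9 | h9
    · exact hW.gap hU h6' h9 h5
    · exfalso
      rcases (show n + 1 ≤ w.2 from h9).lt_or_eq with h10 | h10
      · linarith [hT.le_snd hU (show n + 2 ≤ w.2 by omega) h8]
      · obtain ⟨j, m⟩ := w
        simp only at h10 h8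
        subst h10
        linarith [(hT.roof_bounds hl h8).1]
  let p : ℝ × ℝ → Prop := fun y =>
    (((a : ℝ) + 1 ≤ y.2 ∧ y.2 ≤ n + 1) ∧ (cL : ℝ) - 1 / 16 ≤ y.1 ∧ y.1 ≤ cR + 1 / 16) ∨
      ∃ i : ℤ, |i - c| ≤ l - 5 ∧ y = vertex U (i, n + 1)
  have h0 : p x := Or.inl ⟨⟨h1, h2⟩, by linarith, by linarith⟩
  have hp : ∀ y ∈ starts U, p y → y.2 ≤ n + 1 → p (nextStep (vertexSet U) y) := by
    rintro y hys (⟨⟨hy1, -⟩, hyL, hyR⟩ | ⟨i, hi, rfl⟩) hy2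
    swap
    · linarith [(hT.roof_bounds hl (i := i) (by omega)).1]
    have hn := hG.isNextStep hys
    have hd := hn.dist_le hU
    have hlt := hn.2.1
    have hL' := (col cL hL hcL (by
      have : (cL : ℝ) ≤ cR := hxL.trans hxR
      have : cL ≤ cR := by exact_mod_cast this
      omega)).le_fst hn hy1
    have hR' := (col cR hR (by
      have : (cL : ℝ) ≤ cR := hxL.trans hxR
      have : cL ≤ cR := by exact_mod_cast this
      omega) hcR).fst_le hn hy1
    have hmin := hn.2.2
    obtain ⟨w, hw⟩ : ∃ w, vertex U w = nextStep (vertexSet U) y := hn.1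
    rw [← hw] at hd hlt hL' hR' hmin ⊢
    have hdy := hd
    rw [l1Dist_of_lt hlt] at hd
    have habs := abs_le.1 (show |(vertex U w).1 - y.1| ≤ 9 / 2 by linarith)
    have hb := vertex_bounds hU w
    have hwl : |w.1 - c| ≤ l - 6 := by
      have e1 : (w.1 : ℝ) < c + l - 5 := by linarith
      have e2 : (c : ℝ) - l + 5 < w.1 := by linarith
      have e1' : w.1 < c + l - 5 := by exact_mod_cast e1
      have e2' : c - l + 5 < w.1 := by exact_mod_cast e2
      rw [abs_le]; constructor <;> omega
    rcases le_or_gt w.2 n with hwn | hwn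
    · left
      have hwn' : (w.2 : ℝ) ≤ n := by exact_mod_cast hwn
      refine ⟨⟨by linarith, by linarith⟩, ?_⟩
      rcases le_or_gt y.2 (n - 1 / 2) with hyn | hyn
      · exact ⟨hL' hyn hyL, hR' hyn hyR⟩
      · constructor
        · by_contra! hcon
          have e := (abs_le.1 (hL.cap hU ha hwn (hyn.trans hlt)
            (abs_lt.2 ⟨by linarith, by linarith⟩))).1
          linarith
        · by_contra! hcon
          have e := (abs_le.1 (hR.cap hU ha hwn (hyn.trans hlt)
            (abs_lt.2 ⟨by linarith, by linarith⟩))).2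
          linarith
    · right
      rcases (show n + 1 ≤ w.2 from hwn).lt_or_eq with hw2 | hw1
      · -- the roof is closer than the rows above it
        exfalso
        have e1 := hT.le_snd hU (show n + 2 ≤ w.2 by omega) (by omega)
        have e2 := abs_le.1 (abs_sub_round y.1)
        have hrl : |round y.1 - c| ≤ l := by
          have e3 : (round y.1 : ℝ) < c + l := by linarith
          have e4 : (c : ℝ) - l < round y.1 := by linarith
          have e3' : round y.1 < c + l := by exact_mod_cast e3
          have e4' : c - l < round y.1 := by exact_mod_cast e4
          rw [abs_le]; constructor <;> omega
        have e3 := abs_le.1 (hT.roof hrl).1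
        have e4 := hT.roof_bounds hl hrl
        have e5 : y.2 < (vertex U (round y.1, n + 1)).2 := by linarith
        have e6 := hmin _ (vertex_mem U (round y.1, n + 1)) e5
        rw [l1Dist_of_lt hlt, l1Dist_of_lt e5] at e6
        have e7 := abs_nonneg ((vertex U w).1 - y.1)
        have e8 : |(vertex U (round y.1, n + 1)).1 - y.1| ≤ 9 / 16 := by
          rw [abs_le]; constructor <;> linarith
        linarith
      · obtain ⟨j, m⟩ := w
        simp only at hw1 hwl
        subst hw1
        exact ⟨j, by omega, rfl⟩
  have hE : Exits (vertexSet U) (n + 1) x := by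
    refine hG.exits_of_confined hU hx (a := (c : ℝ) - l - 1) (b := c + l + 1) h0 hp ?_
    rintro y (⟨-, h3, h4⟩ | ⟨i, hi, rfl⟩)
    · constructor <;> linarith
    · have h3 := abs_le.1 (hT.roof (i := i) (by omega)).1
      have h4 : |(i : ℝ) - c| ≤ l - 5 := by exact_mod_cast hi
      have h5 := abs_le.1 h4
      constructor <;> linarith
  have hq := exitPoint_induction (V := vertexSet U) (s := n + 1) (p := fun y => y ∈ starts U ∧ p y)
    ⟨hx, h0⟩ fun y hy hy2 => ⟨hG.nextStep_mem hy.1, hp y hy.1 hy.2 hy2⟩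
  obtain ⟨k, hk, -⟩ := exists_iterate_eq_exitPoint (vertexSet U) (n + 1) x
  rcases hq.2 with ⟨⟨-, h3⟩, -⟩ | ⟨i, hi, hq⟩
  · exact absurd hE.lt_exitPoint (not_lt.2 h3)
  · obtain ⟨k', hk'⟩ := hT.roof_to_centre hU hG hl hi
    exact ⟨k' + k, by rw [Function.iterate_add_apply, hk, hq, hk']⟩

/-- The part of a trap above the centre of its roof is a column. -/
lemma IsTrap.isColumn (hU : ∀ w, U w ∈ box) (hl : 5 ≤ l) (hT : IsTrap U c n l) :
    IsColumn (vertexSet U) c (vertex U (c, n + 1)).2 (n + 35 / 2) := by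
  have hl0 : 0 ≤ l := by omega
  have r := hT.roof (i := c) (by simpa using hl0)
  have rb := hT.roof_bounds hl0 (i := c) (by simpa using hl0)
  simp only [sub_self, abs_zero, zero_add] at r
  have hs := roofSlope_pos hl0
  have hW : IsWall U c (n + 3) (n + 20) := fun w hw => by
    have := hT w (Or.inr hw)
    rwa [trapSet, if_neg (by have := hw.1; omega), if_neg (by have := hw.1; omega)] at this
  constructor
  · intro y h1 h2
    have m2 := hT.middle (w := (c, n + 2)) (by simp) (by simp) (by simpa using hl0)
    have m3 := hT.middle (w := (c, n + 3)) (by simp) (by simp) (by simpa using hl0)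
    have off : ∀ r : ℤ, ¬ (3 / 2 ≤ |(vertex U (c, r)).1 - c|) := fun r hr => by
      have hb := (vertex_bounds hU (c, r)).1
      have : |(vertex U (c, r)).1 - c| ≤ 1 := abs_le.2 ⟨by linarith [hb.1], by linarith [hb.2]⟩
      linarith
    have m2' := m2.resolve_right fun h => off _ h.1
    have m3' := m3.resolve_right fun h => off _ h.1
    push_cast at m2' m3'
    rcases lt_or_ge y (vertex U (c, n + 2)).2 with h3 | h3
    · exact ⟨_, vertex_mem U (c, n + 2), m2'.2.1, h3, by linarith⟩
    · rcases lt_or_ge y (vertex U (c, n + 3)).2 with h4 | h4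
      · exact ⟨_, vertex_mem U (c, n + 3), m3'.2.1, h4, by linarith⟩
      · exact hW.dense (by push_cast; linarith) (by push_cast; linarith)
  · rintro _ ⟨w, rfl⟩ h1 h2 h3
    change _ < (vertex U w).2 at h1
    change (vertex U w).2 ≤ _ at h2
    change |(vertex U w).1 - c| < _ at h3
    change |(vertex U w).1 - c| ≤ _
    have hb := (vertex_bounds hU w).2
    have h5 := abs_sub_le_five hU (h3.trans (by norm_num))
    have h6 : (n : ℝ) < w.2 := by linarith
    have h6' : n < w.2 := by exact_mod_cast h6
    have h7 : (w.2 : ℝ) ≤ n + 20 := by linarith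
    have h7' : w.2 ≤ n + 20 := by exact_mod_cast h7
    rcases le_or_gt w.2 (n + 3) with h8 | h8
    · rcases (show n + 1 ≤ w.2 from h6').lt_or_eq with h9 | h9
      · rcases hT.middle (by omega) h8 (by omega) with h | h
        · exact h.2.1
        · linarith [h.1]
      · obtain ⟨j, m⟩ := w
        simp only at h9 h5
        subst h9
        have rj := hT.roof (i := j) (by omega)
        rcases eq_or_ne j c with rfl | hjc
        · exact rj.1
        · exfalso
          have h10 : (1 : ℝ) ≤ |(j : ℝ) - c| := by
            exact_mod_cast Int.one_le_abs (sub_ne_zero.2 hjc)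
          nlinarith [rj.2.2, r.2.1]
    · exact hW.gap hU (by omega) h7' h3

/-- The path from the centre of a trap climbs along the column of the trap. -/
lemma IsTrap.exitPoint_centre (hU : ∀ w, U w ∈ box) (hG : Generic U) (hl : 5 ≤ l)
    (hT : IsTrap U c n l) {s : ℝ} (hs : s ≤ n + 35 / 2) :
    Exits (vertexSet U) s (vertex U (c, n + 1)) ∧
      |(exitPoint (vertexSet U) s (vertex U (c, n + 1))).1 - c| ≤ 1 / 16 := by
  have hC := hT.isColumn hU hl
  let p : ℝ × ℝ → Prop := fun y => y ∈ starts U ∧ (vertex U (c, n + 1)).2 ≤ y.2 ∧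
    |y.1 - c| ≤ 1 / 16
  have h0 : p (vertex U (c, n + 1)) :=
    ⟨Or.inr (vertex_mem _ _), le_rfl, (hT.roof (i := c) (by simp; omega)).1⟩
  have hp : ∀ y, p y → y.2 ≤ s → p (nextStep (vertexSet U) y) := fun y hy hys => by
    have hn := hG.isNextStep hy.1
    have h3 := abs_le.1 hy.2.2
    refine ⟨hG.nextStep_mem hy.1, hy.2.1.trans hn.2.1.le, abs_le.2 ⟨?_, ?_⟩⟩
    · linarith [hC.le_fst hn hy.2.1 (hys.trans hs) (by linarith)]
    · linarith [hC.fst_le hn hy.2.1 (hys.trans hs) (by linarith)]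
  refine ⟨hG.exits_of_confined hU (Or.inr (vertex_mem _ _)) (a := (c : ℝ) - 1) (b := c + 1) h0
    (fun y _ => hp y) fun y hy => ?_, ?_⟩
  · have h3 := abs_le.1 hy.2.2
    constructor <;> linarith
  · exact (exitPoint_induction (V := vertexSet U) (s := s) h0 hp).2.2

end Trap

/-! ### Measurability of paths -/

section Measurability

variable {Ω : Type*} {mΩ : MeasurableSpace Ω}

/-- A function that agrees with a measurable function on each set of a countable measurable cover
is measurable. -/
lemma measurable_of_countable_cover {β ι : Type*} [MeasurableSpace β] [Countable ι] {f : Ω → β}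
    {A : ι → Set Ω} {g : ι → Ω → β} (hA : ∀ i, MeasurableSet (A i)) (hg : ∀ i, Measurable (g i))
    (hcov : ∀ ω, ∃ i, ω ∈ A i) (hfg : ∀ i, ∀ ω ∈ A i, f ω = g i ω) : Measurable f := by
  intro B hB
  have : f ⁻¹' B = ⋃ i, A i ∩ g i ⁻¹' B := by
    ext ω
    simp only [mem_preimage, mem_iUnion, mem_inter_iff]
    constructor
    · intro h
      obtain ⟨i, hi⟩ := hcov ω
      exact ⟨i, hi, hfg i ω hi ▸ h⟩
    · rintro ⟨i, hi, h⟩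
      rw [hfg i ω hi]
      exact h
  rw [this]
  exact MeasurableSet.iUnion fun i => (hA i).inter (hg i hB)

variable {U : Ω → ℤ × ℤ → ℝ × ℝ} {A : Set (ℤ × ℤ)}

lemma measurable_vertex {w : ℤ × ℤ} (hU : Measurable fun ω => U ω w) :
    Measurable fun ω => vertex (U ω) w := hU.const_add _

lemma measurable_l1Dist {x y : Ω → ℝ × ℝ} (hx : Measurable x) (hy : Measurable y) :
    Measurable fun ω => PerturbedDSF.l1Dist (x ω) (y ω) := by
  unfold PerturbedDSF.l1Dist
  have h1 : Measurable fun ω => (y ω).1 - (x ω).1 := hy.fst.sub hx.fst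
  have h2 : Measurable fun ω => (y ω).2 - (x ω).2 := hy.snd.sub hx.snd
  have habs : Measurable fun r : ℝ => |r| := continuous_abs.measurable
  exact (habs.comp h1).add (habs.comp h2)

lemma measurableSet_isNextStep (hU : ∀ w ∈ A, Measurable fun ω => U ω w) {x : Ω → ℝ × ℝ}
    (hx : Measurable x) {w : ℤ × ℤ} (hw : w ∈ A) :
    MeasurableSet {ω | IsNextStep (vertices (U ω) A) (x ω) (vertex (U ω) w)} := by
  have hv := fun (z : A) => measurable_vertex (hU z.1 z.2)
  have : {ω | IsNextStep (vertices (U ω) A) (x ω) (vertex (U ω) w)} =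
      {ω | (x ω).2 < (vertex (U ω) w).2} ∩ ⋂ z : A, ({ω | (x ω).2 < (vertex (U ω) z).2}ᶜ ∪
        {ω | l1Dist (x ω) (vertex (U ω) w) ≤ l1Dist (x ω) (vertex (U ω) z)}) := by
    ext ω
    simp only [IsNextStep, mem_inter_iff, mem_iInter, mem_union, mem_compl_iff, mem_ofPred_eq]
    constructor
    · rintro ⟨-, h1, h2⟩
      refine ⟨h1, fun z => ?_⟩
      by_cases h : (x ω).2 < (vertex (U ω) z).2
      · exact Or.inr (h2 _ ⟨z, z.2, rfl⟩ h)
      · exact Or.inl h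
    · rintro ⟨h1, h2⟩
      refine ⟨⟨w, hw, rfl⟩, h1, ?_⟩
      rintro _ ⟨z, hz, rfl⟩ h
      exact (h2 ⟨z, hz⟩).resolve_left (not_not.2 h)
  rw [this]
  exact (measurableSet_lt hx.snd (hv ⟨w, hw⟩).snd).inter <| MeasurableSet.iInter fun z =>
    (measurableSet_lt hx.snd (hv z).snd).compl.union
      (measurableSet_le (measurable_l1Dist hx (hv ⟨w, hw⟩)) (measurable_l1Dist hx (hv z)))

lemma measurable_nextStep (hU : ∀ w ∈ A, Measurable fun ω => U ω w) {x : Ω → ℝ × ℝ}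
    (hx : Measurable x) : Measurable fun ω => nextStep (vertices (U ω) A) (x ω) := by
  have hv := fun (z : A) => measurable_vertex (hU z.1 z.2)
  let N : A → Set Ω := fun w => {ω | IsNextStep (vertices (U ω) A) (x ω) (vertex (U ω) w)}
  have hN : ∀ w, MeasurableSet (N w) := fun w => measurableSet_isNextStep hU hx w.2
  let B : A → Set Ω := fun w => N w ∩
    ⋂ z : A, ((N z)ᶜ ∪ {ω | vertex (U ω) z = vertex (U ω) w})
  have hB : ∀ w, MeasurableSet (B w) := fun w => (hN w).inter <| MeasurableSet.iInter fun z =>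
    (hN z).compl.union (measurableSet_eq_fun (hv z) (hv w))
  have key : ∀ w, ∀ ω ∈ B w, nextStep (vertices (U ω) A) (x ω) = vertex (U ω) w := by
    rintro w ω ⟨h1, h2⟩
    refine nextStep_eq ⟨_, h1, ?_⟩ h1
    intro y hy
    obtain ⟨z, hz, rfl⟩ := hy.1
    exact (mem_iInter.1 h2 ⟨z, hz⟩).resolve_left (not_not.2 hy)
  refine measurable_of_countable_cover (ι := Option A)
    (A := fun o => o.elim (⋃ w, B w)ᶜ B) (g := fun o => o.elim x fun w ω => vertex (U ω) w)
    ?_ ?_ ?_ ?_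
  · rintro (_ | w)
    · exact (MeasurableSet.iUnion hB).compl
    · exact hB w
  · rintro (_ | w)
    · exact hx
    · exact hv w
  · intro ω
    by_cases h : ω ∈ ⋃ w, B w
    · obtain ⟨w, hw⟩ := mem_iUnion.1 h
      exact ⟨some w, hw⟩
    · exact ⟨none, h⟩
  · rintro (_ | w) ω hω
    · change _ = x ω
      rw [nextStep, dif_neg]
      rintro ⟨y, hy, hu⟩
      obtain ⟨w, hw, rfl⟩ := hy.1
      refine hω (mem_iUnion.2 ⟨⟨w, hw⟩, hy, mem_iInter.2 fun z => ?_⟩)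
      by_cases hz : ω ∈ N z
      · exact Or.inr (hu _ hz)
      · exact Or.inl hz
    · exact key w ω hω

lemma measurable_iterate (hU : ∀ w ∈ A, Measurable fun ω => U ω w) {x : Ω → ℝ × ℝ}
    (hx : Measurable x) (k : ℕ) :
    Measurable fun ω => (nextStep (vertices (U ω) A))^[k] (x ω) := by
  induction k with
  | zero => simpa using hx
  | succ k ih =>
    simp only [Function.iterate_succ_apply']
    exact measurable_nextStep hU ih

lemma measurable_exitPoint (hU : ∀ w ∈ A, Measurable fun ω => U ω w) {x : Ω → ℝ × ℝ}
    (hx : Measurable x) (s : ℝ) : Measurable fun ω => exitPoint (vertices (U ω) A) s (x ω) := by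
  have hm := fun k => (measurable_iterate hU hx k).snd
  let E : ℕ → Set Ω := fun k => {ω | s < ((nextStep (vertices (U ω) A))^[k] (x ω)).2}
  have hE : ∀ k, MeasurableSet (E k) := fun k => measurableSet_lt measurable_const (hm k)
  refine measurable_of_countable_cover (ι := Option ℕ)
    (A := fun o => o.elim (⋃ k, E k)ᶜ fun k => E k ∩ ⋂ i : Fin k, (E i)ᶜ)
    (g := fun o => o.elim x fun k ω => (nextStep (vertices (U ω) A))^[k] (x ω)) ?_ ?_ ?_ ?_
  · rintro (_ | k)
    · exact (MeasurableSet.iUnion hE).compl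
    · exact (hE k).inter (MeasurableSet.iInter fun i => (hE i).compl)
  · rintro (_ | k)
    · exact hx
    · exact measurable_iterate hU hx k
  · intro ω
    by_cases h : ω ∈ ⋃ k, E k
    · classical
      have h' : ∃ k, ω ∈ E k := mem_iUnion.1 h
      exact ⟨some (Nat.find h'), Nat.find_spec h', mem_iInter.2 fun i => Nat.find_min h' i.2⟩
    · exact ⟨none, h⟩
  · rintro (_ | k) ω hω
    · change _ = x ω
      have : {k | s < ((nextStep (vertices (U ω) A))^[k] (x ω)).2} = ∅ :=
        eq_empty_of_forall_notMem fun k hk => hω (mem_iUnion.2 ⟨k, hk⟩)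
      rw [exitPoint, this, Nat.sInf_empty]
      rfl
    · exact exitPoint_eq_iterate hω.1 fun i hi => not_lt.1 (mem_iInter.1 hω.2 ⟨i, hi⟩)

end Measurability

/-! ### The canonical space of perturbations -/

/-- The uniform distribution on the box. -/
noncomputable def unif : Measure (ℝ × ℝ) := cond volume box

/-- Configurations of perturbations. -/
abbrev Config : Type := ℤ × ℤ → ℝ × ℝ

lemma volume_box : (volume : Measure (ℝ × ℝ)) box = 4 := by
  rw [box, Measure.volume_eq_prod, Measure.prod_prod, Real.volume_Icc]
  rw [← ENNReal.ofReal_mul (by norm_num)]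
  norm_num

lemma measurableSet_box : MeasurableSet box := measurableSet_Icc.prod measurableSet_Icc

instance : IsProbabilityMeasure unif :=
  cond_isProbabilityMeasure_of_finite (by rw [volume_box]; norm_num) (by rw [volume_box]; norm_num)

/-- The law of a family of independent perturbations, each uniform in the box. -/
noncomputable def law : Measure Config := Measure.infinitePi fun _ => unif

instance : IsProbabilityMeasure law := by unfold law; infer_instance

lemma map_eq_law {Ω : Type*} [MeasurableSpace Ω] {μ : Measure Ω} {U : ℤ × ℤ → Ω → ℝ × ℝ}
    (hm : ∀ w, Measurable (U w)) (hi : iIndepFun U μ) (hu : ∀ w, μ.map (U w) = unif) :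
    μ.map (fun ω w => U w ω) = law := by
  rw [hi.map_fun_eq_infinitePi_map hm, law]
  simp_rw [hu]

lemma unif_rect {a b c d : ℝ} (h : Icc a b ×ˢ Icc c d ⊆ box) (hab : a ≤ b) :
    unif (Icc a b ×ˢ Icc c d) = ENNReal.ofReal ((b - a) * (d - c) / 4) := by
  rw [unif, cond_apply measurableSet_box, inter_eq_right.2 h, volume_box, Measure.volume_eq_prod,
    Measure.prod_prod, Real.volume_Icc, Real.volume_Icc, ← ENNReal.ofReal_mul (by linarith),
    ENNReal.ofReal_div_of_pos (by norm_num), mul_comm, ENNReal.div_eq_inv_mul, mul_comm]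
  norm_num

/-- The projection of the plane onto the box. -/
noncomputable def clamp (a : ℝ × ℝ) : ℝ × ℝ := (max (-1) (min 1 a.1), max (-1) (min 1 a.2))

lemma clamp_mem (a : ℝ × ℝ) : clamp a ∈ box :=
  mem_box.2 ⟨⟨le_max_left _ _, max_le (by norm_num) (min_le_left _ _)⟩,
    le_max_left _ _, max_le (by norm_num) (min_le_left _ _)⟩

lemma clamp_of_mem {a : ℝ × ℝ} (h : a ∈ box) : clamp a = a := by
  obtain ⟨⟨h1, h2⟩, h3, h4⟩ := mem_box.1 h
  simp [clamp, h1, h2, h3, h4]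

lemma measurable_clamp : Measurable clamp := by
  unfold clamp; fun_prop

/-- The perturbations of a configuration, projected onto the box, so that they lie in the box for
every configuration and not only for almost every one. -/
noncomputable def perturb (ω : Config) : ℤ × ℤ → ℝ × ℝ := fun w => clamp (ω w)

lemma perturb_mem (ω : Config) (w : ℤ × ℤ) : perturb ω w ∈ box := clamp_mem _

/-- The `σ`-algebra generated by the perturbations of the sites in `A`. -/
@[reducible]
def sigmaOf (A : Set (ℤ × ℤ)) : MeasurableSpace Config :=
  ⨆ w ∈ A, MeasurableSpace.comap (fun ω : Config => ω w) inferInstance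

lemma sigmaOf_le (A : Set (ℤ × ℤ)) : sigmaOf A ≤ (MeasurableSpace.pi : MeasurableSpace Config) :=
  iSup₂_le fun w _ => (measurable_pi_apply w).comap_le

lemma sigmaOf_mono {A B : Set (ℤ × ℤ)} (h : A ⊆ B) : sigmaOf A ≤ sigmaOf B :=
  biSup_mono fun _ hw => h hw

lemma measurable_perturb {A : Set (ℤ × ℤ)} {w : ℤ × ℤ} (hw : w ∈ A) :
    Measurable[sigmaOf A] fun ω => perturb ω w := by
  have h : Measurable[sigmaOf A] fun ω : Config => ω w :=
    measurable_iff_comap_le.2 (le_iSup₂_of_le w hw le_rfl)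
  exact measurable_clamp.comp h

lemma indep_sigmaOf {A B : Set (ℤ × ℤ)} (h : Disjoint A B) : Indep (sigmaOf A) (sigmaOf B) law := by
  have hi : iIndepFun (fun (w : ℤ × ℤ) (ω : Config) => ω w) law :=
    iIndepFun_infinitePi (P := fun _ => unif) (X := fun _ => id) fun _ => measurable_id
  exact indep_iSup_of_disjoint (fun w => (measurable_pi_apply w).comap_le) hi h

lemma law_inter {A B : Set (ℤ × ℤ)} (h : Disjoint A B) {s t : Set Config}
    (hs : MeasurableSet[sigmaOf A] s) (ht : MeasurableSet[sigmaOf B] t) :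
    law (s ∩ t) = law s * law t := (Indep_iff _ _ _).1 (indep_sigmaOf h) s t hs ht

/-- A finite number of local constraints on the perturbations, each of probability at least `η`, is
satisfied with probability at least a power of `η`. -/
lemma le_law_forall {F : Finset (ℤ × ℤ)} {S : ℤ × ℤ → Set (ℝ × ℝ)} (hS : ∀ w ∈ F, MeasurableSet (S w))
    (hbox : ∀ w ∈ F, S w ⊆ box) {η : ENNReal} (h : ∀ w ∈ F, η ≤ unif (S w)) :
    η ^ F.card ≤ law {ω | ∀ w ∈ F, perturb ω w ∈ S w} := by
  have e : {ω : Config | ∀ w ∈ F, perturb ω w ∈ S w} =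
      Set.pi (F : Set (ℤ × ℤ)) fun w => clamp ⁻¹' S w := by
    ext ω; simp [Set.mem_pi, perturb]
  rw [e, law, Measure.infinitePi_pi _ fun w hw => measurable_clamp (hS w hw)]
  refine Finset.pow_card_le_prod F _ _ fun w hw => (h w hw).trans (measure_mono fun a ha => ?_)
  rw [mem_preimage, clamp_of_mem (hbox w hw ha)]
  exact ha

/-! ### Almost every configuration is generic -/

lemma unif_absolutelyContinuous : unif ≪ volume := cond_absolutelyContinuous

lemma unif_compl_box : unif boxᶜ = 0 := by
  rw [unif, cond_apply measurableSet_box, inter_compl_self, measure_empty, mul_zero]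

lemma volume_graph_eq_zero {f : ℝ → ℝ} (hf : Measurable f) :
    (volume : Measure (ℝ × ℝ)) {a | a.2 = f a.1} = 0 := by
  have hm : MeasurableSet {a : ℝ × ℝ | a.2 = f a.1} :=
    measurableSet_eq_fun measurable_snd (hf.comp measurable_fst)
  rw [Measure.volume_eq_prod, Measure.measure_prod_null hm]
  refine Filter.Eventually.of_forall fun x => ?_
  have : Prod.mk x ⁻¹' {a : ℝ × ℝ | a.2 = f a.1} = {f x} := by ext y; simp
  simp [this]

/-- A vertex almost surely avoids the `ℓ¹` spheres that are determined by the other vertices. -/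
lemma law_sphere_eq_zero {w : ℤ × ℤ} {A : Set (ℤ × ℤ)} (hw : w ∉ A) {f g : Config → ℝ}
    (hf : Measurable[sigmaOf A] f) (hg : Measurable[sigmaOf A] g) :
    law {ω | |(vertex (perturb ω) w).1 - f ω| + (vertex (perturb ω) w).2 = g ω} = 0 := by
  have hf' : Measurable f := hf.mono (sigmaOf_le A) le_rfl
  have hg' : Measurable g := hg.mono (sigmaOf_le A) le_rfl
  have hind : IndepFun (fun ω => (f ω, g ω)) (fun ω : Config => ω w) law := by
    refine indep_of_indep_of_le_right (indep_of_indep_of_le_left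
      (indep_sigmaOf (A := A) (B := {w}) (disjoint_singleton_right.2 hw)) ?_) ?_
    · exact measurable_iff_comap_le.1 (hf.prodMk hg)
    · exact le_iSup₂_of_le w rfl le_rfl
  have hprod := (indepFun_iff_map_prod_eq_prod_map_map (hf'.prodMk hg').aemeasurable
    (measurable_pi_apply w).aemeasurable).1 hind
  have hmarg : law.map (fun ω : Config => ω w) = unif := Measure.infinitePi_map_eval _ w
  let S : Set ((ℝ × ℝ) × ℝ × ℝ) :=
    {p | |(w.1 : ℝ) + (clamp p.2).1 - p.1.1| + (w.2 + (clamp p.2).2) = p.1.2}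
  have habs : Measurable fun r : ℝ => |r| := continuous_abs.measurable
  have hS : MeasurableSet S := by
    refine measurableSet_eq_fun ?_ measurable_fst.snd
    have h1 : Measurable fun p : (ℝ × ℝ) × ℝ × ℝ => clamp p.2 := measurable_clamp.comp measurable_snd
    exact (habs.comp ((h1.fst.const_add _).sub measurable_fst.fst)).add (h1.snd.const_add _)
  have e : {ω | |(vertex (perturb ω) w).1 - f ω| + (vertex (perturb ω) w).2 = g ω} =
      (fun ω : Config => ((f ω, g ω), ω w)) ⁻¹' S := rfl
  rw [e, ← Measure.map_apply ((hf'.prodMk hg').prodMk (measurable_pi_apply w)) hS, hprod, hmarg,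
    Measure.measure_prod_null hS]
  refine Filter.Eventually.of_forall fun p => ?_
  have hgraph : unif {a : ℝ × ℝ | a.2 = p.2 - w.2 - |(w.1 : ℝ) + a.1 - p.1|} = 0 := by
    refine unif_absolutelyContinuous (volume_graph_eq_zero
      (f := fun r => p.2 - w.2 - |(w.1 : ℝ) + r - p.1|) ?_)
    exact (habs.comp (by fun_prop)).const_sub _
  refine measure_mono_null (fun a ha => ?_) (measure_union_null unif_compl_box hgraph)
  by_cases hbox : a ∈ box
  · right
    change |(w.1 : ℝ) + (clamp a).1 - p.1| + (w.2 + (clamp a).2) = p.2 at ha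
    rw [clamp_of_mem hbox] at ha
    change a.2 = p.2 - w.2 - |(w.1 : ℝ) + a.1 - p.1|
    linarith
  · exact Or.inl hbox

lemma l1Dist_eq_iff_sphere {x y z : ℝ × ℝ} (hy : x.2 < y.2) (hz : x.2 < z.2)
    (h : l1Dist x y = l1Dist x z) : |y.1 - x.1| + y.2 = |z.1 - x.1| + z.2 := by
  rw [l1Dist_of_lt hy, l1Dist_of_lt hz] at h
  linarith

theorem generic_ae : ∀ᵐ ω ∂law, Generic (perturb ω) := by
  have habs : Measurable fun r : ℝ => |r| := continuous_abs.measurable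
  have h1 : ∀ᵐ ω ∂law, ∀ p w w' : ℤ × ℤ, w ≠ w' →
      ¬ |(vertex (perturb ω) w).1 - (latticePoint p).1| + (vertex (perturb ω) w).2 =
        |(vertex (perturb ω) w').1 - (latticePoint p).1| + (vertex (perturb ω) w').2 := by
    refine ae_all_iff.2 fun p => ae_all_iff.2 fun w => ae_all_iff.2 fun w' => ?_
    by_cases hw : w = w'
    · exact Filter.Eventually.of_forall fun _ h => absurd hw h
    · have hv := measurable_vertex (measurable_perturb (mem_singleton w'))
      have h0 := law_sphere_eq_zero (w := w) (A := {w'}) hw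
        (f := fun _ => (latticePoint p).1) (g := fun ω =>
          |(vertex (perturb ω) w').1 - (latticePoint p).1| + (vertex (perturb ω) w').2)
        measurable_const ((habs.comp (hv.fst.sub_const _)).add hv.snd)
      filter_upwards [measure_eq_zero_iff_ae_notMem.1 h0] with ω hω _
      exact hω
  have h2 : ∀ᵐ ω ∂law, ∀ p w w' : ℤ × ℤ, w ≠ w' → w ≠ p → w' ≠ p →
      ¬ |(vertex (perturb ω) w).1 - (vertex (perturb ω) p).1| + (vertex (perturb ω) w).2 =
        |(vertex (perturb ω) w').1 - (vertex (perturb ω) p).1| + (vertex (perturb ω) w').2 := by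
    refine ae_all_iff.2 fun p => ae_all_iff.2 fun w => ae_all_iff.2 fun w' => ?_
    by_cases hw : w = w'
    · exact Filter.Eventually.of_forall fun _ h => absurd hw h
    by_cases hp : w = p
    · exact Filter.Eventually.of_forall fun _ _ h => absurd hp h
    · have hv := measurable_vertex (measurable_perturb (A := {w', p}) (w := w') (by simp))
      have hv' := measurable_vertex (measurable_perturb (A := {w', p}) (w := p) (by simp))
      have h0 := law_sphere_eq_zero (w := w) (A := {w', p}) (by simp [hw, hp])
        (f := fun ω => (vertex (perturb ω) p).1) (g := fun ω =>
          |(vertex (perturb ω) w').1 - (vertex (perturb ω) p).1| + (vertex (perturb ω) w').2)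
        hv'.fst ((habs.comp (hv.fst.sub hv'.fst)).add hv.snd)
      filter_upwards [measure_eq_zero_iff_ae_notMem.1 h0] with ω hω _ _ _
      exact hω
  filter_upwards [h1, h2] with ω g1 g2
  intro x hx
  obtain ⟨y, hy⟩ := exists_isNextStep (perturb_mem ω) x
  refine ⟨y, hy, fun z hz => ?_⟩
  have hd : l1Dist x z = l1Dist x y :=
    le_antisymm (hz.2.2 y hy.1 hy.2.1) (hy.2.2 z hz.1 hz.2.1)
  have hd' := l1Dist_eq_iff_sphere hz.2.1 hy.2.1 hd
  obtain ⟨w, rfl⟩ := hz.1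
  obtain ⟨w', rfl⟩ := hy.1
  by_contra hne
  have hww : w ≠ w' := fun h => hne (by rw [h])
  rcases hx with ⟨p, rfl⟩ | ⟨p, rfl⟩
  · exact g1 p w w' hww hd'
  · refine g2 p w w' hww (fun h => ?_) (fun h => ?_) hd'
    · rw [h] at hz; exact lt_irrefl _ hz.2.1
    · rw [h] at hy; exact lt_irrefl _ hy.2.1

/-! ### Levels and wall events -/

/-- The path from `x` where it leaves the height `20 j - 7`. This point is determined by the rows up
to `20 j`. -/
noncomputable def levelPoint (x : ℝ × ℝ) (j : ℕ) (ω : Config) : ℝ × ℝ :=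
  exitPoint (vertexSet (perturb ω)) (20 * j - 7) x

/-- The index of the block of `33` consecutive columns that contains the path at level `j`. -/
noncomputable def levelBlock (x : ℝ × ℝ) (j : ℕ) (ω : Config) : ℤ := ⌊(levelPoint x j ω).1 / 33⌋

/-- The information contained in the rows up to `20 j`. -/
@[reducible]
def past (j : ℕ) : MeasurableSpace Config := sigmaOf (rowsLE (20 * j))

lemma past_le (j : ℕ) : past j ≤ (MeasurableSpace.pi : MeasurableSpace Config) := sigmaOf_le _

lemma past_mono : Monotone past := fun i j hij => sigmaOf_mono fun w hw => by
  have : (i : ℤ) ≤ j := by exact_mod_cast hij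
  have hw' : w.2 ≤ 20 * (i : ℤ) := hw
  change w.2 ≤ 20 * (j : ℤ)
  omega

lemma measurable_levelPoint (x : ℝ × ℝ) (j : ℕ) : Measurable[past j] (levelPoint x j) := by
  have e : levelPoint x j = fun ω =>
      exitPoint (vertices (perturb ω) (rowsLE (20 * j))) (20 * j - 7) x :=
    funext fun ω => exitPoint_rowsLE (perturb_mem ω) (by push_cast; exact le_rfl) x
  rw [e]
  exact measurable_exitPoint (fun w hw => measurable_perturb hw) measurable_const _

lemma measurable_levelBlock (x : ℝ × ℝ) (j : ℕ) : Measurable[past j] (levelBlock x j) :=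
  (Int.measurable_floor.comp (measurable_id.div_const 33)).comp
    (measurable_fst.comp (measurable_levelPoint x j))

lemma measurableSet_levelBlock (x : ℝ × ℝ) (j : ℕ) (q : ℤ) :
    MeasurableSet[past j] {ω | levelBlock x j ω = q} :=
  measurable_levelBlock x j (measurableSet_singleton q)

/-- The abscissa of the possible wall of index `q` at level `j`. The walls of consecutive levels
use different columns, which makes them independent although they share rows. -/
def wallPos (j : ℕ) (q : ℤ) : ℤ := 33 * q + 11 * ((j : ℤ) % 2)

/-- The event that there is a wall of index `q` around the level `j`. -/
def wallEvent (j : ℕ) (q : ℤ) : Set Config :=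
  {ω | IsWall (perturb ω) (wallPos j q) (20 * j - 10) (20 * j + 20)}

/-- The event that the part of the wall of index `q` in the rows up to `20 j` is present. -/
def halfWallEvent (j : ℕ) (q : ℤ) : Set Config :=
  {ω | IsWall (perturb ω) (wallPos j q) (20 * j - 10) (20 * j)}

lemma wallEvent_subset (j : ℕ) (q : ℤ) : wallEvent j q ⊆ halfWallEvent j q :=
  fun _ h => IsWall.mono h (by omega)

lemma measurableSet_columnSet (d : ℤ) : MeasurableSet (columnSet d) := by
  unfold columnSet
  split_ifs <;> exact measurableSet_Icc.prod measurableSet_Icc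

lemma columnSet_subset_box (d : ℤ) : columnSet d ⊆ box := by
  unfold columnSet box
  split_ifs <;> exact prod_mono (Icc_subset_Icc (by norm_num) (by norm_num))
    (Icc_subset_Icc (by norm_num) (by norm_num))

lemma le_unif_columnSet (d : ℤ) : ENNReal.ofReal (1 / 256) ≤ unif (columnSet d) := by
  have hb := columnSet_subset_box d
  unfold columnSet at hb ⊢
  split_ifs at hb ⊢ <;> rw [unif_rect hb (by norm_num)] <;>
    exact ENNReal.ofReal_le_ofReal (by norm_num)

lemma measurableSet_isWall (c a b : ℤ) {A : Set (ℤ × ℤ)} (h : strip c a b ⊆ A) :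
    MeasurableSet[sigmaOf A] {ω | IsWall (perturb ω) c a b} := by
  have e : {ω | IsWall (perturb ω) c a b} =
      ⋂ w : strip c a b, (fun ω => perturb ω w) ⁻¹' columnSet (w.1.1 - c) := by
    ext ω
    simp [IsWall]
  rw [e]
  exact MeasurableSet.iInter fun w => measurable_perturb (h w.2) (measurableSet_columnSet _)

/-- The sites used by the walls around the level `j`. -/
def wallSites (j : ℕ) : Set (ℤ × ℤ) :=
  {w | (20 * (j : ℤ) - 10 < w.2 ∧ w.2 ≤ 20 * j + 20) ∧ ∃ q, |w.1 - wallPos j q| ≤ 5}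

lemma measurableSet_wallEvent (j : ℕ) (q : ℤ) : MeasurableSet[sigmaOf (wallSites j)] (wallEvent j q) :=
  measurableSet_isWall _ _ _ fun _ hw => ⟨hw.1, q, hw.2⟩

lemma measurableSet_halfWallEvent (j : ℕ) (q : ℤ) : MeasurableSet[past j] (halfWallEvent j q) :=
  measurableSet_isWall _ _ _ fun _ hw => hw.1.2

lemma disjoint_wallSites (j : ℕ) :
    Disjoint (rowsLE (20 * j) ∪ wallSites j) (wallSites (j + 1)) := by
  rw [Set.disjoint_left]
  rintro w hw ⟨⟨h1, -⟩, q', hq'⟩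
  push_cast at h1
  rcases hw with hw | ⟨-, q, hq⟩
  · have hw' : w.2 ≤ 20 * (j : ℤ) := hw
    omega
  · have a1 := abs_le.1 hq
    have a2 := abs_le.1 hq'
    simp only [wallPos] at a1 a2
    push_cast at a2
    omega

/-- The lower bound for the probability of a wall. -/
noncomputable def wallProb : ENNReal := ENNReal.ofReal (1 / 256) ^ 330

lemma wallProb_pos : wallProb ≠ 0 := pow_ne_zero _ (by simp)

lemma wallProb_le_law (j : ℕ) (q : ℤ) : wallProb ≤ law (wallEvent j q) := by
  let F : Finset (ℤ × ℤ) := Finset.Icc (wallPos j q - 5) (wallPos j q + 5) ×ˢ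
    Finset.Ioc (20 * (j : ℤ) - 10) (20 * j + 20)
  have hF : F.card = 330 := by
    rw [Finset.card_product, Int.card_Icc, Int.card_Ioc,
      show wallPos j q + 5 + 1 - (wallPos j q - 5) = 11 by ring,
      show (20 * (j : ℤ) + 20 - (20 * j - 10)) = 30 by ring]
    rfl
  have h := le_law_forall (F := F) (S := fun w => columnSet (w.1 - wallPos j q))
    (fun _ _ => measurableSet_columnSet _) (fun _ _ => columnSet_subset_box _)
    fun _ _ => le_unif_columnSet _
  rw [hF] at h
  refine h.trans (measure_mono fun ω hω w hw => hω w ?_)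
  have := abs_le.1 hw.2
  exact Finset.mem_product.2 ⟨Finset.mem_Icc.2 ⟨by linarith, by linarith⟩,
    Finset.mem_Ioc.2 hw.1⟩

lemma wallProb_le_one : wallProb ≤ 1 := (wallProb_le_law 0 0).trans prob_le_one

/-- Independent events of probability at least `p` fail simultaneously with geometrically small
probability. -/
lemma law_forall_notMem_le {E : ℕ → Set Config} {A : ℕ → Set (ℤ × ℤ)} {p : ENNReal}
    (hE : ∀ i, MeasurableSet[sigmaOf (A i)] (E i)) (hA : Pairwise (Function.onFun Disjoint A))
    (hp : ∀ i, p ≤ law (E i)) (m : ℕ) : law (⋂ i : Fin m, (E i)ᶜ) ≤ (1 - p) ^ m := by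
  have hmeas : ∀ m, MeasurableSet[sigmaOf (⋃ i : Fin m, A i)] (⋂ i : Fin m, (E i)ᶜ) := fun m =>
    MeasurableSet.iInter fun i => (sigmaOf_mono (subset_iUnion (fun i : Fin m => A i) i) _
      (hE i)).compl
  induction m with
  | zero => simp
  | succ m ih =>
    have e : (⋂ i : Fin (m + 1), (E i)ᶜ) = (⋂ i : Fin m, (E i)ᶜ) ∩ (E m)ᶜ := by
      ext ω
      simp only [mem_iInter, mem_inter_iff, mem_compl_iff]
      constructor
      · exact fun h => ⟨fun i => h i.castSucc, h (Fin.last m)⟩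
      · rintro ⟨h1, h2⟩ i
        rcases Fin.lastCases (motive := fun i => i = Fin.last m ∨ ∃ k : Fin m, i = k.castSucc)
          (Or.inl rfl) (fun k => Or.inr ⟨k, rfl⟩) i with rfl | ⟨k, rfl⟩
        · exact h2
        · exact h1 k
    have hd : Disjoint (⋃ i : Fin m, A i) (A m) :=
      disjoint_iUnion_left.2 fun i => hA i.2.ne
    rw [e, law_inter hd (hmeas m) (hE m).compl, pow_succ,
      prob_compl_eq_one_sub (sigmaOf_le _ _ (hE m))]
    gcongr
    exact hp m

/-- The event that, on one side of the block `q`, none of the first `m` possible walls around the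
level `j` is present. -/
def noWall (j : ℕ) (q : ℤ) (m : ℕ) : Set Config :=
  (⋂ i : Fin m, (wallEvent j (q + 1 + (i : ℕ)))ᶜ) ∪ ⋂ i : Fin m, (wallEvent j (q - 1 - (i : ℕ)))ᶜ

lemma measurableSet_noWall (j : ℕ) (q : ℤ) (m : ℕ) :
    MeasurableSet[sigmaOf (wallSites j)] (noWall j q m) :=
  (MeasurableSet.iInter fun _ => (measurableSet_wallEvent j _).compl).union
    (MeasurableSet.iInter fun _ => (measurableSet_wallEvent j _).compl)

lemma measurableSet_noWall' (j : ℕ) (q : ℤ) (m : ℕ) : MeasurableSet (noWall j q m) :=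
  sigmaOf_le _ _ (measurableSet_noWall j q m)

lemma noWall_zero (j : ℕ) (q : ℤ) : noWall j q 0 = univ := by simp [noWall]

lemma noWall_anti (j : ℕ) (q : ℤ) : Antitone (noWall j q) := fun m m' h => by
  refine union_subset_union ?_ ?_ <;>
  · intro ω hω
    rw [mem_iInter] at hω ⊢
    exact fun i => hω (i.castLE h)

lemma law_noWall_le (j : ℕ) (q : ℤ) (m : ℕ) : law (noWall j q m) ≤ 2 * (1 - wallProb) ^ m := by
  rw [two_mul]
  have aux : ∀ f : ℕ → ℤ, Function.Injective f →
      law (⋂ i : Fin m, (wallEvent j (f i))ᶜ) ≤ (1 - wallProb) ^ m := by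
    intro f hf
    refine law_forall_notMem_le (E := fun i => wallEvent j (f i))
      (A := fun i => strip (wallPos j (f i)) (20 * j - 10) (20 * j + 20))
      (fun i => measurableSet_isWall _ _ _ Subset.rfl) (fun i i' hii => ?_)
      (fun i => wallProb_le_law j _) m
    rw [Function.onFun, Set.disjoint_left]
    rintro w ⟨-, h1⟩ ⟨-, h2⟩
    have a1 := abs_le.1 h1
    have a2 := abs_le.1 h2
    have hne : f i ≠ f i' := fun h => hii (hf h)
    simp only [wallPos] at a1 a2
    omega
  exact (measure_union_le _ _).trans (add_le_add
    (aux (fun i => q + 1 + i) fun i i' h => by simpa using h)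
    (aux (fun i => q - 1 - i) fun i i' h => by simpa using h))

/-- The number of blocks, counted from the block `q`, in which walls around the level `j` have to be
searched until one is found on each side. -/
noncomputable def gapFrom (j : ℕ) (q : ℤ) (ω : Config) : ENNReal :=
  ∑' m, (noWall j q m).indicator 1 ω

lemma measurable_tsum_indicator {α : Type*} {mα : MeasurableSpace α} {s : ℕ → Set α}
    (hs : ∀ m, MeasurableSet (s m)) :
    Measurable fun a => ∑' m, (s m).indicator (1 : α → ENNReal) a :=
  Measurable.tsum fun m => measurable_one.indicator (hs m)

lemma measurable_gapFrom (j : ℕ) (q : ℤ) : Measurable[sigmaOf (wallSites j)] (gapFrom j q) :=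
  measurable_tsum_indicator fun m => measurableSet_noWall j q m

lemma measurable_gapFrom' (j : ℕ) (q : ℤ) : Measurable (gapFrom j q) :=
  (measurable_gapFrom j q).mono (sigmaOf_le _) le_rfl

lemma setLIntegral_gapFrom (j : ℕ) (q : ℤ) (B : Set Config) :
    ∫⁻ ω in B, gapFrom j q ω ∂law = ∑' m, law (noWall j q m ∩ B) := by
  simp only [gapFrom]
  rw [lintegral_tsum fun m => (measurable_one.indicator (measurableSet_noWall' j q m)).aemeasurable]
  refine tsum_congr fun m => ?_
  rw [lintegral_indicator_one (measurableSet_noWall' j q m),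
    Measure.restrict_apply (measurableSet_noWall' j q m)]

/-- The expected gap, up to a constant factor. -/
noncomputable def gapMean : ENNReal := 2 * wallProb⁻¹

lemma gapMean_ne_top : gapMean ≠ ⊤ :=
  ENNReal.mul_ne_top (by simp) (ENNReal.inv_ne_top.2 wallProb_pos)

lemma tsum_noWall_le (j : ℕ) (q : ℤ) : ∑' m, law (noWall j q m) ≤ gapMean := by
  refine (ENNReal.tsum_le_tsum fun m => law_noWall_le j q m).trans ?_
  rw [ENNReal.tsum_mul_left, ENNReal.tsum_geometric,
    ENNReal.sub_sub_cancel ENNReal.one_ne_top wallProb_le_one, gapMean]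

lemma le_gapFrom {j : ℕ} {q : ℤ} {m : ℕ} {ω : Config} (h : ω ∈ noWall j q m) :
    (m : ENNReal) + 1 ≤ gapFrom j q ω := by
  refine le_trans ?_ (ENNReal.sum_le_tsum (Finset.range (m + 1)))
  rw [Finset.sum_congr rfl fun i hi => indicator_of_mem (noWall_anti j q
    (Nat.lt_succ_iff.1 (Finset.mem_range.1 hi)) h) (1 : Config → ENNReal)]
  simp

/-- The configurations for which all paths are well defined and go up to infinity. -/
def Typical (ω : Config) : Prop :=
  Generic (perturb ω) ∧ ∀ j q, ∃ m, ω ∉ noWall j q m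

theorem typical_ae : ∀ᵐ ω ∂law, Typical ω := by
  refine generic_ae.and (ae_all_iff.2 fun j => ae_all_iff.2 fun q => ?_)
  have h : ∀ᵐ ω ∂law, gapFrom j q ω < ⊤ := by
    refine ae_lt_top (measurable_gapFrom' j q) ?_
    have := setLIntegral_gapFrom j q univ
    simp only [Measure.restrict_univ, inter_univ] at this
    rw [this]
    exact ((tsum_noWall_le j q).trans_lt gapMean_ne_top.lt_top).ne
  filter_upwards [h] with ω hω
  by_contra! hcon
  refine hω.ne (ENNReal.eq_top_of_forall_nnreal_le fun r => ?_)
  obtain ⟨n, hn⟩ := exists_nat_ge r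
  refine le_trans ?_ (le_gapFrom (hcon n))
  exact le_trans (by exact_mod_cast hn) (self_le_add_right _ _)

/-! ### Displacement of a path between two levels -/

section Displacement

variable {a : ℤ} {j : ℕ} {ω : Config}

/-- The lattice points of height `0`. -/
noncomputable abbrev base (a : ℤ) : ℝ × ℝ := latticePoint (a, 0)

lemma base_mem (a : ℤ) (U : ℤ × ℤ → ℝ × ℝ) : base a ∈ starts U := Or.inl ⟨_, rfl⟩

lemma levelPoint_mem (hG : Generic (perturb ω)) : levelPoint (base a) j ω ∈ starts (perturb ω) := by
  obtain ⟨k, hk, -⟩ := exists_iterate_eq_exitPoint (vertexSet (perturb ω)) (20 * j - 7) (base a)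
  rw [levelPoint, ← hk]
  exact hG.iterate_mem (base_mem a _) k

lemma exists_walls {q : ℤ} {m : ℕ} (h : ω ∉ noWall j q m) :
    (∃ i < m, ω ∈ wallEvent j (q + 1 + (i : ℕ))) ∧
      ∃ i < m, ω ∈ wallEvent j (q - 1 - (i : ℕ)) := by
  simp only [noWall, mem_union, mem_iInter, mem_compl_iff, not_or, not_forall, not_not] at h
  obtain ⟨⟨i, hi⟩, ⟨i', hi'⟩⟩ := h
  exact ⟨⟨i, i.2, hi⟩, ⟨i', i'.2, hi'⟩⟩

lemma levelBlock_bounds (x : ℝ × ℝ) (j : ℕ) (ω : Config) :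
    33 * (levelBlock x j ω : ℝ) ≤ (levelPoint x j ω).1 ∧
      (levelPoint x j ω).1 < 33 * (levelBlock x j ω + 1) := by
  have h1 := Int.floor_le ((levelPoint x j ω).1 / 33)
  have h2 := Int.lt_floor_add_one ((levelPoint x j ω).1 / 33)
  rw [le_div_iff₀ (by norm_num)] at h1
  rw [div_lt_iff₀ (by norm_num)] at h2
  constructor
  · rw [levelBlock]; linarith
  · rw [levelBlock]; linarith

lemma wallPos_bounds (j : ℕ) (q : ℤ) :
    33 * (q : ℝ) ≤ wallPos j q ∧ (wallPos j q : ℝ) ≤ 33 * q + 11 := by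
  have h : 0 ≤ (j : ℤ) % 2 ∧ (j : ℤ) % 2 ≤ 1 := by omega
  have h1 : 33 * q ≤ wallPos j q := by rw [wallPos]; omega
  have h2 : wallPos j q ≤ 33 * q + 11 := by rw [wallPos]; omega
  exact ⟨by exact_mod_cast h1, by exact_mod_cast h2⟩

/-- Walls on both sides confine the path until the next level. -/
lemma levelPoint_succ_of_notMem (hG : Generic (perturb ω))
    (hE : Exits (vertexSet (perturb ω)) (20 * j - 7) (base a)) {m : ℕ}
    (hm : ω ∉ noWall j (levelBlock (base a) j ω) m) :
    Exits (vertexSet (perturb ω)) (20 * (j + 1 : ℕ) - 7) (base a) ∧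
      33 * ((levelBlock (base a) j ω : ℝ) - m) - 1 / 16 ≤ (levelPoint (base a) (j + 1) ω).1 ∧
      (levelPoint (base a) (j + 1) ω).1 ≤
        33 * ((levelBlock (base a) j ω : ℝ) + m) + 11 + 1 / 16 := by
  obtain ⟨⟨i, hi, hW⟩, i', hi', hW'⟩ := exists_walls hm
  set q := levelBlock (base a) j ω with hq
  have hb := levelBlock_bounds (base a) j ω
  have p1 := wallPos_bounds j (q + 1 + (i : ℕ))
  have p2 := wallPos_bounds j (q - 1 - (i' : ℕ))
  push_cast at p1 p2
  have hi1 : (i : ℝ) + 1 ≤ m := by exact_mod_cast hi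
  have hi2 : (i' : ℝ) + 1 ≤ m := by exact_mod_cast hi'
  have hi0 : (0 : ℝ) ≤ i := Nat.cast_nonneg i
  have hi0' : (0 : ℝ) ≤ i' := Nat.cast_nonneg i'
  have hlt := hE.lt_exitPoint
  obtain ⟨k, hk⟩ : ∃ k, (nextStep (vertexSet (perturb ω)))^[k] (base a) = levelPoint (base a) j ω :=
    ⟨_, rfl⟩
  obtain ⟨h1, h2, h3⟩ := hG.exitPoint_between_walls (perturb_mem ω) hW' hW (levelPoint_mem (a := a) hG)
    (s := 20 * (j + 1 : ℕ) - 7) (by change _ ≤ (exitPoint _ _ _).2; push_cast; linarith)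
    (by linarith [hb.1]) (by linarith [hb.2]) (by push_cast; linarith)
  have hE' : Exits (vertexSet (perturb ω)) (20 * (j + 1 : ℕ) - 7) (base a) := by
    rw [← hk] at h1; exact h1.of_iterate
  have e : exitPoint (vertexSet (perturb ω)) (20 * (j + 1 : ℕ) - 7) (levelPoint (base a) j ω) =
      levelPoint (base a) (j + 1) ω := by
    rw [levelPoint, levelPoint, hE'.exitPoint_exitPoint (by push_cast; linarith)]
  rw [e] at h2 h3
  exact ⟨hE', by linarith, by linarith⟩

lemma Typical.exits (h : Typical ω) (a : ℤ) (j : ℕ) :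
    Exits (vertexSet (perturb ω)) (20 * j - 7) (base a) := by
  induction j with
  | zero => exact exits_of_lt (by simp [latticePoint])
  | succ j ih =>
    obtain ⟨m, hm⟩ := h.2 j (levelBlock (base a) j ω)
    exact (levelPoint_succ_of_notMem h.1 ih hm).1

lemma Typical.exitPoint_levelPoint (h : Typical ω) (a : ℤ) {i j : ℕ} (hij : i ≤ j) :
    exitPoint (vertexSet (perturb ω)) (20 * j - 7) (levelPoint (base a) i ω) =
      levelPoint (base a) j ω := by
  have : (i : ℝ) ≤ j := by exact_mod_cast hij
  exact (h.exits a j).exitPoint_exitPoint (by linarith)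

/-- A large displacement in terms of blocks can only occur if walls are missing. -/
lemma Typical.mem_noWall (h : Typical ω) (a : ℤ) (j : ℕ) :
    ω ∈ noWall j (levelBlock (base a) j ω)
      ((levelBlock (base a) (j + 1) ω - levelBlock (base a) j ω).natAbs - 2) := by
  set n := (levelBlock (base a) (j + 1) ω - levelBlock (base a) j ω).natAbs with hn
  rcases Nat.lt_or_ge n 2 with hn2 | hn2
  · rw [Nat.sub_eq_zero_of_le hn2.le, noWall_zero]; trivial
  by_contra hm
  obtain ⟨-, h1, h2⟩ := levelPoint_succ_of_notMem h.1 (h.exits a j) hm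
  have hb := levelBlock_bounds (base a) (j + 1) ω
  set q := levelBlock (base a) j ω
  set q' := levelBlock (base a) (j + 1) ω
  have e1 : (q' : ℝ) < q + ((n - 2 : ℕ) : ℝ) + 1 := by linarith
  have e2 : (q : ℝ) - ((n - 2 : ℕ) : ℝ) - 2 < q' := by linarith
  have e1' : q' < q + ((n - 2 : ℕ) : ℤ) + 1 := by exact_mod_cast e1
  have e2' : q - ((n - 2 : ℕ) : ℤ) - 2 < q' := by exact_mod_cast e2
  omega

/-- The gap around the path at level `j`. -/
noncomputable def gapAt (x : ℝ × ℝ) (j : ℕ) (ω : Config) : ENNReal :=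
  gapFrom j (levelBlock x j ω) ω

lemma Typical.ofReal_abs_sub_le (h : Typical ω) (a : ℤ) (j : ℕ) :
    ENNReal.ofReal |(levelPoint (base a) (j + 1) ω).1 - (levelPoint (base a) j ω).1| ≤
      99 * gapAt (base a) j ω := by
  classical
  have hex := h.2 j (levelBlock (base a) j ω)
  set m := Nat.find hex with hm
  have hm' := Nat.find_spec hex
  have hpos : 0 < m := by
    rw [Nat.pos_iff_ne_zero]
    intro h0
    rw [← hm, h0, noWall_zero] at hm'
    exact hm' trivial
  obtain ⟨m', hmm⟩ : ∃ m', m = m' + 1 := ⟨m - 1, by omega⟩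
  have hmem : ω ∈ noWall j (levelBlock (base a) j ω) m' := by
    by_contra hcon
    exact Nat.find_min hex (m := m') (by omega) hcon
  obtain ⟨-, h1, h2⟩ := levelPoint_succ_of_notMem h.1 (h.exits a j) hm'
  rw [← hm, hmm] at h1 h2
  have hb := levelBlock_bounds (base a) j ω
  have hle : |(levelPoint (base a) (j + 1) ω).1 - (levelPoint (base a) j ω).1| ≤
      99 * ((m' : ℝ) + 1) := by
    push_cast at h1 h2
    have : (0 : ℝ) ≤ m' := Nat.cast_nonneg m'
    rw [abs_le]; constructor <;> linarith
  refine (ENNReal.ofReal_le_ofReal hle).trans ?_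
  rw [ENNReal.ofReal_mul (by norm_num), ENNReal.ofReal_ofNat]
  gcongr
  refine le_trans (le_of_eq ?_) (le_gapFrom hmem)
  rw [ENNReal.ofReal_add (by positivity) (by norm_num), ENNReal.ofReal_natCast, ENNReal.ofReal_one]

end Displacement

/-! ### Contraction of the gap -/

/-- The event that, on one side of the path at level `j`, none of the first `m` possible walls is
present. -/
def noWallAt (x : ℝ × ℝ) (j m : ℕ) : Set Config :=
  ⋃ q, {ω | levelBlock x j ω = q} ∩ noWall j q m

lemma mem_noWallAt {x : ℝ × ℝ} {j m : ℕ} {ω : Config} :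
    ω ∈ noWallAt x j m ↔ ω ∈ noWall j (levelBlock x j ω) m := by
  rw [noWallAt, mem_iUnion]
  constructor
  · rintro ⟨q, h1, h2⟩
    have h1' : levelBlock x j ω = q := h1
    rw [h1']
    exact h2
  · exact fun h => ⟨levelBlock x j ω, rfl, h⟩

lemma measurableSet_noWallAt (x : ℝ × ℝ) (j m : ℕ) : MeasurableSet (noWallAt x j m) :=
  MeasurableSet.iUnion fun q => (past_le j _ (measurableSet_levelBlock x j q)).inter
    (measurableSet_noWall' j q m)

lemma gapAt_eq_tsum (x : ℝ × ℝ) (j : ℕ) :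
    gapAt x j = fun ω => ∑' m, (noWallAt x j m).indicator (1 : Config → ENNReal) ω := by
  funext ω
  rw [gapAt, gapFrom]
  refine tsum_congr fun m => ?_
  by_cases h : ω ∈ noWall j (levelBlock x j ω) m
  · rw [indicator_of_mem h, indicator_of_mem (mem_noWallAt.2 h)]
  · rw [indicator_of_notMem h, indicator_of_notMem (mt mem_noWallAt.1 h)]

lemma measurable_gapAt (x : ℝ × ℝ) (j : ℕ) : Measurable (gapAt x j) := by
  rw [gapAt_eq_tsum]
  exact measurable_tsum_indicator fun m => measurableSet_noWallAt x j m

lemma setLIntegral_gapAt (x : ℝ × ℝ) (j : ℕ) (B : Set Config) :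
    ∫⁻ ω in B, gapAt x j ω ∂law = ∑' m, law (noWallAt x j m ∩ B) := by
  simp only [gapAt_eq_tsum]
  rw [lintegral_tsum fun m =>
    (measurable_one.indicator (measurableSet_noWallAt x j m)).aemeasurable]
  refine tsum_congr fun m => ?_
  rw [lintegral_indicator_one (measurableSet_noWallAt x j m),
    Measure.restrict_apply (measurableSet_noWallAt x j m)]

lemma iUnion_inter_fiber {Ω β : Type*} (B : Set Ω) (Q : Ω → β) :
    ⋃ q, B ∩ {ω | Q ω = q} = B := by
  ext ω; simp

lemma pairwise_disjoint_inter_fiber {Ω β : Type*} (B : Set Ω) (Q : Ω → β) :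
    Pairwise (Function.onFun Disjoint fun q => B ∩ {ω | Q ω = q}) := by
  intro q q' hq
  rw [Function.onFun, Set.disjoint_left]
  rintro ω ⟨-, h1⟩ ⟨-, h2⟩
  exact hq (h1.symm.trans h2)

lemma tsum_sub_two_le (f : ℕ → ENNReal) : ∑' n, f (n - 2) ≤ 3 * ∑' n, f n := by
  have h0 : f 0 ≤ ∑' n, f n := ENNReal.le_tsum 0
  rw [tsum_eq_zero_add' ENNReal.summable, tsum_eq_zero_add' ENNReal.summable]
  have e : (3 : ENNReal) * ∑' n, f n = ∑' n, f n + (∑' n, f n + ∑' n, f n) := by ring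
  rw [e]
  exact add_le_add h0 (add_le_add h0 le_rfl)

/-- Missing walls at the next level are unlikely, even around the random position of the path: this
position is determined by the past and the walls of the current level, up to a random choice whose
cost is the current gap. -/
lemma law_noWallAt_succ_le (a : ℤ) (j m : ℕ) {B : Set Config} (hB : MeasurableSet[past j] B) :
    law (noWallAt (base a) (j + 1) m ∩ B) ≤
      12 * (1 - wallProb) ^ m * ∫⁻ ω in B, gapAt (base a) j ω ∂law := by
  have hBq : ∀ q, MeasurableSet[past j] (B ∩ {ω | levelBlock (base a) j ω = q}) := fun q =>
    hB.inter (measurableSet_levelBlock _ _ _)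
  have piece : ∀ q, law (noWallAt (base a) (j + 1) m ∩ (B ∩ {ω | levelBlock (base a) j ω = q})) ≤
      12 * (1 - wallProb) ^ m *
        ∫⁻ ω in B ∩ {ω | levelBlock (base a) j ω = q}, gapAt (base a) j ω ∂law := by
    intro q
    set C := B ∩ {ω | levelBlock (base a) j ω = q} with hC
    have e : ∫⁻ ω in C, gapAt (base a) j ω ∂law = ∑' m, law (noWall j q m ∩ C) := by
      rw [← setLIntegral_gapFrom]
      refine setLIntegral_congr_fun (past_le j _ (hBq q)) fun ω hω => ?_
      change gapFrom j _ ω = _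
      rw [show levelBlock (base a) j ω = q from hω.2]
    let D : ℕ → Set Config := fun n => noWall (j + 1) (q + n) m ∪ noWall (j + 1) (q - n) m
    have hD : ∀ n, MeasurableSet[sigmaOf (wallSites (j + 1))] (D n) := fun n =>
      (measurableSet_noWall _ _ _).union (measurableSet_noWall _ _ _)
    have hDle : ∀ n, law (D n) ≤ 4 * (1 - wallProb) ^ m := fun n => by
      refine (measure_union_le _ _).trans ((add_le_add (law_noWall_le _ _ _)
        (law_noWall_le _ _ _)).trans (le_of_eq ?_))
      ring
    have hcov : ∀ᵐ ω ∂law, ω ∈ noWallAt (base a) (j + 1) m ∩ C →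
        ω ∈ ⋃ n : ℕ, (noWall j q (n - 2) ∩ C) ∩ D n := by
      filter_upwards [typical_ae] with ω hω hm
      have h1 := hω.mem_noWall a j
      have h2 : ω ∈ noWall (j + 1) (levelBlock (base a) (j + 1) ω) m := mem_noWallAt.1 hm.1
      have hq : levelBlock (base a) j ω = q := hm.2.2
      rw [hq] at h1
      refine mem_iUnion.2 ⟨_, ⟨h1, hm.2⟩, ?_⟩
      rcases le_total q (levelBlock (base a) (j + 1) ω) with h | h
      · left
        rwa [show q + ((levelBlock (base a) (j + 1) ω - q).natAbs : ℤ) =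
          levelBlock (base a) (j + 1) ω by omega]
      · right
        rwa [show q - ((levelBlock (base a) (j + 1) ω - q).natAbs : ℤ) =
          levelBlock (base a) (j + 1) ω by omega]
    calc law (noWallAt (base a) (j + 1) m ∩ C)
        ≤ law (⋃ n : ℕ, (noWall j q (n - 2) ∩ C) ∩ D n) := measure_mono_ae hcov
      _ ≤ ∑' n : ℕ, law ((noWall j q (n - 2) ∩ C) ∩ D n) := measure_iUnion_le _
      _ ≤ ∑' n : ℕ, law (noWall j q (n - 2) ∩ C) * (4 * (1 - wallProb) ^ m) := by
          refine ENNReal.tsum_le_tsum fun n => ?_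
          rw [law_inter (disjoint_wallSites j) (((sigmaOf_mono subset_union_right) _
            (measurableSet_noWall j q _)).inter ((sigmaOf_mono subset_union_left) _ (hBq q)))
            (hD n)]
          gcongr
          exact hDle n
      _ = (∑' n : ℕ, law (noWall j q (n - 2) ∩ C)) * (4 * (1 - wallProb) ^ m) :=
          ENNReal.tsum_mul_right
      _ ≤ (3 * ∑' n : ℕ, law (noWall j q n ∩ C)) * (4 * (1 - wallProb) ^ m) := by
          gcongr
          exact tsum_sub_two_le fun n => law (noWall j q n ∩ C)
      _ = _ := by rw [e]; ring
  calc law (noWallAt (base a) (j + 1) m ∩ B)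
      ≤ ∑' q, law (noWallAt (base a) (j + 1) m ∩ (B ∩ {ω | levelBlock (base a) j ω = q})) := by
        refine le_trans (measure_mono ?_) (measure_iUnion_le _)
        rw [← inter_iUnion, iUnion_inter_fiber]
    _ ≤ ∑' q, 12 * (1 - wallProb) ^ m *
        ∫⁻ ω in B ∩ {ω | levelBlock (base a) j ω = q}, gapAt (base a) j ω ∂law :=
        ENNReal.tsum_le_tsum piece
    _ = _ := by
        rw [ENNReal.tsum_mul_left, ← lintegral_iUnion (fun q => past_le j _ (hBq q))
          (pairwise_disjoint_inter_fiber _ _), iUnion_inter_fiber]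

/-- The expected gap contracts from one level to the next, up to an additive constant. -/
lemma exists_lintegral_gapAt_succ_le : ∃ G : ℕ, ∀ (a : ℤ) (j : ℕ) (B : Set Config),
    MeasurableSet[past j] B → ∫⁻ ω in B, gapAt (base a) (j + 1) ω ∂law ≤
      G * law B + 2⁻¹ * ∫⁻ ω in B, gapAt (base a) j ω ∂law := by
  have hr : 1 - wallProb < 1 :=
    ENNReal.sub_lt_self ENNReal.one_ne_top one_ne_zero wallProb_pos
  have hlim := ENNReal.Tendsto.const_mul (a := 12 * wallProb⁻¹)
    (ENNReal.tendsto_pow_atTop_nhds_zero_of_lt_one hr)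
    (Or.inr (ENNReal.mul_ne_top (by simp) (ENNReal.inv_ne_top.2 wallProb_pos)))
  rw [mul_zero] at hlim
  obtain ⟨G, hG⟩ := (hlim.eventually_le_const (u := 2⁻¹) (by simp)).exists
  refine ⟨G, fun a j B hB => ?_⟩
  set I := ∫⁻ ω in B, gapAt (base a) j ω ∂law
  rw [setLIntegral_gapAt, ← Summable.sum_add_tsum_nat_add' (k := G) ENNReal.summable]
  refine add_le_add ?_ ?_
  · refine (Finset.sum_le_sum fun m _ => measure_mono inter_subset_right).trans ?_
    simp
  · calc ∑' m, law (noWallAt (base a) (j + 1) (m + G) ∩ B)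
        ≤ ∑' m, 12 * (1 - wallProb) ^ (m + G) * I :=
          ENNReal.tsum_le_tsum fun m => law_noWallAt_succ_le a j _ hB
      _ = 12 * wallProb⁻¹ * (1 - wallProb) ^ G * I := by
          simp_rw [pow_add]
          rw [ENNReal.tsum_mul_right]
          simp_rw [← mul_assoc]
          rw [ENNReal.tsum_mul_right, ENNReal.tsum_mul_left, ENNReal.tsum_geometric,
            ENNReal.sub_sub_cancel ENNReal.one_ne_top wallProb_le_one]
      _ ≤ _ := by gcongr

lemma levelPoint_zero (a : ℤ) (ω : Config) : levelPoint (base a) 0 ω = base a :=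
  exitPoint_of_lt (by simp [latticePoint])

lemma lintegral_gapAt_zero_le (a : ℤ) : ∫⁻ ω, gapAt (base a) 0 ω ∂law ≤ gapMean := by
  have e : gapAt (base a) 0 = gapFrom 0 ⌊(base a).1 / 33⌋ := by
    funext ω
    rw [gapAt, levelBlock, levelPoint_zero]
  have h := setLIntegral_gapFrom 0 ⌊(base a).1 / 33⌋ univ
  simp only [Measure.restrict_univ, inter_univ] at h
  rw [e, h]
  exact tsum_noWall_le _ _

/-- The constant term of the contraction of the gap. -/
noncomputable def drift : ℕ := exists_lintegral_gapAt_succ_le.choose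

lemma lintegral_gapAt_succ_le (a : ℤ) (j : ℕ) {B : Set Config} (hB : MeasurableSet[past j] B) :
    ∫⁻ ω in B, gapAt (base a) (j + 1) ω ∂law ≤
      drift * law B + 2⁻¹ * ∫⁻ ω in B, gapAt (base a) j ω ∂law :=
  exists_lintegral_gapAt_succ_le.choose_spec a j B hB

lemma lintegral_gapAt_ne_top (a : ℤ) (j : ℕ) : ∫⁻ ω, gapAt (base a) j ω ∂law ≠ ⊤ := by
  induction j with
  | zero => exact ne_top_of_le_ne_top gapMean_ne_top (lintegral_gapAt_zero_le a)
  | succ j ih =>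
    have h := lintegral_gapAt_succ_le a j (B := univ) MeasurableSet.univ
    rw [Measure.restrict_univ] at h
    refine ne_top_of_le_ne_top (ENNReal.add_ne_top.2 ⟨?_, ?_⟩) h
    · exact ENNReal.mul_ne_top (by simp) (measure_ne_top _ _)
    · exact ENNReal.mul_ne_top (by simp) ih

/-- The gap around the path at level `j`, as a real number. -/
noncomputable def gap (a : ℤ) (j : ℕ) (ω : Config) : ℝ := (gapAt (base a) j ω).toReal

lemma gap_nonneg (a : ℤ) (j : ℕ) (ω : Config) : 0 ≤ gap a j ω := ENNReal.toReal_nonneg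

lemma integrable_gap (a : ℤ) (j : ℕ) : Integrable (gap a j) law :=
  integrable_toReal_of_lintegral_ne_top (measurable_gapAt _ _).aemeasurable
    (lintegral_gapAt_ne_top a j)

lemma gapAt_ae_lt_top (a : ℤ) (j : ℕ) : ∀ᵐ ω ∂law, gapAt (base a) j ω < ⊤ :=
  ae_lt_top (measurable_gapAt _ _) (lintegral_gapAt_ne_top a j)

lemma setIntegral_gap (a : ℤ) (j : ℕ) (B : Set Config) :
    ∫ ω in B, gap a j ω ∂law = (∫⁻ ω in B, gapAt (base a) j ω ∂law).toReal :=
  integral_toReal (measurable_gapAt _ _).aemeasurable (ae_restrict_of_ae (gapAt_ae_lt_top a j))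

lemma setIntegral_gap_nonneg (a : ℤ) (j : ℕ) (B : Set Config) : 0 ≤ ∫ ω in B, gap a j ω ∂law :=
  integral_nonneg fun ω => gap_nonneg a j ω

lemma setLIntegral_gapAt_ne_top (a : ℤ) (j : ℕ) (B : Set Config) :
    ∫⁻ ω in B, gapAt (base a) j ω ∂law ≠ ⊤ :=
  ne_top_of_le_ne_top (lintegral_gapAt_ne_top a j) (setLIntegral_le_lintegral _ _)

lemma setIntegral_gap_zero_le (a : ℤ) (B : Set Config) :
    ∫ ω in B, gap a 0 ω ∂law ≤ gapMean.toReal := by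
  rw [setIntegral_gap]
  exact ENNReal.toReal_mono gapMean_ne_top
    ((setLIntegral_le_lintegral _ _).trans (lintegral_gapAt_zero_le a))

lemma setIntegral_gap_succ_le (a : ℤ) (j : ℕ) {B : Set Config} (hB : MeasurableSet[past j] B) :
    ∫ ω in B, gap a (j + 1) ω ∂law ≤
      drift * law.real B + (∫ ω in B, gap a j ω ∂law) / 2 := by
  have h1 : (drift : ENNReal) * law B ≠ ⊤ := ENNReal.mul_ne_top (by simp) (measure_ne_top _ _)
  have h2 := ENNReal.mul_ne_top (a := 2⁻¹) (by simp) (setLIntegral_gapAt_ne_top a j B)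
  rw [setIntegral_gap, setIntegral_gap]
  refine (ENNReal.toReal_mono (ENNReal.add_ne_top.2 ⟨h1, h2⟩)
    (lintegral_gapAt_succ_le a j hB)).trans (le_of_eq ?_)
  rw [ENNReal.toReal_add h1 h2, ENNReal.toReal_mul, ENNReal.toReal_mul]
  simp only [ENNReal.toReal_natCast, ENNReal.toReal_inv, ENNReal.toReal_ofNat, measureReal_def]
  ring

/-- The position of the path at level `j`. -/
noncomputable def pos (a : ℤ) (j : ℕ) (ω : Config) : ℝ := (levelPoint (base a) j ω).1

lemma measurable_pos (a : ℤ) (j : ℕ) : Measurable[past j] (pos a j) :=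
  measurable_fst.comp (measurable_levelPoint _ _)

lemma abs_pos_succ_sub_le (a : ℤ) (j : ℕ) :
    ∀ᵐ ω ∂law, |pos a (j + 1) ω - pos a j ω| ≤ 99 * gap a j ω := by
  filter_upwards [typical_ae, gapAt_ae_lt_top a j] with ω h1 h2
  have h := h1.ofReal_abs_sub_le a j
  have h3 := ENNReal.toReal_mono (ENNReal.mul_ne_top (by simp) h2.ne) h
  rwa [ENNReal.toReal_ofReal (abs_nonneg _), ENNReal.toReal_mul, ENNReal.toReal_ofNat] at h3

lemma integrable_pos (a : ℤ) (j : ℕ) : Integrable (pos a j) law := by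
  induction j with
  | zero =>
    have e : pos a 0 = fun _ => (base a).1 := funext fun ω => by rw [pos, levelPoint_zero]
    rw [e]
    exact integrable_const _
  | succ j ih =>
    have hm : ∀ i, Measurable (pos a i) := fun i => (measurable_pos a i).mono (past_le i) le_rfl
    have : Integrable (fun ω => pos a (j + 1) ω - pos a j ω) law := by
      refine Integrable.mono' ((integrable_gap a j).const_mul 99)
        ((hm _).sub (hm _)).aestronglyMeasurable ?_
      filter_upwards [abs_pos_succ_sub_le a j] with ω h
      exact h
    exact (this.add ih).congr (Filter.Eventually.of_forall fun ω => sub_add_cancel _ _)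

/-! ### Reflection of the perturbations -/

/-- The reflection of a single perturbation. -/
def mirror (a : ℝ × ℝ) : ℝ × ℝ := (-a.1, a.2)

lemma measurable_mirror : Measurable mirror := measurable_fst.neg.prodMk measurable_snd

lemma mirror_mem_box {a : ℝ × ℝ} : mirror a ∈ box ↔ a ∈ box := by
  simp only [mem_box, mirror]
  constructor <;> rintro ⟨⟨h1, h2⟩, h3⟩ <;> exact ⟨⟨by linarith, by linarith⟩, h3⟩

lemma map_mirror_unif : unif.map mirror = unif := by
  have h1 : MeasurePreserving mirror (volume : Measure (ℝ × ℝ)) volume :=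
    (Measure.measurePreserving_neg (volume : Measure ℝ)).prod (MeasurePreserving.id volume)
  have h2 := h1.restrict_preimage measurableSet_box
  have h3 : mirror ⁻¹' box = box := by ext a; exact mirror_mem_box
  rw [h3] at h2
  exact (h2.smul_measure ((volume box)⁻¹)).map_eq

lemma clamp_mirror (a : ℝ × ℝ) : clamp (mirror a) = mirror (clamp a) := by
  have h : ∀ r : ℝ, max (-1) (min 1 (-r)) = -max (-1) (min 1 r) := by
    intro r
    rcases le_total r (-1) with h | h
    · rw [min_eq_left (by linarith), min_eq_right (by linarith), max_eq_right (by linarith),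
        max_eq_left (by linarith)]
      ring
    rcases le_total r 1 with h' | h'
    · rw [min_eq_right (by linarith), min_eq_right (by linarith), max_eq_right (by linarith),
        max_eq_right (by linarith)]
    · rw [min_eq_right (by linarith), min_eq_left (by linarith), max_eq_left (by linarith),
        max_eq_right (by linarith)]
  exact Prod.ext (h a.1) rfl

/-- The reflection of a site about the column `c`. -/
def mirrorSite (c : ℤ) (w : ℤ × ℤ) : ℤ × ℤ := (2 * c - w.1, w.2)

lemma mirrorSite_mirrorSite (c : ℤ) (w : ℤ × ℤ) : mirrorSite c (mirrorSite c w) = w := by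
  simp [mirrorSite]

/-- The configuration reflected about the column `c`. -/
def reflectConfig (c : ℤ) (ω : Config) : Config := fun w => mirror (ω (mirrorSite c w))

lemma measurable_reflectConfig (c : ℤ) : Measurable (reflectConfig c) :=
  measurable_pi_iff.2 fun _ => measurable_mirror.comp (measurable_pi_apply _)

lemma measurePreserving_reflectConfig (c : ℤ) : MeasurePreserving (reflectConfig c) law law := by
  refine ⟨measurable_reflectConfig c, ?_⟩
  have hi : iIndepFun (fun (w : ℤ × ℤ) (ω : Config) => ω w) law :=
    iIndepFun_infinitePi (P := fun _ => unif) (X := fun _ => id) fun _ => measurable_id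
  have hinj : Function.Injective (mirrorSite c) := fun w w' h => by
    rw [← mirrorSite_mirrorSite c w, h, mirrorSite_mirrorSite]
  have hi' := (hi.precomp hinj).comp (fun _ => mirror) fun _ => measurable_mirror
  refine map_eq_law (U := fun w (ω : Config) => mirror (ω (mirrorSite c w)))
    (fun w => measurable_mirror.comp (measurable_pi_apply _)) hi' fun w => ?_
  have hmarg : law.map (fun ω : Config => ω (mirrorSite c w)) = unif :=
    Measure.infinitePi_map_eval _ _
  have h2 := Measure.map_map (μ := law) measurable_mirror
    (measurable_pi_apply (X := fun _ => ℝ × ℝ) (mirrorSite c w))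
  rw [hmarg, map_mirror_unif] at h2
  exact h2.symm

lemma perturb_reflectConfig (c : ℤ) (ω : Config) (w : ℤ × ℤ) :
    perturb (reflectConfig c ω) w = mirror (perturb ω (mirrorSite c w)) := clamp_mirror _

lemma vertex_reflectConfig (c : ℤ) (ω : Config) (w : ℤ × ℤ) :
    vertex (perturb (reflectConfig c ω)) w = reflect c (vertex (perturb ω) (mirrorSite c w)) := by
  refine Prod.ext ?_ ?_
  · rw [vertex_fst, perturb_reflectConfig, reflect, vertex_fst]
    simp only [mirror, mirrorSite]
    push_cast
    ring
  · rw [vertex_snd, perturb_reflectConfig, reflect, vertex_snd]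
    rfl

lemma vertices_reflectConfig (c n : ℤ) (ω : Config) :
    vertices (perturb (reflectConfig c ω)) (rowsGT n) =
      reflect c '' vertices (perturb ω) (rowsGT n) := by
  ext z
  constructor
  · rintro ⟨w, hw, rfl⟩
    exact ⟨_, ⟨mirrorSite c w, hw, rfl⟩, (vertex_reflectConfig c ω w).symm⟩
  · rintro ⟨_, ⟨w, hw, rfl⟩, rfl⟩
    refine ⟨mirrorSite c w, hw, ?_⟩
    rw [vertex_reflectConfig, mirrorSite_mirrorSite]

/-! ### Trap events -/

/-- The event that there is a trap of half-width `l` at abscissa `c` above the row `n`. -/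
def trapEvent (c n l : ℤ) : Set Config := {ω | IsTrap (perturb ω) c n l}

lemma measurableSet_trapSet (l d r : ℤ) : MeasurableSet (trapSet l d r) := by
  unfold trapSet
  split_ifs <;> first | exact measurableSet_columnSet _ | exact measurableSet_Icc.prod measurableSet_Icc

lemma trapSet_subset_box {l d r : ℤ} (hl : 0 ≤ l) (hd : r = 1 → |d| ≤ l) : trapSet l d r ⊆ box := by
  unfold trapSet
  split_ifs with h1 h2 h3 h4
  · have h5 : |(d : ℝ)| ≤ l := by exact_mod_cast hd h1
    have h6 := mul_roofSlope_le hl (d := |(d : ℝ)| + 1 / 4) (by linarith)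
    have h7 := roofSlope_pos hl
    have h8 : 0 ≤ |(d : ℝ)| * roofSlope l := mul_nonneg (abs_nonneg _) h7.le
    have h9 := mul_roofSlope_le hl (d := 1) (by
      have : (0 : ℝ) ≤ l := by exact_mod_cast hl
      linarith)
    exact prod_mono (Icc_subset_Icc (by norm_num) (by norm_num))
      (Icc_subset_Icc (by linarith) (by linarith))
  · exact prod_mono (Icc_subset_Icc (by norm_num) (by norm_num))
      (Icc_subset_Icc (by norm_num) (by norm_num))
  · exact prod_mono (Icc_subset_Icc (by norm_num) (by norm_num))
      (Icc_subset_Icc (by norm_num) (by norm_num))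
  · exact prod_mono (Icc_subset_Icc (by norm_num) (by norm_num))
      (Icc_subset_Icc (by norm_num) (by norm_num))
  · exact columnSet_subset_box _

lemma le_unif_trapSet {l d r : ℤ} (hl : 0 ≤ l) (hd : r = 1 → |d| ≤ l) :
    ENNReal.ofReal (roofSlope l / 64) ≤ unif (trapSet l d r) := by
  have hb := trapSet_subset_box hl hd
  have h7 := roofSlope_pos hl
  have h9 := mul_roofSlope_le hl (d := 1) (by
    have : (0 : ℝ) ≤ l := by exact_mod_cast hl
    linarith)
  unfold trapSet at hb ⊢
  split_ifs at hb ⊢ with h1 h2 h3 h4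
  · rw [unif_rect hb (by norm_num)]
    exact ENNReal.ofReal_le_ofReal (by linarith)
  · rw [unif_rect hb (by norm_num)]
    exact ENNReal.ofReal_le_ofReal (by linarith)
  · rw [unif_rect hb (by norm_num)]
    exact ENNReal.ofReal_le_ofReal (by linarith)
  · rw [unif_rect hb (by norm_num)]
    exact ENNReal.ofReal_le_ofReal (by linarith)
  · exact (ENNReal.ofReal_le_ofReal (by linarith)).trans (le_unif_columnSet d)

lemma measurableSet_trapEvent (c n l : ℤ) :
    MeasurableSet[sigmaOf (trapSites c n l)] (trapEvent c n l) := by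
  have e : trapEvent c n l =
      ⋂ w : trapSites c n l, (fun ω => perturb ω w) ⁻¹' trapSet l (w.1.1 - c) (w.1.2 - n) := by
    ext ω
    simp [trapEvent, IsTrap]
  rw [e]
  exact MeasurableSet.iInter fun w => measurable_perturb w.2 (measurableSet_trapSet _ _ _)

lemma measurableSet_trapEvent' (c n l : ℤ) : MeasurableSet (trapEvent c n l) :=
  sigmaOf_le _ _ (measurableSet_trapEvent c n l)

/-- Traps of a given width have a probability that is bounded below uniformly in their position. -/
lemma exists_le_law_trapEvent {l : ℤ} (hl : 0 ≤ l) :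
    ∃ p : ℝ, 0 < p ∧ ∀ c n, p ≤ law.real (trapEvent c n l) := by
  set η := ENNReal.ofReal (roofSlope l / 64) with hη
  have hη0 : η ≠ 0 := by
    rw [hη, Ne, ENNReal.ofReal_eq_zero, not_le]
    linarith [roofSlope_pos hl]
  have hη1 : η ≤ 1 := (le_unif_trapSet hl (d := 0) (r := 2) (by omega)).trans prob_le_one
  set k : ℕ := (2 * l + 1).toNat * 3 + 187 with hk
  have key : ∀ c n, η ^ k ≤ law (trapEvent c n l) := by
    intro c n
    let F : Finset (ℤ × ℤ) := Finset.Icc (c - l) (c + l) ×ˢ Finset.Ioc n (n + 3) ∪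
      Finset.Icc (c - 5) (c + 5) ×ˢ Finset.Ioc (n + 3) (n + 20)
    have hF : ∀ w, w ∈ F ↔ w ∈ trapSites c n l := by
      intro w
      simp only [F, Finset.mem_union, Finset.mem_product, Finset.mem_Icc, Finset.mem_Ioc,
        trapSites, mem_ofPred_eq, abs_le]
      constructor <;> rintro (⟨⟨h1, h2⟩, h3, h4⟩ | ⟨⟨h1, h2⟩, h3, h4⟩)
      · exact Or.inl ⟨⟨h3, h4⟩, by linarith, by linarith⟩
      · exact Or.inr ⟨⟨h3, h4⟩, by linarith, by linarith⟩
      · exact Or.inl ⟨⟨by linarith, by linarith⟩, h1, h2⟩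
      · exact Or.inr ⟨⟨by linarith, by linarith⟩, h1, h2⟩
    have hcard : F.card ≤ k := by
      refine (Finset.card_union_le _ _).trans ?_
      rw [Finset.card_product, Finset.card_product, Int.card_Icc, Int.card_Icc, Int.card_Ioc,
        Int.card_Ioc, show c + l + 1 - (c - l) = 2 * l + 1 by ring, show n + 3 - n = 3 by ring,
        show c + 5 + 1 - (c - 5) = 11 by ring, show n + 20 - (n + 3) = 17 by ring]
      rfl
    have hd : ∀ w ∈ F, w.2 - n = 1 → |w.1 - c| ≤ l := by
      intro w hw h
      rcases (hF w).1 hw with h' | h'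
      · exact h'.2
      · omega
    refine (pow_le_pow_right_of_le_one' hη1 hcard).trans ((le_law_forall (F := F)
      (S := fun w => trapSet l (w.1 - c) (w.2 - n)) (fun _ _ => measurableSet_trapSet _ _ _)
      (fun w hw => trapSet_subset_box hl (hd w hw)) fun w hw => le_unif_trapSet hl (hd w hw)).trans
      (measure_mono fun ω hω w hw => hω w ((hF w).2 hw)))
  refine ⟨(η ^ k).toReal, ENNReal.toReal_pos (pow_ne_zero _ hη0) ?_, fun c n => ?_⟩
  · exact ENNReal.pow_ne_top (by simp [hη])
  · exact ENNReal.toReal_mono (measure_ne_top _ _) (key c n)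

lemma trapSites_subset_rowsGT (c n l : ℤ) : trapSites c n l ⊆ rowsGT n := by
  rintro w (⟨⟨h, -⟩, -⟩ | ⟨⟨h, -⟩, -⟩)
  · exact h
  · exact lt_trans (by omega) h

lemma trapSites_subset_rowsLE (c n l : ℤ) : trapSites c n l ⊆ rowsLE (n + 20) := by
  rintro w (⟨⟨-, h⟩, -⟩ | ⟨⟨-, h⟩, -⟩)
  · exact h.trans (by omega)
  · exact h

lemma disjoint_rowsLE_rowsGT (n : ℤ) : Disjoint (rowsLE n) (rowsGT n) :=
  Set.disjoint_left.2 fun w (h : w.2 ≤ n) (h' : n < w.2) => absurd h' (not_lt.2 h)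

lemma measurableSet_trapEvent_past (c l : ℤ) (j : ℕ) :
    MeasurableSet[past (j + 1)] (trapEvent c (20 * j) l) := by
  refine sigmaOf_mono ?_ _ (measurableSet_trapEvent c (20 * j) l)
  have := trapSites_subset_rowsLE c (20 * j) l
  rwa [show 20 * (j : ℤ) + 20 = 20 * ((j + 1 : ℕ) : ℤ) by push_cast; ring] at this

lemma law_inter_trapEvent {c l : ℤ} {j : ℕ} {B : Set Config} (hB : MeasurableSet[past j] B) :
    law.real (B ∩ trapEvent c (20 * j) l) = law.real B * law.real (trapEvent c (20 * j) l) := by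
  rw [measureReal_def, law_inter ((disjoint_rowsLE_rowsGT _).mono_right
    (trapSites_subset_rowsGT c (20 * j) l)) hB (measurableSet_trapEvent _ _ _), ENNReal.toReal_mul]
  rfl

lemma mirror_mem_trapSet {l d r : ℤ} {a : ℝ × ℝ} (h : a ∈ trapSet l d r) :
    mirror a ∈ trapSet l (-d) r := by
  have aux : ∀ {x y : ℝ} {s : Set ℝ}, a ∈ Icc x y ×ˢ s → mirror a ∈ Icc (-y) (-x) ×ˢ s := by
    rintro x y s ⟨⟨h1, h2⟩, h3⟩
    exact ⟨⟨neg_le_neg h2, neg_le_neg h1⟩, h3⟩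
  unfold trapSet columnSet at *
  rw [Int.cast_neg, abs_neg]
  rcases lt_trichotomy d 0 with hd | rfl | hd
  · rw [if_neg (show -d ≠ 0 by omega), if_pos (show 0 < -d by omega),
      if_neg (show -d ≠ 0 by omega), if_pos (show 0 < -d by omega)]
    rw [if_neg hd.ne, if_neg hd.not_gt, if_neg hd.ne, if_neg hd.not_gt] at h
    split_ifs at h ⊢ <;> convert aux h using 2 <;> norm_num
  · rw [neg_zero]
    simp only [if_true] at h ⊢
    split_ifs at h ⊢ <;> convert aux h using 2 <;> norm_num
  · rw [if_neg (show -d ≠ 0 by omega), if_neg (show ¬ 0 < -d by omega),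
      if_neg (show -d ≠ 0 by omega), if_neg (show ¬ 0 < -d by omega)]
    rw [if_neg hd.ne', if_pos hd, if_neg hd.ne', if_pos hd] at h
    split_ifs at h ⊢ <;> convert aux h using 2 <;> norm_num

lemma reflectConfig_mem_trapEvent {c n l : ℤ} {ω : Config} (h : ω ∈ trapEvent c n l) :
    reflectConfig c ω ∈ trapEvent c n l := by
  intro w hw
  have hw' : mirrorSite c w ∈ trapSites c n l := by
    have e : |(mirrorSite c w).1 - c| = |w.1 - c| := by
      rw [← abs_neg]; congr 1; simp only [mirrorSite]; ring
    exact hw.imp (fun h => ⟨h.1, e ▸ h.2⟩) fun h => ⟨h.1, e ▸ h.2⟩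
  have h1 := mirror_mem_trapSet (h _ hw')
  rw [perturb_reflectConfig]
  have e : -((mirrorSite c w).1 - c) = w.1 - c := by simp only [mirrorSite]; ring
  rwa [e] at h1

lemma reflectConfig_reflectConfig (c : ℤ) (ω : Config) :
    reflectConfig c (reflectConfig c ω) = ω := by
  funext w
  simp [reflectConfig, mirrorSite_mirrorSite, mirror]

lemma reflectConfig_mem_trapEvent_iff {c n l : ℤ} {ω : Config} :
    reflectConfig c ω ∈ trapEvent c n l ↔ ω ∈ trapEvent c n l :=
  ⟨fun h => by simpa only [reflectConfig_reflectConfig] using reflectConfig_mem_trapEvent h,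
    reflectConfig_mem_trapEvent⟩

/-- The abscissa at which the path from the top vertex of a trap at `c` above row `n` leaves the
height `s`, computed in the configuration above row `n`. -/
noncomputable def topExit (c n : ℤ) (s : ℝ) (ω : Config) : ℝ :=
  (exitPoint (vertices (perturb ω) (rowsGT n)) s (vertex (perturb ω) (c, n + 1))).1

lemma measurable_topExit (c n : ℤ) (s : ℝ) : Measurable[sigmaOf (rowsGT n)] (topExit c n s) := by
  have h1 : (c, n + 1) ∈ rowsGT n := lt_add_one n
  exact measurable_fst.comp (measurable_exitPoint (fun w hw => measurable_perturb hw)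
    (measurable_vertex (measurable_perturb h1)) s)

lemma topExit_reflectConfig (c n : ℤ) (s : ℝ) (ω : Config) :
    topExit c n s (reflectConfig c ω) = 2 * c - topExit c n s ω := by
  have e : mirrorSite c (c, n + 1) = (c, n + 1) := Prod.ext (by simp [mirrorSite]; ring) rfl
  rw [topExit, vertices_reflectConfig, vertex_reflectConfig, exitPoint_reflect, e]
  rfl

/-- By symmetry, the path from the top of a trap has no drift, even given the trap and the past. -/
lemma setIntegral_topExit (c l : ℤ) (s : ℝ) {j : ℕ} {B : Set Config} (hB : MeasurableSet[past j] B) :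
    ∫ ω in B ∩ trapEvent c (20 * j) l, (topExit c (20 * j) s ω - c) ∂law = 0 := by
  set E := trapEvent c (20 * j) l with hE
  let f : Config → ℝ := E.indicator fun ω => topExit c (20 * j) s ω - c
  have hf : Measurable[sigmaOf (rowsGT (20 * j))] f :=
    Measurable.indicator ((measurable_topExit c (20 * j) s).sub_const _)
      (sigmaOf_mono (trapSites_subset_rowsGT _ _ _) _ (measurableSet_trapEvent _ _ _))
  have hf' : Measurable f := hf.mono (sigmaOf_le _) le_rfl
  have hodd : ∀ ω, f (reflectConfig c ω) = -f ω := by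
    intro ω
    by_cases h : ω ∈ E
    · simp only [f]
      rw [indicator_of_mem h, indicator_of_mem (reflectConfig_mem_trapEvent h),
        topExit_reflectConfig]
      ring
    · simp only [f]
      rw [indicator_of_notMem h, indicator_of_notMem (mt reflectConfig_mem_trapEvent_iff.1 h),
        neg_zero]
  have h0 : ∫ ω, f ω ∂law = 0 := by
    have hp := measurePreserving_reflectConfig c
    have h1 : ∫ ω, f ω ∂law = ∫ ω, f (reflectConfig c ω) ∂law := by
      conv_lhs => rw [← hp.map_eq]
      exact integral_map hp.measurable.aemeasurable hf'.aestronglyMeasurable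
    simp_rw [hodd, integral_neg] at h1
    linarith
  rw [← setIntegral_indicator (sigmaOf_le _ _ (measurableSet_trapEvent _ _ _))]
  have hind : Indep (past j) (MeasurableSpace.comap f inferInstance) law :=
    indep_of_indep_of_le_right (indep_sigmaOf (disjoint_rowsLE_rowsGT (20 * j)))
      (measurable_iff_comap_le.1 hf)
  have h2 := hind.setIntegral_eq_mul (past_le j) (f := id) hf'.aemeasurable hB
    measurable_id.aestronglyMeasurable
  simp only [id, h0, mul_zero] at h2
  exact h2

/-- A trap inside which the path is confined by walls catches the path. -/
lemma Typical.trapped {ω : Config} (hω : Typical ω) {a c l iL iR : ℤ} {j : ℕ} (hl : 5 ≤ l)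
    (hT : ω ∈ trapEvent c (20 * j) l) (hL : ω ∈ halfWallEvent j iL) (hR : ω ∈ halfWallEvent j iR)
    (hcL : c - l + 12 ≤ wallPos j iL) (hcR : wallPos j iR ≤ c + l - 12)
    (hpL : (wallPos j iL : ℝ) ≤ pos a j ω) (hpR : pos a j ω ≤ wallPos j iR) :
    (∀ i, j < i → levelPoint (base a) i ω =
      exitPoint (vertexSet (perturb ω)) (20 * i - 7) (vertex (perturb ω) (c, 20 * j + 1)) ∧
      pos a i ω = topExit c (20 * j) (20 * i - 7) ω) ∧ |pos a (j + 1) ω - c| ≤ 1 / 16 := by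
  have hU := perturb_mem ω
  have hlow := (hω.exits a j).lt_exitPoint
  have hup : (levelPoint (base a) j ω).2 ≤ 20 * j + 1 := by
    rcases Nat.eq_zero_or_pos j with rfl | hj
    · rw [levelPoint_zero]; simp [latticePoint]
    · have hj' : (1 : ℝ) ≤ j := by exact_mod_cast hj
      have := hω.1.exitPoint_snd_le hU (base_mem a _) (s := 20 * j - 7)
        (by simp only [latticePoint]; push_cast; linarith)
      rw [levelPoint]
      linarith
  obtain ⟨k, hk⟩ := hT.catches hU hω.1 (by omega) (a := 20 * j - 10) (by omega) hL hR hcL hcR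
    (levelPoint_mem (a := a) (j := j) hω.1) (by push_cast; rw [levelPoint]; linarith)
    (by push_cast; linarith) hpL hpR
  have hc0 : |c - c| ≤ l := by simp; omega
  have hb := hT.roof_bounds (by omega) hc0
  push_cast at hb
  have main : ∀ i, j < i → levelPoint (base a) i ω =
      exitPoint (vertexSet (perturb ω)) (20 * i - 7) (vertex (perturb ω) (c, 20 * j + 1)) := by
    intro i hi
    have hi' : (j : ℝ) + 1 ≤ i := by exact_mod_cast hi
    rw [← hω.exitPoint_levelPoint a hi.le, ← hk]
    refine (Exits.exitPoint_iterate_of_le (hω.exits a i).exits_exitPoint ?_).symm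
    change ((nextStep (vertexSet (perturb ω)))^[k] (levelPoint (base a) j ω)).2 ≤ _
    rw [hk]
    linarith
  refine ⟨fun i hi => ⟨main i hi, ?_⟩, ?_⟩
  · rw [pos, main i hi, topExit, exitPoint_rowsGT hU (n := 20 * j)]
    push_cast
    linarith
  · rw [pos, main (j + 1) (Nat.lt_succ_self j)]
    exact (hT.exitPoint_centre hU hω.1 hl (by push_cast; linarith)).2

/-! ### Integrals over countable partitions -/

lemma setIntegral_mono_of_fiber {β : Type*} [Countable β] {Q : Config → β}
    (hQ : ∀ q, MeasurableSet {ω | Q ω = q})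
    {B : Set Config} (hB : MeasurableSet B) {f g : Config → ℝ} (hf : Integrable f law)
    (hg : Integrable g law) (h : ∀ q, ∫ ω in B ∩ {ω | Q ω = q}, f ω ∂law ≤
      ∫ ω in B ∩ {ω | Q ω = q}, g ω ∂law) : ∫ ω in B, f ω ∂law ≤ ∫ ω in B, g ω ∂law := by
  have hs := fun (F : Config → ℝ) hF => hasSum_integral_iUnion (μ := law) (f := F) (fun q => hB.inter (hQ q))
    (pairwise_disjoint_inter_fiber B Q) hF
  rw [← iUnion_inter_fiber B Q]
  exact hasSum_le h (hs f hf.integrableOn) (hs g hg.integrableOn)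

lemma abs_setIntegral_le_of_fiber {β : Type*} [Countable β] {Q : Config → β}
    (hQ : ∀ q, MeasurableSet {ω | Q ω = q})
    {B : Set Config} (hB : MeasurableSet B) {f g : Config → ℝ} (hf : Integrable f law)
    (hg : Integrable g law) (h : ∀ q, |∫ ω in B ∩ {ω | Q ω = q}, f ω ∂law| ≤
      ∫ ω in B ∩ {ω | Q ω = q}, g ω ∂law) : |∫ ω in B, f ω ∂law| ≤ ∫ ω in B, g ω ∂law := by
  rw [abs_le']
  refine ⟨setIntegral_mono_of_fiber hQ hB hf hg fun q => (le_abs_self _).trans (h q), ?_⟩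
  rw [← integral_neg]
  refine setIntegral_mono_of_fiber hQ hB hf.neg hg fun q => ?_
  rw [integral_neg]
  exact (neg_le_abs _).trans (h q)

/-! ### Good events -/

/-- The event that, within `K` blocks on each side of the path at level `j`, the lower half of some
wall is present. -/
def halfWalls (a : ℤ) (j K : ℕ) : Set Config :=
  ⋃ q, {ω | levelBlock (base a) j ω = q} ∩
    ((⋃ i : Fin K, halfWallEvent j (q + 1 + (i : ℕ))) ∩
      ⋃ i : Fin K, halfWallEvent j (q - 1 - (i : ℕ)))

lemma measurableSet_halfWalls (a : ℤ) (j K : ℕ) : MeasurableSet[past j] (halfWalls a j K) :=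
  MeasurableSet.iUnion fun _ => (measurableSet_levelBlock _ _ _).inter
    ((MeasurableSet.iUnion fun _ => measurableSet_halfWallEvent _ _).inter
      (MeasurableSet.iUnion fun _ => measurableSet_halfWallEvent _ _))

lemma exists_halfWalls {a q : ℤ} {j K : ℕ} {ω : Config} (h : ω ∈ halfWalls a j K)
    (hq : levelBlock (base a) j ω = q) :
    (∃ i < K, ω ∈ halfWallEvent j (q + 1 + (i : ℕ))) ∧
      ∃ i < K, ω ∈ halfWallEvent j (q - 1 - (i : ℕ)) := by
  obtain ⟨q', h1, h2, h3⟩ := mem_iUnion.1 h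
  have h1' : levelBlock (base a) j ω = q' := h1
  obtain rfl : q = q' := hq.symm.trans h1'
  obtain ⟨i, hi⟩ := mem_iUnion.1 h2
  obtain ⟨i', hi'⟩ := mem_iUnion.1 h3
  exact ⟨⟨i, i.2, hi⟩, i', i'.2, hi'⟩

lemma le_gapAt_of_notMem_halfWalls {a : ℤ} {j K : ℕ} {ω : Config} (h : ω ∉ halfWalls a j K) :
    (K : ENNReal) ≤ gapAt (base a) j ω := by
  refine le_trans (self_le_add_right _ 1) (le_gapFrom ?_)
  by_contra hcon
  obtain ⟨⟨i, hi, h1⟩, i', hi', h2⟩ := exists_walls hcon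
  exact h (mem_iUnion.2 ⟨levelBlock (base a) j ω, rfl,
    mem_iUnion.2 ⟨⟨i, hi⟩, wallEvent_subset _ _ h1⟩,
    mem_iUnion.2 ⟨⟨i', hi'⟩, wallEvent_subset _ _ h2⟩⟩)

/-- An event of the past on which the conditional expectation of the gap is at most `K`, and outside
of which it is at least `K`. -/
lemma exists_gap_split (a : ℤ) (j K : ℕ) : ∃ s, MeasurableSet[past j] s ∧
    (∀ B, MeasurableSet[past j] B → B ⊆ s → ∫ ω in B, gap a j ω ∂law ≤ K * law.real B) ∧
    ∀ B, MeasurableSet[past j] B → B ⊆ sᶜ → K * law.real B ≤ ∫ ω in B, gap a j ω ∂law := by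
  let ν := law.withDensity (gapAt (base a) j)
  let μ := (K : ENNReal) • law
  have hν : IsFiniteMeasure ν := isFiniteMeasure_withDensity (lintegral_gapAt_ne_top a j)
  have hμ : IsFiniteMeasure μ := Measure.smul_finite law (by simp)
  have hν' : IsFiniteMeasure (ν.trim (past_le j)) := isFiniteMeasure_trim _
  have hμ' : IsFiniteMeasure (μ.trim (past_le j)) := isFiniteMeasure_trim _
  have e1 : ∀ B, MeasurableSet[past j] B →
      ∫ ω in B, gap a j ω ∂law = (ν.trim (past_le j) B).toReal := fun B hB => by
    rw [setIntegral_gap, trim_measurableSet_eq _ hB, withDensity_apply _ (past_le j _ hB)]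
  have e2 : ∀ B, MeasurableSet[past j] B →
      K * law.real B = (μ.trim (past_le j) B).toReal := fun B hB => by
    rw [trim_measurableSet_eq _ hB, Measure.smul_apply, smul_eq_mul, ENNReal.toReal_mul,
      ENNReal.toReal_natCast, measureReal_def]
  obtain ⟨s, hs, h1, h2⟩ := @hahn_decomposition _ (past j) (μ.trim (past_le j))
    (ν.trim (past_le j)) hμ' hν'
  refine ⟨s, hs, fun B hB hBs => ?_, fun B hB hBs => ?_⟩
  · rw [e1 B hB, e2 B hB]
    exact ENNReal.toReal_mono (@measure_ne_top _ (past j) _ hμ' _) (h1 B hB hBs)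
  · rw [e1 B hB, e2 B hB]
    exact ENNReal.toReal_mono (@measure_ne_top _ (past j) _ hν' _) (h2 B hB hBs)

/-- The good event at level `j`: the gap is not too large in conditional expectation, and the
path is confined when it reaches the level. -/
lemma exists_good (a : ℤ) (j K : ℕ) : ∃ s, MeasurableSet[past j] s ∧ s ⊆ halfWalls a j K ∧
    (∀ B, MeasurableSet[past j] B → B ⊆ s → ∫ ω in B, gap a j ω ∂law ≤ K * law.real B) ∧
    ∀ B, MeasurableSet[past j] B → B ⊆ sᶜ → K * law.real B ≤ ∫ ω in B, gap a j ω ∂law := by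
  obtain ⟨s, hs, h1, h2⟩ := exists_gap_split a j K
  have hH := measurableSet_halfWalls a j K
  refine ⟨s ∩ halfWalls a j K, hs.inter hH, inter_subset_right,
    fun B hB hBs => h1 B hB (hBs.trans inter_subset_left), fun B hB hBs => ?_⟩
  have h3 := h2 (B ∩ halfWalls a j K) (hB.inter hH) fun ω hω h => hBs hω.1 ⟨h, hω.2⟩
  have hC : MeasurableSet (B \ halfWalls a j K) := past_le j _ (hB.diff hH)
  have h4 : K * law.real (B \ halfWalls a j K) ≤ ∫ ω in B \ halfWalls a j K, gap a j ω ∂law := by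
    have h5 : ∫ ω in B \ halfWalls a j K, (K : ℝ) ∂law ≤
        ∫ ω in B \ halfWalls a j K, gap a j ω ∂law := by
      refine integral_mono_ae (integrable_const _) (integrable_gap a j).integrableOn ?_
      filter_upwards [ae_restrict_mem hC, ae_restrict_of_ae (gapAt_ae_lt_top a j)] with ω hω hlt
      have h6 := ENNReal.toReal_mono hlt.ne (le_gapAt_of_notMem_halfWalls hω.2)
      rwa [ENNReal.toReal_natCast] at h6
    rw [setIntegral_const, smul_eq_mul, mul_comm] at h5
    exact h5
  rw [← integral_inter_add_sdiff (past_le j _ hH) (integrable_gap a j).integrableOn,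
    ← measureReal_inter_add_sdiff (s := B) (past_le j _ hH)]
  linarith

/-- The half-width of the traps that catch a path confined by walls within `K` blocks, at up to
`r` blocks from it. -/
def trapWidth (K r : ℕ) : ℤ := 33 * (K + r) + 34

/-- The trap in the block of index `q` at level `j`. -/
def trapAt (K r j : ℕ) (q : ℤ) : Set Config := trapEvent (33 * q + 22) (20 * j) (trapWidth K r)

lemma five_le_trapWidth (K r : ℕ) : 5 ≤ trapWidth K r := by
  rw [trapWidth]; omega

lemma levelBlock_eq_of_abs_sub_le {a q : ℤ} {j : ℕ} {ω : Config}
    (h : |pos a j ω - (33 * q + 22 : ℤ)| ≤ 1 / 16) : levelBlock (base a) j ω = q := by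
  rw [levelBlock, Int.floor_eq_iff, le_div_iff₀ (by norm_num), div_lt_iff₀ (by norm_num)]
  have h' := abs_le.1 h
  rw [pos] at h'
  push_cast at h'
  constructor <;> linarith [h'.1, h'.2]

/-- The trap in a block at distance at most `r` from the path catches the path. -/
lemma Typical.trapped_of_halfWalls {ω : Config} (hω : Typical ω) {a q q' : ℤ} {j K r : ℕ}
    (hH : ω ∈ halfWalls a j K) (hq : levelBlock (base a) j ω = q) (hr : |q' - q| ≤ r)
    (hT : ω ∈ trapAt K r j q') :
    (∀ i, j < i → levelPoint (base a) i ω = exitPoint (vertexSet (perturb ω)) (20 * i - 7)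
        (vertex (perturb ω) (33 * q' + 22, 20 * j + 1)) ∧
      pos a i ω = topExit (33 * q' + 22) (20 * j) (20 * i - 7) ω) ∧
      |pos a (j + 1) ω - (33 * q' + 22 : ℤ)| ≤ 1 / 16 := by
  obtain ⟨⟨i, hi, hR⟩, i', hi', hL⟩ := exists_halfWalls hH hq
  have hb := levelBlock_bounds (base a) j ω
  have p1 := wallPos_bounds j (q + 1 + (i : ℕ))
  have p2 := wallPos_bounds j (q - 1 - (i' : ℕ))
  have hr' := abs_le.1 hr
  rw [hq] at hb
  push_cast at p1 p2
  have hi0 : (0 : ℝ) ≤ i := Nat.cast_nonneg i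
  have hi0' : (0 : ℝ) ≤ i' := Nat.cast_nonneg i'
  refine hω.trapped (five_le_trapWidth K r) hT hL hR ?_ ?_ ?_ ?_
  · rw [trapWidth, wallPos]; omega
  · rw [trapWidth, wallPos]; omega
  · rw [pos]; linarith
  · rw [pos]; linarith

/-! ### The drift of a single path -/

/-- On an event of the past, the drift of a path is bounded in terms of the probability of the event
and of the gap. A trap suppresses all further drift, and it has a positive probability whatever the
past, which makes the bound uniform in the number of levels. -/
theorem exists_abs_setIntegral_pos_sub_le {K : ℕ} (hK : 4 * drift ≤ K) : ∃ α : ℝ, 0 < α ∧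
    ∀ (k : ℕ) (a : ℤ) (j : ℕ) (B : Set Config), MeasurableSet[past j] B →
      |∫ ω in B, (pos a (j + k) ω - pos a j ω) ∂law| ≤
        α * law.real B + 396 * ∫ ω in B, gap a j ω ∂law := by
  obtain ⟨p, hp, hpE⟩ := exists_le_law_trapEvent (l := trapWidth K 0)
    (by have := five_le_trapWidth K 0; omega)
  set G : ℝ := Nat.cast drift with hGdef
  have hG : 4 * G ≤ K := by
    have : ((4 * drift : ℕ) : ℝ) ≤ K := by exact_mod_cast hK
    push_cast at this
    exact this
  have hG0 : 0 ≤ G := Nat.cast_nonneg _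
  set c₀ : ℝ := 99 * K + 1 + 396 * G + 198 * K
  have hc₀ : 0 < c₀ := by positivity
  set α := c₀ / p
  have hα : 0 < α := div_pos hc₀ hp
  have hαp : α * p = c₀ := div_mul_cancel₀ _ hp.ne'
  refine ⟨α, hα, fun k => ?_⟩
  induction k with
  | zero =>
    intro a j B hB
    simp only [add_zero, sub_self, integral_zero, abs_zero]
    have := setIntegral_gap_nonneg a j B
    positivity
  | succ k ih =>
    intro a j B hB
    have hint : ∀ i i', Integrable (fun ω => pos a i ω - pos a i' ω) law := fun i i' =>
      (integrable_pos a i).sub (integrable_pos a i')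
    have hstep : ∀ C, |∫ ω in C, (pos a (j + 1) ω - pos a j ω) ∂law| ≤
        99 * ∫ ω in C, gap a j ω ∂law := by
      intro C
      rw [← integral_const_mul]
      exact norm_integral_le_of_norm_le ((integrable_gap a j).integrableOn.const_mul 99)
        (ae_restrict_of_ae ((abs_pos_succ_sub_le a j).mono fun ω h => by
          rwa [Real.norm_eq_abs]))
    have hsplit : ∀ C, ∫ ω in C, (pos a (j + (k + 1)) ω - pos a j ω) ∂law =
        (∫ ω in C, (pos a (j + 1) ω - pos a j ω) ∂law) +
          ∫ ω in C, (pos a (j + 1 + k) ω - pos a (j + 1) ω) ∂law := by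
      intro C
      rw [← integral_add (hint _ _).integrableOn (hint _ _).integrableOn, add_assoc, add_comm 1 k]
      exact integral_congr_ae (Filter.Eventually.of_forall fun ω => by ring)
    obtain ⟨s, hs, hsH, hs1, hs2⟩ := exists_good a j K
    -- the part of `B` where the trap is useful
    have hgood : |∫ ω in B ∩ s, (pos a (j + (k + 1)) ω - pos a j ω) ∂law| ≤
        ∫ ω in B ∩ s, (α + 396 * gap a j ω) ∂law := by
      refine abs_setIntegral_le_of_fiber (Q := levelBlock (base a) j)
        (fun q => past_le j _ (measurableSet_levelBlock _ _ q)) (past_le j _ (hB.inter hs))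
        (hint _ _) ((integrable_const α).add ((integrable_gap a j).const_mul 396)) fun q => ?_
      set C := B ∩ s ∩ {ω | levelBlock (base a) j ω = q} with hC
      have hCm : MeasurableSet[past j] C := (hB.inter hs).inter (measurableSet_levelBlock _ _ _)
      have hCm' : MeasurableSet C := past_le j _ hCm
      have hCs : C ⊆ s := fun ω hω => hω.1.2
      rw [integral_add (integrable_const α).integrableOn
        ((integrable_gap a j).const_mul 396).integrableOn, setIntegral_const, integral_const_mul,
        smul_eq_mul, mul_comm _ α, hsplit]
      set E := trapAt K 0 j q with hE
      have hEm : MeasurableSet E := measurableSet_trapEvent' _ _ _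
      have hCE : MeasurableSet[past (j + 1)] (C \ E) :=
        (past_mono (Nat.le_succ j) _ hCm).diff (measurableSet_trapEvent_past _ _ j)
      rw [← integral_inter_add_sdiff hEm (hint (j + 1 + k) (j + 1)).integrableOn]
      have h1 := hstep C
      have hgapC := hs1 C hCm hCs
      have hgap1 : ∫ ω in C \ E, gap a (j + 1) ω ∂law ≤ G * law.real C +
          (∫ ω in C, gap a j ω ∂law) / 2 :=
        (setIntegral_mono_set (integrable_gap a (j + 1)).integrableOn
          (Filter.Eventually.of_forall fun ω => gap_nonneg a _ ω)
          (Filter.Eventually.of_forall sdiff_subset)).trans (setIntegral_gap_succ_le a j hCm)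
      have h2 := ih a (j + 1) (C \ E) hCE
      have hprob : law.real (C ∩ E) = law.real C * law.real E := law_inter_trapEvent hCm
      have hprob' : law.real (C \ E) = law.real C - law.real C * law.real E := by
        have := measureReal_inter_add_sdiff (μ := law) (s := C) hEm
        linarith
      have hpE' : p ≤ law.real E := hpE _ _
      have h3 : |∫ ω in C ∩ E, (pos a (j + 1 + k) ω - pos a (j + 1) ω) ∂law| ≤
          law.real C := by
        have htr : ∀ᵐ ω ∂law.restrict (C ∩ E), pos a (j + 1 + k) ω - pos a (j + 1) ω =
            (topExit (33 * q + 22) (20 * j) (20 * (j + 1 + k : ℕ) - 7) ω - (33 * q + 22 : ℤ)) -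
              (pos a (j + 1) ω - (33 * q + 22 : ℤ)) ∧
            |pos a (j + 1) ω - (33 * q + 22 : ℤ)| ≤ 1 / 16 := by
          filter_upwards [ae_restrict_mem (hCm'.inter hEm), ae_restrict_of_ae typical_ae]
            with ω hω hty
          have ht := hty.trapped_of_halfWalls (hsH (hCs hω.1)) hω.1.2 (q' := q) (by simp) hω.2
          refine ⟨?_, ht.2⟩
          rw [← (ht.1 (j + 1 + k) (by omega)).2]
          ring
        have hi1 : Integrable (fun ω => pos a (j + 1) ω - (33 * q + 22 : ℤ))
            (law.restrict (C ∩ E)) :=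
          ((integrable_pos a (j + 1)).sub (integrable_const _)).integrableOn
        have hi2 : Integrable (fun ω => topExit (33 * q + 22) (20 * j)
            (20 * (j + 1 + k : ℕ) - 7) ω - (33 * q + 22 : ℤ)) (law.restrict (C ∩ E)) := by
          refine ((hint (j + 1 + k) (j + 1)).integrableOn.add hi1).congr ?_
          filter_upwards [htr] with ω hω
          simp only [Pi.add_apply, hω.1]
          ring
        have h0 : ∫ ω in C ∩ E, (topExit (33 * q + 22) (20 * j) (20 * (j + 1 + k : ℕ) - 7) ω -
            (33 * q + 22 : ℤ)) ∂law = 0 := setIntegral_topExit _ _ _ hCm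
        rw [integral_congr_ae (htr.mono fun ω hω => hω.1), integral_sub hi2 hi1, h0, zero_sub, abs_neg]
        have h4 := norm_setIntegral_le_of_norm_le_const_ae (μ := law) (s := C ∩ E)
          (f := fun ω => pos a (j + 1) ω - (33 * q + 22 : ℤ)) (C := 1 / 16)
          (measure_lt_top _ _) (htr.mono fun ω hω => hω.2)
        have h5 : law.real (C ∩ E) ≤ law.real C := measureReal_mono inter_subset_left
        have h6 : 0 ≤ law.real (C ∩ E) := measureReal_nonneg
        rw [Real.norm_eq_abs] at h4
        linarith
      have hP : 0 ≤ law.real C := measureReal_nonneg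
      have hg0 := setIntegral_gap_nonneg a j C
      have h7 : c₀ * law.real C ≤ α * (law.real C * law.real E) := by
        rw [← hαp, mul_assoc, mul_comm p]
        gcongr
      rw [hprob', mul_sub] at h2
      refine (abs_add_le _ _).trans ((add_le_add h1 ((abs_add_le _ _).trans
        (add_le_add h3 h2))).trans ?_)
      have h8 : c₀ * law.real C = 99 * (K * law.real C) + law.real C + 396 * (G * law.real C) +
          198 * (K * law.real C) := by ring
      linarith
    -- the part of `B` where the gap is large
    have hbad : |∫ ω in B \ s, (pos a (j + (k + 1)) ω - pos a j ω) ∂law| ≤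
        α * law.real (B \ s) + 396 * ∫ ω in B \ s, gap a j ω ∂law := by
      have hDm : MeasurableSet[past j] (B \ s) := hB.diff hs
      rw [hsplit]
      have h1 := hstep (B \ s)
      have h2 := ih a (j + 1) (B \ s) (past_mono (Nat.le_succ j) _ hDm)
      have h3 := setIntegral_gap_succ_le a j hDm
      have h4 := hs2 _ hDm fun ω hω => hω.2
      have h5 : 4 * G * law.real (B \ s) ≤ K * law.real (B \ s) := by gcongr
      refine (abs_add_le _ _).trans ((add_le_add h1 h2).trans ?_)
      linarith
    rw [← integral_inter_add_sdiff (past_le j _ hs) (hint _ _).integrableOn,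
      ← integral_inter_add_sdiff (past_le j _ hs) (integrable_gap a j).integrableOn,
      ← measureReal_inter_add_sdiff (s := B) (past_le j _ hs)]
    rw [integral_add (integrable_const α).integrableOn
        ((integrable_gap a j).const_mul 396).integrableOn, setIntegral_const, integral_const_mul,
        smul_eq_mul, mul_comm _ α] at hgood
    refine (abs_add_le _ _).trans ((add_le_add hgood hbad).trans (le_of_eq ?_))
    ring

/-! ### A concave potential -/

/-- The function `2 R z - z ^ 2`, continued by its maximum for `z ≥ R`. -/
noncomputable def potential (R z : ℝ) : ℝ := R ^ 2 - max (R - z) 0 ^ 2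

lemma measurable_potential (R : ℝ) : Measurable (potential R) := by
  unfold potential; fun_prop

lemma potential_le_sq (R z : ℝ) : potential R z ≤ R ^ 2 := by
  have := sq_nonneg (max (R - z) 0)
  rw [potential]; linarith

lemma potential_le {R : ℝ} (hR : 0 ≤ R) (z : ℝ) : potential R z ≤ 2 * R * z := by
  rw [potential]
  rcases le_total z R with h | h
  · rw [max_eq_left (by linarith)]; nlinarith [sq_nonneg z]
  · rw [max_eq_right (by linarith)]; nlinarith

lemma max_sub_le {R z : ℝ} (hR : 0 ≤ R) (hz : -9 ≤ z) : max (R - z) 0 ≤ R + 9 :=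
  max_le (by linarith) (by linarith)

lemma le_potential {R z : ℝ} (hR : 0 ≤ R) (hz : -9 ≤ z) : -(18 * R + 81) ≤ potential R z := by
  have h1 := max_sub_le hR hz
  have h2 := le_max_right (R - z) 0
  rw [potential]
  nlinarith

/-- The error term of the first order expansion of the potential; it is nonnegative by concavity. -/
noncomputable def concaveGain (R z z' : ℝ) : ℝ :=
  potential R z + 2 * max (R - z) 0 * (z' - z) - potential R z'

lemma concaveGain_nonneg (R z z' : ℝ) : 0 ≤ concaveGain R z z' := by
  rw [concaveGain, potential, potential]
  rcases le_total z R with h | h <;> rcases le_total z' R with h' | h'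
  · rw [max_eq_left (by linarith), max_eq_left (by linarith)]; nlinarith [sq_nonneg (z - z')]
  · rw [max_eq_left (by linarith), max_eq_right (by linarith)]; nlinarith
  · rw [max_eq_right (by linarith), max_eq_left (by linarith)]; nlinarith [sq_nonneg (R - z')]
  · rw [max_eq_right (by linarith), max_eq_right (by linarith)]; nlinarith

/-- Away from its maximum, the potential is strictly concave. -/
lemma le_concaveGain {R z : ℝ} (hz : z ≤ R - 1) (z' : ℝ) :
    2 * (z' - z) - 1 ≤ concaveGain R z z' := by
  rw [concaveGain, potential, potential, max_eq_left (show 0 ≤ R - z by linarith)]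
  rcases le_total z' R with h' | h'
  · rw [max_eq_left (by linarith)]; nlinarith [sq_nonneg (z' - z - 1)]
  · rw [max_eq_right (by linarith)]
    nlinarith [mul_nonneg (show 0 ≤ R - z - 1 by linarith) (show 0 ≤ z' - R by linarith),
      sq_nonneg (R - z - 1)]

/-! ### Two paths -/

/-- The signed distance of two paths at level `j`. -/
noncomputable def sep (a a' : ℤ) (j : ℕ) (ω : Config) : ℝ := pos a' j ω - pos a j ω

lemma integrable_sep (a a' : ℤ) (j : ℕ) : Integrable (sep a a' j) law :=
  (integrable_pos a' j).sub (integrable_pos a j)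

/-- The conditional expectation, given the past of level `j`, of the distance at level `N`. -/
noncomputable def meanSep (a a' : ℤ) (N j : ℕ) : Config → ℝ := law[sep a a' N|past j]

lemma measurable_meanSep (a a' : ℤ) (N j : ℕ) : Measurable[past j] (meanSep a a' N j) :=
  stronglyMeasurable_condExp.measurable

lemma measurable_meanSep' (a a' : ℤ) (N j : ℕ) : Measurable (meanSep a a' N j) :=
  (measurable_meanSep a a' N j).mono (past_le j) le_rfl

lemma integrable_meanSep (a a' : ℤ) (N j : ℕ) : Integrable (meanSep a a' N j) law :=
  integrable_condExp

lemma setIntegral_meanSep (a a' : ℤ) (N : ℕ) {j : ℕ} {B : Set Config}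
    (hB : MeasurableSet[past j] B) :
    ∫ ω in B, meanSep a a' N j ω ∂law = ∫ ω in B, sep a a' N ω ∂law :=
  setIntegral_condExp (past_le j) (integrable_sep a a' N) hB

/-- The event that two paths have met before leaving the level `j`. -/
def merged (a a' : ℤ) (j : ℕ) : Set Config :=
  {ω | levelPoint (base a) j ω = levelPoint (base a') j ω}

lemma measurableSet_merged (a a' : ℤ) (j : ℕ) : MeasurableSet[past j] (merged a a' j) :=
  measurableSet_eq_fun (measurable_levelPoint _ _) (measurable_levelPoint _ _)

lemma Typical.merged_mono {ω : Config} (hω : Typical ω) {a a' : ℤ} {i j : ℕ} (hij : i ≤ j)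
    (h : ω ∈ merged a a' i) : ω ∈ merged a a' j := by
  have h' : levelPoint (base a) i ω = levelPoint (base a') i ω := h
  change levelPoint (base a) j ω = levelPoint (base a') j ω
  rw [← hω.exitPoint_levelPoint a hij, ← hω.exitPoint_levelPoint a' hij, h']

lemma Typical.neg_nine_le_sep {ω : Config} (hω : Typical ω) {a a' : ℤ} (ha : a < a') (j : ℕ) :
    -9 ≤ sep a a' j ω := by
  have h1 : ((a : ℤ) : ℝ) < a' := by exact_mod_cast ha
  rcases hω.1.exitPoint_order (perturb_mem ω) (base_mem a _) (base_mem a' _) rfl h1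
    (hω.exits a j) (hω.exits a' j) with h | h
  · have : sep a a' j ω = 0 := by
      rw [sep, pos, pos, levelPoint, levelPoint, h, sub_self]
    linarith
  · rw [sep, pos, pos, levelPoint, levelPoint]
    linarith

lemma neg_nine_le_meanSep {a a' : ℤ} (ha : a < a') (N j : ℕ) :
    ∀ᵐ ω ∂law, -9 ≤ meanSep a a' N j ω := by
  have h : (fun _ => (-9 : ℝ)) ≤ᵐ[law] sep a a' N := by
    filter_upwards [typical_ae] with ω hω using hω.neg_nine_le_sep ha N
  have h2 := condExp_mono (m := past j) (integrable_const (-9 : ℝ)) (integrable_sep a a' N) h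
  rw [condExp_const (past_le j)] at h2
  exact h2

/-- Given a past that determines the block of a path, the walls of this level have not been
explored. -/
lemma setIntegral_gap_le_of_levelBlock {a q : ℤ} {i : ℕ} {A : Set (ℤ × ℤ)}
    (hA : Disjoint A (wallSites i)) {C : Set Config} (hC : MeasurableSet[sigmaOf A] C)
    (hq : ∀ᵐ ω ∂law, ω ∈ C → levelBlock (base a) i ω = q) :
    ∫ ω in C, gap a i ω ∂law ≤ gapMean.toReal * law.real C := by
  have hC' : MeasurableSet C := sigmaOf_le _ _ hC
  have h : ∫⁻ ω in C, gapAt (base a) i ω ∂law ≤ gapMean * law C := by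
    calc ∫⁻ ω in C, gapAt (base a) i ω ∂law = ∫⁻ ω in C, gapFrom i q ω ∂law := by
          refine setLIntegral_congr_fun_ae hC' ?_
          filter_upwards [hq] with ω hω hC
          rw [gapAt, hω hC]
      _ = ∑' m, law (noWall i q m ∩ C) := setLIntegral_gapFrom i q C
      _ = ∑' m, law (noWall i q m) * law C := by
          refine tsum_congr fun m => ?_
          rw [inter_comm, law_inter hA hC (measurableSet_noWall i q m), mul_comm]
      _ = (∑' m, law (noWall i q m)) * law C := ENNReal.tsum_mul_right
      _ ≤ _ := by gcongr; exact tsum_noWall_le i q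
  rw [setIntegral_gap]
  refine (ENNReal.toReal_mono (ENNReal.mul_ne_top gapMean_ne_top (measure_ne_top _ _)) h).trans
    (le_of_eq ?_)
  rw [ENNReal.toReal_mul]
  rfl

lemma disjoint_trapSites_wallSites (q l : ℤ) (j : ℕ) :
    Disjoint (trapSites (33 * q + 22) (20 * j) l) (wallSites (j + 1)) := by
  rw [Set.disjoint_left]
  rintro w hw ⟨⟨h1, -⟩, q', hq'⟩
  push_cast at h1
  rcases hw with ⟨⟨-, h2⟩, -⟩ | ⟨-, h2⟩
  · omega
  · have a1 := abs_le.1 h2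
    have a2 := abs_le.1 hq'
    simp only [wallPos] at a2
    push_cast at a2
    omega

lemma disjoint_trapSites {q q' : ℤ} {K r : ℕ} (j : ℕ) (h : q + (2 * K + 2 + 2 * r) < q') :
    Disjoint (trapSites (33 * q + 22) (20 * j) (trapWidth K r))
      (trapSites (33 * q' + 22) (20 * j) (trapWidth K r)) := by
  have key : ∀ (p : ℤ), ∀ w ∈ trapSites (33 * p + 22) (20 * j) (trapWidth K r),
      |w.1 - (33 * p + 22)| ≤ trapWidth K r := by
    rintro p w (⟨-, h⟩ | ⟨-, h⟩)
    · exact h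
    · exact h.trans (five_le_trapWidth K r)
  rw [Set.disjoint_left]
  intro w hw hw'
  have h1 := abs_le.1 (key q w hw)
  have h2 := abs_le.1 (key q' w hw')
  rw [trapWidth] at h1 h2
  omega

/-- A trap on each side of two distant paths. -/
def trapPair (K r j : ℕ) (q q' : ℤ) : Set Config := trapAt K r j (q - r) ∩ trapAt K r j (q' + r)

lemma measurableSet_trapPair (K r j : ℕ) (q q' : ℤ) :
    MeasurableSet[sigmaOf (rowsGT (20 * j))] (trapPair K r j q q') :=
  (sigmaOf_mono (trapSites_subset_rowsGT _ _ _) _ (measurableSet_trapEvent _ _ _)).inter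
    (sigmaOf_mono (trapSites_subset_rowsGT _ _ _) _ (measurableSet_trapEvent _ _ _))

lemma law_trapPair {K r j : ℕ} {q q' : ℤ} (h : q + (2 * K + 2) < q') :
    law.real (trapPair K r j q q') = law.real (trapAt K r j (q - r)) *
      law.real (trapAt K r j (q' + r)) := by
  rw [measureReal_def, trapPair, trapAt, trapAt, law_inter (disjoint_trapSites j (by omega))
    (measurableSet_trapEvent _ _ _) (measurableSet_trapEvent _ _ _), ENNReal.toReal_mul]
  rfl

/-- If two paths are far apart, traps that pull them away from each other increase the expected
future distance by a definite amount. Since there is no effect of the traps on the drift afterwards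
except for a bounded error, it is enough to choose the traps at a large distance. -/
lemma le_setIntegral_meanSep_sub {K r : ℕ} {α : ℝ}
    (hα : ∀ (k : ℕ) (a : ℤ) (j : ℕ) (B : Set Config), MeasurableSet[past j] B →
      |∫ ω in B, (pos a (j + k) ω - pos a j ω) ∂law| ≤
        α * law.real B + 396 * ∫ ω in B, gap a j ω ∂law)
    (hr : 35 + 4 * α + 792 * (gapMean.toReal + K) ≤ 66 * r) {a a' q q' : ℤ} {j N : ℕ} (hj : j < N)
    {B : Set Config} (hB : MeasurableSet[past j] B)
    (hH : B ⊆ halfWalls a j K) (hH' : B ⊆ halfWalls a' j K)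
    (hg : ∫ ω in B, gap a j ω ∂law ≤ K * law.real B)
    (hg' : ∫ ω in B, gap a' j ω ∂law ≤ K * law.real B)
    (hq : ∀ ω ∈ B, levelBlock (base a) j ω = q) (hq' : ∀ ω ∈ B, levelBlock (base a') j ω = q') :
    law.real (B ∩ trapPair K r j q q') ≤ ∫ ω in B ∩ trapPair K r j q q',
      (meanSep a a' N (j + 1) ω - meanSep a a' N j ω) ∂law := by
  set E := trapPair K r j q q' with hE
  have hEm := measurableSet_trapPair K r j q q'
  have hB' : MeasurableSet B := past_le j _ hB
  have hE' : MeasurableSet E := sigmaOf_le _ _ hEm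
  have hBE : MeasurableSet[past (j + 1)] (B ∩ E) := (past_mono (Nat.le_succ j) _ hB).inter
    ((measurableSet_trapEvent_past _ _ j).inter (measurableSet_trapEvent_past _ _ j))
  have hsep : ∀ (C : Set Config) (i k : ℕ), ∫ ω in C, sep a a' (i + k) ω ∂law =
      (∫ ω in C, sep a a' i ω ∂law) + ((∫ ω in C, (pos a' (i + k) ω - pos a' i ω) ∂law) -
        ∫ ω in C, (pos a (i + k) ω - pos a i ω) ∂law) := by
    intro C i k
    have hint : ∀ b : ℤ, Integrable (fun ω => pos b (i + k) ω - pos b i ω) (law.restrict C) :=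
      fun b => ((integrable_pos b _).sub (integrable_pos b _)).integrableOn
    rw [← integral_sub (hint a') (hint a), ← integral_add (f := sep a a' i)
      (g := fun ω => pos a' (i + k) ω - pos a' i ω - (pos a (i + k) ω - pos a i ω))
      (integrable_sep a a' i).integrableOn ((hint a').sub (hint a))]
    refine integral_congr_ae (Filter.Eventually.of_forall fun ω => ?_)
    simp only [sep]
    ring
  obtain ⟨k, rfl⟩ : ∃ k, N = j + 1 + k := ⟨N - (j + 1), by omega⟩
  -- both paths are caught
  have hcaught : ∀ᵐ ω ∂law, ω ∈ B ∩ E →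
      |pos a (j + 1) ω - (33 * (q - r) + 22 : ℤ)| ≤ 1 / 16 ∧
      |pos a' (j + 1) ω - (33 * (q' + r) + 22 : ℤ)| ≤ 1 / 16 := by
    filter_upwards [typical_ae] with ω hω hm
    exact ⟨(hω.trapped_of_halfWalls (hH hm.1) (hq ω hm.1) (by simp) hm.2.1).2,
      (hω.trapped_of_halfWalls (hH' hm.1) (hq' ω hm.1) (by simp) hm.2.2).2⟩
  have hdisj : Disjoint (rowsLE (20 * j) ∪
      (trapSites (33 * (q - r) + 22) (20 * j) (trapWidth K r) ∪
        trapSites (33 * (q' + r) + 22) (20 * j) (trapWidth K r))) (wallSites (j + 1)) :=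
    Disjoint.union_left ((disjoint_wallSites j).mono_left subset_union_left)
      (Disjoint.union_left (disjoint_trapSites_wallSites _ _ j)
        (disjoint_trapSites_wallSites _ _ j))
  have hBEs : MeasurableSet[sigmaOf (rowsLE (20 * j) ∪
      (trapSites (33 * (q - r) + 22) (20 * j) (trapWidth K r) ∪
        trapSites (33 * (q' + r) + 22) (20 * j) (trapWidth K r)))] (B ∩ E) :=
    (sigmaOf_mono subset_union_left _ hB).inter
      ((sigmaOf_mono (subset_union_left.trans subset_union_right) _
        (measurableSet_trapEvent _ _ _)).inter
        (sigmaOf_mono (subset_union_right.trans subset_union_right) _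
          (measurableSet_trapEvent _ _ _)))
  have hgap := setIntegral_gap_le_of_levelBlock (a := a) (i := j + 1) hdisj hBEs
    (hcaught.mono fun ω h hm => levelBlock_eq_of_abs_sub_le (h hm).1)
  have hgap' := setIntegral_gap_le_of_levelBlock (a := a') (i := j + 1) hdisj hBEs
    (hcaught.mono fun ω h hm => levelBlock_eq_of_abs_sub_le (h hm).2)
  set g := gapMean.toReal
  have hP : law.real (B ∩ E) = law.real B * law.real E := by
    rw [measureReal_def, law_inter (disjoint_rowsLE_rowsGT _) hB hEm, ENNReal.toReal_mul]
    rfl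
  -- the expected distance after the traps
  have h1 : (33 * (q' - q + 2 * r) - 1 / 8 - 2 * α - 792 * g) * law.real (B ∩ E) ≤
      ∫ ω in B ∩ E, meanSep a a' (j + 1 + k) (j + 1) ω ∂law := by
    rw [setIntegral_meanSep _ _ _ hBE, hsep]
    have h2 := abs_le.1 (hα k a (j + 1) _ hBE)
    have h3 := abs_le.1 (hα k a' (j + 1) _ hBE)
    have h4 : (33 * ((q' : ℝ) - q + 2 * r) - 1 / 8) * law.real (B ∩ E) ≤
        ∫ ω in B ∩ E, sep a a' (j + 1) ω ∂law := by
      rw [mul_comm, ← smul_eq_mul, ← setIntegral_const]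
      refine integral_mono_ae (integrable_const _) (integrable_sep _ _ _).integrableOn ?_
      filter_upwards [ae_restrict_mem (hB'.inter hE'), ae_restrict_of_ae hcaught] with ω hm hω
      obtain ⟨h5, h6⟩ := hω hm
      have h5 := abs_le.1 h5
      have h6 := abs_le.1 h6
      push_cast at h5 h6
      rw [sep]
      linarith
    linarith
  -- the expected distance before the traps
  have h2 : ∫ ω in B ∩ E, meanSep a a' (j + 1 + k) j ω ∂law ≤
      (33 * (q' - q + 1) + 2 * α + 792 * K) * law.real (B ∩ E) := by
    have h3 : ∫ ω in B, meanSep a a' (j + 1 + k) j ω ∂law ≤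
        (33 * (q' - q + 1) + 2 * α + 792 * K) * law.real B := by
      rw [setIntegral_meanSep _ _ _ hB, add_assoc, hsep]
      have h2 := abs_le.1 (hα (1 + k) a j _ hB)
      have h3 := abs_le.1 (hα (1 + k) a' j _ hB)
      have h4 : ∫ ω in B, sep a a' j ω ∂law ≤ (33 * ((q' : ℝ) - q + 1)) * law.real B := by
        rw [mul_comm, ← smul_eq_mul, ← setIntegral_const]
        refine integral_mono_ae (integrable_sep _ _ _).integrableOn (integrable_const _) ?_
        filter_upwards [ae_restrict_mem hB'] with ω hm
        have h5 := levelBlock_bounds (base a) j ω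
        have h6 := levelBlock_bounds (base a') j ω
        rw [hq ω hm] at h5
        rw [hq' ω hm] at h6
        rw [sep, pos, pos]
        linarith
      linarith
    -- the traps are independent of the past
    have h4 : ∫ ω in B ∩ E, meanSep a a' (j + 1 + k) j ω ∂law =
        law.real E * ∫ ω in B, meanSep a a' (j + 1 + k) j ω ∂law := by
      have hf : Measurable[past j] (B.indicator (meanSep a a' (j + 1 + k) j)) :=
        (measurable_meanSep a a' (j + 1 + k) j).indicator hB
      have hf' := hf.mono (past_le j) le_rfl
      have hind : Indep (sigmaOf (rowsGT (20 * j)))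
          (MeasurableSpace.comap (B.indicator (meanSep a a' (j + 1 + k) j)) inferInstance) law :=
        indep_of_indep_of_le_right (indep_sigmaOf (disjoint_rowsLE_rowsGT (20 * j)).symm)
          (measurable_iff_comap_le.1 hf)
      have h5 := hind.setIntegral_eq_mul (sigmaOf_le _) (f := id) hf'.aemeasurable hEm
        measurable_id.aestronglyMeasurable
      simp only [id] at h5
      rw [setIntegral_indicator hB', integral_indicator hB', inter_comm] at h5
      exact h5
    rw [h4, hP]
    have := mul_le_mul_of_nonneg_left h3 (measureReal_nonneg (μ := law) (s := E))
    linarith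
  rw [integral_sub (integrable_meanSep _ _ _ _).integrableOn
    (integrable_meanSep _ _ _ _).integrableOn]
  have hP0 : 0 ≤ law.real (B ∩ E) := measureReal_nonneg
  have h3 := mul_le_mul_of_nonneg_right hr hP0
  linarith

/-! ### The potential of the expected distance -/

section TwoPaths

variable {a a' : ℤ} {N : ℕ} {R : ℝ}

lemma integrable_potential_meanSep (ha : a < a') (hR : 0 ≤ R) (i : ℕ) :
    Integrable (fun ω => potential R (meanSep a a' N i ω)) law := by
  refine Integrable.of_bound ((measurable_potential R).comp
    (measurable_meanSep' a a' N i)).aestronglyMeasurable (R ^ 2 + (18 * R + 81)) ?_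
  filter_upwards [neg_nine_le_meanSep ha N i] with ω hω
  rw [Real.norm_eq_abs, abs_le]
  have h1 := le_potential hR hω
  have h2 := potential_le_sq R (meanSep a a' N i ω)
  constructor
  · linarith [sq_nonneg R]
  · linarith

lemma slope_ae_le (ha : a < a') (hR : 0 ≤ R) (i : ℕ) :
    ∀ᵐ ω ∂law, ‖2 * max (R - meanSep a a' N i ω) 0‖ ≤ 2 * (R + 9) := by
  filter_upwards [neg_nine_le_meanSep ha N i] with ω hω
  rw [Real.norm_of_nonneg (by positivity)]
  linarith [max_sub_le hR hω]

lemma measurable_slope (a a' : ℤ) (N : ℕ) (R : ℝ) (j : ℕ) :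
    Measurable[past j] fun ω => 2 * max (R - meanSep a a' N j ω) 0 := by
  have h : Measurable fun z : ℝ => 2 * max (R - z) 0 := by fun_prop
  exact h.comp (measurable_meanSep a a' N j)

lemma integrable_slope_mul (ha : a < a') (hR : 0 ≤ R) (j : ℕ) {f : Config → ℝ}
    (hf : Integrable f law) :
    Integrable (fun ω => 2 * max (R - meanSep a a' N j ω) 0 * f ω) law :=
  hf.bdd_mul ((measurable_slope a a' N R j).mono (past_le j) le_rfl).aestronglyMeasurable
    (slope_ae_le ha hR j)

lemma setIntegral_slope_mul_meanSep (ha : a < a') (hR : 0 ≤ R) {i j : ℕ} (hij : j ≤ i)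
    {B : Set Config} (hB : MeasurableSet[past j] B) :
    ∫ ω in B, 2 * max (R - meanSep a a' N j ω) 0 * meanSep a a' N i ω ∂law =
      ∫ ω in B, 2 * max (R - meanSep a a' N j ω) 0 * sep a a' N ω ∂law := by
  have h := condExp_stronglyMeasurable_mul_of_bound (past_le i)
    ((measurable_slope a a' N R j).mono (past_mono hij) le_rfl).stronglyMeasurable
    (integrable_sep a a' N) _ (slope_ae_le ha hR j)
  have h2 := setIntegral_condExp (past_le i) (integrable_slope_mul (N := N) ha hR j
    (integrable_sep a a' N)) (past_mono hij _ hB)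
  rw [← h2]
  refine integral_congr_ae (ae_restrict_of_ae ?_)
  filter_upwards [h] with ω hω
  exact hω.symm

lemma integrable_concaveGain (ha : a < a') (hR : 0 ≤ R) (j : ℕ) :
    Integrable (fun ω => concaveGain R (meanSep a a' N j ω) (meanSep a a' N (j + 1) ω)) law :=
  ((integrable_potential_meanSep ha hR j).add (integrable_slope_mul ha hR j
    ((integrable_meanSep a a' N (j + 1)).sub (integrable_meanSep a a' N j)))).sub
    (integrable_potential_meanSep ha hR (j + 1))

/-- The expected distance is a martingale, so that the first order term has no mean. -/
lemma setIntegral_concaveGain (ha : a < a') (hR : 0 ≤ R) {j : ℕ} {B : Set Config}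
    (hB : MeasurableSet[past j] B) :
    ∫ ω in B, concaveGain R (meanSep a a' N j ω) (meanSep a a' N (j + 1) ω) ∂law =
      (∫ ω in B, potential R (meanSep a a' N j ω) ∂law) -
        ∫ ω in B, potential R (meanSep a a' N (j + 1) ω) ∂law := by
  have h0 : ∫ ω in B, 2 * max (R - meanSep a a' N j ω) 0 *
      (meanSep a a' N (j + 1) ω - meanSep a a' N j ω) ∂law = 0 := by
    simp_rw [mul_sub]
    rw [integral_sub (integrable_slope_mul ha hR j (integrable_meanSep _ _ _ _)).integrableOn
      (integrable_slope_mul ha hR j (integrable_meanSep _ _ _ _)).integrableOn,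
      setIntegral_slope_mul_meanSep ha hR (Nat.le_succ j) hB,
      setIntegral_slope_mul_meanSep ha hR le_rfl hB, sub_self]
  have hp := fun i => (integrable_potential_meanSep (N := N) ha hR i).integrableOn (s := B)
  have hs : IntegrableOn (fun ω => 2 * max (R - meanSep a a' N j ω) 0 *
      (meanSep a a' N (j + 1) ω - meanSep a a' N j ω)) B law :=
    (integrable_slope_mul ha hR j ((integrable_meanSep a a' N (j + 1)).sub
      (integrable_meanSep a a' N j))).integrableOn
  simp only [concaveGain]
  rw [integral_sub (f := fun ω => potential R (meanSep a a' N j ω) +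
    2 * max (R - meanSep a a' N j ω) 0 * (meanSep a a' N (j + 1) ω - meanSep a a' N j ω))
    ((hp j).add hs) (hp (j + 1)), integral_add (hp j) hs, h0, add_zero]

/-- On a good event that determines the blocks of two paths, there is a positive probability of a
loss of potential, due to a pair of traps that pull distant paths apart, or of a merger, due to a
common trap of close paths. -/
lemma le_setIntegral_concaveGain_add {K r : ℕ} {α p : ℝ}
    (hα : ∀ (k : ℕ) (a : ℤ) (j : ℕ) (B : Set Config), MeasurableSet[past j] B →
      |∫ ω in B, (pos a (j + k) ω - pos a j ω) ∂law| ≤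
        α * law.real B + 396 * ∫ ω in B, gap a j ω ∂law)
    (hr : 35 + 4 * α + 792 * (gapMean.toReal + K) ≤ 66 * r) (hKr : 2 * K + 2 ≤ r) (hp0 : 0 ≤ p)
    (hp : ∀ j q, p ≤ law.real (trapAt K r j q)) (ha : a < a') (hR : 0 ≤ R) {q q' : ℤ} {j : ℕ}
    (hj : j < N) {B : Set Config} (hB : MeasurableSet[past j] B)
    (hH : B ⊆ halfWalls a j K) (hH' : B ⊆ halfWalls a' j K)
    (hg : ∫ ω in B, gap a j ω ∂law ≤ K * law.real B)
    (hg' : ∫ ω in B, gap a' j ω ∂law ≤ K * law.real B)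
    (hq : ∀ ω ∈ B, levelBlock (base a) j ω = q) (hq' : ∀ ω ∈ B, levelBlock (base a') j ω = q')
    (hBR : ∀ ω ∈ B, meanSep a a' N j ω ≤ R - 1) :
    p ^ 2 * law.real B ≤
      ∫ ω in B, (concaveGain R (meanSep a a' N j ω) (meanSep a a' N (j + 1) ω) +
        (merged a a' (j + 1)).indicator 1 ω) ∂law := by
  have hB' : MeasurableSet B := past_le j _ hB
  have hM : MeasurableSet (merged a a' (j + 1)) := past_le _ _ (measurableSet_merged a a' (j + 1))
  set h : Config → ℝ := fun ω =>
    concaveGain R (meanSep a a' N j ω) (meanSep a a' N (j + 1) ω) +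
      (merged a a' (j + 1)).indicator 1 ω with hh
  have h1 : ∀ ω, 0 ≤ (merged a a' (j + 1)).indicator (1 : Config → ℝ) ω := fun ω =>
    indicator_nonneg (fun _ _ => zero_le_one) ω
  have hnn : ∀ ω, 0 ≤ h ω := fun ω => add_nonneg (concaveGain_nonneg _ _ _) (h1 ω)
  have hint : Integrable h law := (integrable_concaveGain ha hR j).add
    ((integrable_const (1 : ℝ)).indicator hM)
  -- it suffices to consider the part of the event where there are suitable traps
  have key : ∀ E : Set Config, MeasurableSet[sigmaOf (rowsGT (20 * j))] E →
      p ^ 2 ≤ law.real E → law.real (B ∩ E) ≤ ∫ ω in B ∩ E, h ω ∂law →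
      p ^ 2 * law.real B ≤ ∫ ω in B, h ω ∂law := by
    intro E hE hpE hle
    have hP : law.real (B ∩ E) = law.real B * law.real E := by
      rw [measureReal_def, law_inter (disjoint_rowsLE_rowsGT _) hB hE, ENNReal.toReal_mul]
      rfl
    calc p ^ 2 * law.real B ≤ law.real E * law.real B := by gcongr
      _ = law.real (B ∩ E) := by rw [hP, mul_comm]
      _ ≤ _ := hle
      _ ≤ _ := setIntegral_mono_set hint.integrableOn (Filter.Eventually.of_forall hnn)
          (Filter.Eventually.of_forall inter_subset_left)
  rcases lt_or_ge (q + (2 * K + 2)) q' with hfar | hnear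
  · refine key (trapPair K r j q q') (measurableSet_trapPair _ _ _ _ _) ?_ ?_
    · rw [law_trapPair hfar, sq]
      exact mul_le_mul (hp _ _) (hp _ _) hp0 measureReal_nonneg
    · have h2 := le_setIntegral_meanSep_sub hα hr hj hB hH hH' hg hg' hq hq'
      have hC : MeasurableSet (B ∩ trapPair K r j q q') :=
        hB'.inter (sigmaOf_le _ _ (measurableSet_trapPair _ _ _ _ _))
      set C := B ∩ trapPair K r j q q' with hCdef
      have hi : Integrable (fun ω => meanSep a a' N (j + 1) ω - meanSep a a' N j ω) law :=
        (integrable_meanSep _ _ _ _).sub (integrable_meanSep _ _ _ _)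
      have h3 : ∫ ω in C, (2 * (meanSep a a' N (j + 1) ω - meanSep a a' N j ω) - 1) ∂law ≤
          ∫ ω in C, h ω ∂law := by
        refine setIntegral_mono_on ((hi.const_mul 2).sub (integrable_const 1)).integrableOn
          hint.integrableOn hC fun ω hω => ?_
        have := le_concaveGain (hBR ω hω.1) (meanSep a a' N (j + 1) ω)
        have := h1 ω
        simp only [hh]
        linarith
      rw [integral_sub (hi.const_mul 2).integrableOn (integrable_const 1).integrableOn,
        integral_const_mul, setIntegral_const, smul_eq_mul, mul_one] at h3
      linarith
  · rcases (measureReal_nonneg (μ := law) (s := B)).eq_or_lt with h0 | h0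
    · rw [← h0, mul_zero]
      exact integral_nonneg hnn
    -- unmerged paths are ordered, up to a bounded error
    have hge : q - 1 ≤ q' := by
      have hne : law B ≠ 0 := fun h => by rw [measureReal_def, h] at h0; simp at h0
      obtain ⟨ω, hω, hty⟩ : ∃ ω ∈ B, Typical ω := by
        by_contra! hcon
        refine hne (measure_mono_null (fun ω hω => ?_) (ae_iff.1 typical_ae))
        exact hcon ω hω
      have h2 := hty.neg_nine_le_sep ha j
      have h3 := levelBlock_bounds (base a) j ω
      have h4 := levelBlock_bounds (base a') j ω
      rw [hq ω hω] at h3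
      rw [hq' ω hω] at h4
      rw [sep, pos, pos] at h2
      have h5 : (q : ℝ) - 2 < q' := by linarith
      have h6 : q - 2 < q' := by exact_mod_cast h5
      omega
    have hE := measurableSet_trapEvent (33 * q + 22) (20 * j) (trapWidth K r)
    have hE' : MeasurableSet (trapAt K r j q) := sigmaOf_le _ _ hE
    have hp1 : p ≤ 1 := (hp 0 0).trans measureReal_le_one
    refine key (trapAt K r j q) (sigmaOf_mono (trapSites_subset_rowsGT _ _ _) _ hE)
      ((by nlinarith : p ^ 2 ≤ p).trans (hp j q)) ?_
    have h2 : ∫ _ in B ∩ trapAt K r j q, (1 : ℝ) ∂law ≤ ∫ ω in B ∩ trapAt K r j q, h ω ∂law := by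
      refine integral_mono_ae (integrable_const _) hint.integrableOn ?_
      filter_upwards [ae_restrict_mem (hB'.inter hE'), ae_restrict_of_ae typical_ae] with ω hm hω
      have h3 := (hω.trapped_of_halfWalls (hH hm.1) (hq ω hm.1) (q' := q) (by simp) hm.2).1
        (j + 1) (Nat.lt_succ_self j)
      have h4 := (hω.trapped_of_halfWalls (hH' hm.1) (hq' ω hm.1) (q' := q)
        (by rw [abs_le]; omega) hm.2).1 (j + 1) (Nat.lt_succ_self j)
      have h5 : ω ∈ merged a a' (j + 1) := h3.1.trans h4.1.symm
      have h6 := concaveGain_nonneg R (meanSep a a' N j ω) (meanSep a a' N (j + 1) ω)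
      simp only [hh]
      rw [indicator_of_mem h5]
      simpa using h6
    rwa [setIntegral_const, smul_eq_mul, mul_one] at h2

/-- The event that two paths have not merged by level `j` and that their expected distance at level
`N` has stayed below `R - 1`. -/
def surviving (a a' : ℤ) (N : ℕ) (R : ℝ) (j : ℕ) : Set Config :=
  ⋂ i : Fin (j + 1), (merged a a' i)ᶜ ∩ {ω | meanSep a a' N i ω < R - 1}

lemma measurableSet_surviving (a a' : ℤ) (N : ℕ) (R : ℝ) (j : ℕ) :
    MeasurableSet[past j] (surviving a a' N R j) :=
  MeasurableSet.iInter fun i => past_mono (Nat.lt_succ_iff.1 i.2) _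
    ((measurableSet_merged a a' i).compl.inter
      (measurable_meanSep a a' N i measurableSet_Iio))

lemma mem_surviving {j : ℕ} {ω : Config} : ω ∈ surviving a a' N R j ↔
    ∀ i ≤ j, ω ∉ merged a a' i ∧ meanSep a a' N i ω < R - 1 := by
  rw [surviving, mem_iInter]
  exact ⟨fun h i hi => h ⟨i, Nat.lt_succ_iff.2 hi⟩, fun h i => h i (Nat.lt_succ_iff.1 i.2)⟩

lemma surviving_anti (a a' : ℤ) (N : ℕ) (R : ℝ) : Antitone (surviving a a' N R) :=
  fun _ _ hij _ hω => mem_surviving.2 fun i hi => mem_surviving.1 hω i (hi.trans hij)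

/-- The potential restricted to the surviving paths, shifted to be nonnegative. -/
noncomputable def survivingPotential (a a' : ℤ) (N : ℕ) (R : ℝ) (j : ℕ) : ℝ :=
  ∫ ω in surviving a a' N R j, (potential R (meanSep a a' N j ω) + (18 * R + 82)) ∂law

lemma survivingPotential_nonneg (ha : a < a') (hR : 0 ≤ R) (j : ℕ) :
    0 ≤ survivingPotential a a' N R j := by
  refine integral_nonneg_of_ae (ae_restrict_of_ae ?_)
  filter_upwards [neg_nine_le_meanSep ha N j] with ω hω
  have := le_potential hR hω
  simp only [Pi.zero_apply]
  linarith

/-- The shifted potential of the surviving paths decreases, at a rate given by the good events. -/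
lemma mul_law_good_le {K r : ℕ} {α p : ℝ}
    (hα : ∀ (k : ℕ) (a : ℤ) (j : ℕ) (B : Set Config), MeasurableSet[past j] B →
      |∫ ω in B, (pos a (j + k) ω - pos a j ω) ∂law| ≤
        α * law.real B + 396 * ∫ ω in B, gap a j ω ∂law)
    (hr : 35 + 4 * α + 792 * (gapMean.toReal + K) ≤ 66 * r) (hKr : 2 * K + 2 ≤ r) (hp0 : 0 ≤ p)
    (hp : ∀ j q, p ≤ law.real (trapAt K r j q)) (ha : a < a') (hR : 0 ≤ R) {j : ℕ}
    (hj : j < N) {s : Set Config} (hs : MeasurableSet[past j] s)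
    (hH : s ⊆ halfWalls a j K) (hH' : s ⊆ halfWalls a' j K)
    (hg : ∀ B, MeasurableSet[past j] B → B ⊆ s → ∫ ω in B, gap a j ω ∂law ≤ K * law.real B)
    (hg' : ∀ B, MeasurableSet[past j] B → B ⊆ s → ∫ ω in B, gap a' j ω ∂law ≤ K * law.real B) :
    p ^ 2 * law.real (surviving a a' N R j ∩ s) ≤
      survivingPotential a a' N R j - survivingPotential a a' N R (j + 1) := by
  set S := surviving a a' N R j with hS
  set S' := surviving a a' N R (j + 1) with hS'
  have hSm : MeasurableSet[past j] S := measurableSet_surviving a a' N R j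
  have hSm' : MeasurableSet S' := past_le _ _ (measurableSet_surviving a a' N R (j + 1))
  have hSS : S' ⊆ S := surviving_anti a a' N R (Nat.le_succ j)
  have hM : MeasurableSet (merged a a' (j + 1)) := past_le _ _ (measurableSet_merged a a' (j + 1))
  set h : Config → ℝ := fun ω =>
    concaveGain R (meanSep a a' N j ω) (meanSep a a' N (j + 1) ω) +
      (merged a a' (j + 1)).indicator 1 ω with hh
  have hgi := integrable_concaveGain (N := N) ha hR j
  have hind : Integrable ((merged a a' (j + 1)).indicator (1 : Config → ℝ)) law :=
    (integrable_const (1 : ℝ)).indicator hM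
  have hint : Integrable h law := hgi.add hind
  have hnn : ∀ ω, 0 ≤ h ω := fun ω => add_nonneg (concaveGain_nonneg _ _ _)
    (indicator_nonneg (fun _ _ => zero_le_one) ω)
  have hpot := fun i => integrable_potential_meanSep (N := N) ha hR i
  have h1 : p ^ 2 * law.real (S ∩ s) ≤ ∫ ω in S ∩ s, h ω ∂law := by
    rw [mul_comm, ← smul_eq_mul, ← setIntegral_const]
    refine setIntegral_mono_of_fiber
      (Q := fun ω => (levelBlock (base a) j ω, levelBlock (base a') j ω)) ?_
      (past_le j _ (hSm.inter hs)) (integrable_const _) hint ?_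
    · rintro ⟨q, q'⟩
      simp only [Prod.mk.injEq]
      exact (past_le j _ (measurableSet_levelBlock _ _ q)).inter
        (past_le j _ (measurableSet_levelBlock _ _ q'))
    · rintro ⟨q, q'⟩
      simp only [Prod.mk.injEq]
      set B := S ∩ s ∩ {ω | levelBlock (base a) j ω = q ∧ levelBlock (base a') j ω = q'} with hBdef
      have hB : MeasurableSet[past j] B := (hSm.inter hs).inter
        ((measurableSet_levelBlock _ _ q).inter (measurableSet_levelBlock _ _ q'))
      have hBs : B ⊆ s := fun ω hω => hω.1.2
      rw [setIntegral_const, smul_eq_mul, mul_comm]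
      exact le_setIntegral_concaveGain_add hα hr hKr hp0 hp ha hR hj hB (hBs.trans hH)
        (hBs.trans hH') (hg B hB hBs) (hg' B hB hBs) (fun ω hω => hω.2.1) (fun ω hω => hω.2.2)
        fun ω hω => (mem_surviving.1 hω.1.1 j le_rfl).2.le
  have h2 : ∫ ω in S ∩ s, h ω ∂law ≤ ∫ ω in S, h ω ∂law :=
    setIntegral_mono_set hint.integrableOn (Filter.Eventually.of_forall hnn)
      (Filter.Eventually.of_forall inter_subset_left)
  have h3 : ∫ ω in S, h ω ∂law = (∫ ω in S, potential R (meanSep a a' N j ω) ∂law) -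
      (∫ ω in S, potential R (meanSep a a' N (j + 1) ω) ∂law) +
        law.real (S ∩ merged a a' (j + 1)) := by
    rw [integral_add hgi.integrableOn hind.integrableOn, setIntegral_concaveGain ha hR hSm,
      setIntegral_indicator hM]
    simp
  have hdiff : law.real S = law.real S' + law.real (S \ S') := by
    rw [← measureReal_inter_add_sdiff (s := S) hSm', inter_eq_right.2 hSS]
  have h4 : law.real (S ∩ merged a a' (j + 1)) ≤ law.real (S \ S') :=
    measureReal_mono fun ω hω => ⟨hω.1, fun hω' => (mem_surviving.1 hω' (j + 1) le_rfl).1 hω.2⟩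
  have h5 : (∫ ω in S', potential R (meanSep a a' N (j + 1) ω) ∂law) -
      (18 * R + 81) * law.real (S \ S') ≤
        ∫ ω in S, potential R (meanSep a a' N (j + 1) ω) ∂law := by
    rw [← integral_inter_add_sdiff (s := S) hSm' (hpot (j + 1)).integrableOn,
      inter_eq_right.2 hSS]
    have h6 : ∫ _ in S \ S', -(18 * R + 81) ∂law ≤
        ∫ ω in S \ S', potential R (meanSep a a' N (j + 1) ω) ∂law := by
      refine integral_mono_ae (integrable_const _) (hpot (j + 1)).integrableOn
        (ae_restrict_of_ae ?_)
      filter_upwards [neg_nine_le_meanSep ha N (j + 1)] with ω hω using le_potential hR hω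
    rw [setIntegral_const, smul_eq_mul] at h6
    linarith
  have h7 : ∀ i, survivingPotential a a' N R i =
      (∫ ω in surviving a a' N R i, potential R (meanSep a a' N i ω) ∂law) +
        (18 * R + 82) * law.real (surviving a a' N R i) := by
    intro i
    rw [survivingPotential, integral_add (hpot i).integrableOn (integrable_const _).integrableOn,
      setIntegral_const, smul_eq_mul, mul_comm (law.real _)]
  rw [h7, h7, ← hS, ← hS', hdiff]
  rw [h3] at h2
  linarith

end TwoPaths

/-! ### The tail of the merging level -/

/-- The contraction of the gap bounds the total gap along a decreasing sequence of events. -/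
lemma sum_setIntegral_gap_le (a : ℤ) {S : ℕ → Set Config} (hS : Antitone S)
    (hm : ∀ j, MeasurableSet[past j] (S j)) (n : ℕ) :
    (∑ j ∈ Finset.range n, ∫ ω in S j, gap a j ω ∂law) + 2 * ∫ ω in S n, gap a n ω ∂law ≤
      2 * gapMean.toReal + 2 * drift * ∑ j ∈ Finset.range n, law.real (S j) := by
  induction n with
  | zero =>
    have := setIntegral_gap_zero_le a (S 0)
    simp only [Finset.range_zero, Finset.sum_empty, zero_add, mul_zero, add_zero]
    linarith
  | succ n ih =>
    rw [Finset.sum_range_succ, Finset.sum_range_succ]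
    have h1 : ∫ ω in S (n + 1), gap a (n + 1) ω ∂law ≤ ∫ ω in S n, gap a (n + 1) ω ∂law :=
      setIntegral_mono_set (integrable_gap a (n + 1)).integrableOn
        (Filter.Eventually.of_forall fun ω => gap_nonneg a _ ω)
        (Filter.Eventually.of_forall (hS (Nat.le_succ n)))
    have h2 := setIntegral_gap_succ_le a n (hm n)
    linarith

lemma mul_law_sdiff_le {a : ℤ} {j K : ℕ} {S s : Set Config} (hS : MeasurableSet[past j] S)
    (hs : MeasurableSet[past j] s)
    (h : ∀ B, MeasurableSet[past j] B → B ⊆ sᶜ → K * law.real B ≤ ∫ ω in B, gap a j ω ∂law) :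
    K * law.real (S \ s) ≤ ∫ ω in S, gap a j ω ∂law :=
  (h (S \ s) (hS.diff hs) fun _ hω => hω.2).trans
    (setIntegral_mono_set (integrable_gap a j).integrableOn
      (Filter.Eventually.of_forall fun ω => gap_nonneg a _ ω)
      (Filter.Eventually.of_forall sdiff_subset))

/-- The expected number of levels survived by a pair of paths, in terms of the initial potential. -/
lemma exists_sum_law_surviving_le : ∃ C : ℝ, 0 < C ∧ ∀ (a a' : ℤ) (N : ℕ) (R : ℝ), a < a' → 0 ≤ R →
    ∑ j ∈ Finset.range N, law.real (surviving a a' N R j) ≤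
      C * (survivingPotential a a' N R 0 + 1) := by
  set K : ℕ := 8 * drift + 1 with hK
  obtain ⟨α, hα0, hα'⟩ := exists_abs_setIntegral_pos_sub_le (K := K) (by omega)
  have hα : ∀ (k : ℕ) (a : ℤ) (j : ℕ) (B : Set Config), MeasurableSet[past j] B →
      |∫ ω in B, (pos a (j + k) ω - pos a j ω) ∂law| ≤
        α * law.real B + 396 * ∫ ω in B, gap a j ω ∂law := hα'
  obtain ⟨r₀, hr₀⟩ := exists_nat_ge (35 + 4 * α + 792 * (gapMean.toReal + K))
  set r : ℕ := r₀ + (2 * K + 2) with hr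
  have hr1 : 35 + 4 * α + 792 * (gapMean.toReal + K) ≤ 66 * r := by
    have h1 : (r₀ : ℝ) ≤ r := by exact_mod_cast Nat.le_add_right r₀ (2 * K + 2)
    have h2 : (0 : ℝ) ≤ r := Nat.cast_nonneg r
    linarith
  obtain ⟨p, hp0, hp⟩ := exists_le_law_trapEvent (l := trapWidth K r)
    (by have := five_le_trapWidth K r; omega)
  set g := gapMean.toReal
  have hg0 : 0 ≤ g := ENNReal.toReal_nonneg
  have hKr : (K : ℝ) = 8 * drift + 1 := by rw [hK]; push_cast; ring
  have hG0 : (0 : ℝ) ≤ drift := Nat.cast_nonneg _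
  refine ⟨2 / p ^ 2 + 8 * g, by positivity, fun a a' N R ha hR => ?_⟩
  set S := surviving a a' N R with hS
  set Φ := survivingPotential a a' N R with hΦ
  have hSm : ∀ j, MeasurableSet[past j] (S j) := measurableSet_surviving a a' N R
  have hSa : Antitone S := surviving_anti a a' N R
  -- one level
  have hstep : ∀ j < N, K * law.real (S j) ≤ K / p ^ 2 * (Φ j - Φ (j + 1)) +
      ((∫ ω in S j, gap a j ω ∂law) + ∫ ω in S j, gap a' j ω ∂law) := by
    intro j hj
    obtain ⟨s, hs, hH, hg, hb⟩ := exists_good a j K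
    obtain ⟨s', hs', hH', hg', hb'⟩ := exists_good a' j K
    have h1 := mul_law_good_le hα hr1 (by omega) hp0.le (fun j q => hp _ _) ha hR hj
      (hs.inter hs') (inter_subset_left.trans hH) (inter_subset_right.trans hH')
      (fun B hB hBs => hg B hB (hBs.trans inter_subset_left))
      (fun B hB hBs => hg' B hB (hBs.trans inter_subset_right))
    have h2 := mul_law_sdiff_le (hSm j) hs hb
    have h3 := mul_law_sdiff_le (hSm j) hs' hb'
    have h4 : law.real (S j) ≤ law.real (S j ∩ (s ∩ s')) + (law.real (S j \ s) +
        law.real (S j \ s')) := by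
      refine (measureReal_mono (fun ω hω => ?_)).trans ((measureReal_union_le _ _).trans
        (add_le_add le_rfl (measureReal_union_le _ _)))
      by_cases hω1 : ω ∈ s
      · by_cases hω2 : ω ∈ s'
        · exact Or.inl ⟨hω, hω1, hω2⟩
        · exact Or.inr (Or.inr ⟨hω, hω2⟩)
      · exact Or.inr (Or.inl ⟨hω, hω1⟩)
    have h5 : K * law.real (S j ∩ (s ∩ s')) ≤ K / p ^ 2 * (Φ j - Φ (j + 1)) := by
      rw [div_mul_eq_mul_div, le_div_iff₀ (by positivity), mul_assoc, mul_comm (law.real _)]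
      gcongr
    have h6 := mul_le_mul_of_nonneg_left h4 (Nat.cast_nonneg (α := ℝ) K)
    linarith
  have hsum := Finset.sum_le_sum fun j hj => hstep j (Finset.mem_range.1 hj)
  rw [← Finset.mul_sum, Finset.sum_add_distrib, ← Finset.mul_sum, Finset.sum_add_distrib,
    Finset.sum_range_sub'] at hsum
  have e1 := sum_setIntegral_gap_le a hSa hSm N
  have e2 := sum_setIntegral_gap_le a' hSa hSm N
  have e3 := setIntegral_gap_nonneg a N (S N)
  have e4 := setIntegral_gap_nonneg a' N (S N)
  have e5 : 0 ≤ Φ N := survivingPotential_nonneg ha hR N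
  have e6 : 0 ≤ Φ 0 := survivingPotential_nonneg ha hR 0
  set T := ∑ j ∈ Finset.range N, law.real (S j)
  have hT0 : 0 ≤ T := Finset.sum_nonneg fun _ _ => measureReal_nonneg
  have e7 : K / p ^ 2 * (Φ 0 - Φ N) ≤ K / p ^ 2 * Φ 0 := by
    gcongr
    linarith
  have e8 : K * T ≤ K * (2 / p ^ 2 * Φ 0) + 8 * g := by
    have e9 : K * (2 / p ^ 2 * Φ 0) = 2 * (K / p ^ 2 * Φ 0) := by ring
    have e10 : (K : ℝ) * T = 8 * (drift * T) + T := by rw [hKr]; ring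
    linarith
  have hK1 : (1 : ℝ) ≤ K := by rw [hKr]; linarith
  have e11 : T ≤ 2 / p ^ 2 * Φ 0 + 8 * g := by
    by_contra! hcon
    have := mul_lt_mul_of_pos_left hcon (show (0 : ℝ) < K by linarith)
    nlinarith
  have e12 : 0 ≤ 2 / p ^ 2 := by positivity
  have e13 := mul_nonneg hg0 e6
  linarith

lemma integral_meanSep (a a' : ℤ) (N j : ℕ) :
    ∫ ω, meanSep a a' N j ω ∂law = ∫ ω, sep a a' N ω ∂law := integral_condExp (past_le j)

lemma exists_integral_sep_le : ∃ C : ℝ, 0 < C ∧ ∀ (a a' : ℤ) (N : ℕ),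
    ∫ ω, sep a a' N ω ∂law ≤ ((a' : ℝ) - a) + C := by
  obtain ⟨α, hα0, hα⟩ := exists_abs_setIntegral_pos_sub_le (K := 4 * drift) le_rfl
  have hg0 : 0 ≤ gapMean.toReal := ENNReal.toReal_nonneg
  refine ⟨2 * (α + 396 * gapMean.toReal), by positivity, fun a a' N => ?_⟩
  have h : ∀ b : ℤ, |(∫ ω, pos b N ω ∂law) - b| ≤ α + 396 * gapMean.toReal := by
    intro b
    have h1 := hα N b 0 univ MeasurableSet.univ
    have h2 := setIntegral_gap_zero_le b univ
    have h3 : ∀ ω, pos b 0 ω = b := fun ω => by rw [pos, levelPoint_zero]; rfl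
    simp only [h3, zero_add, Measure.restrict_univ, probReal_univ, mul_one] at h1 h2
    rw [integral_sub (integrable_pos b N) (integrable_const _)] at h1
    simp only [integral_const, probReal_univ, one_smul] at h1
    linarith
  simp only [sep]
  rw [integral_sub (integrable_pos a' N) (integrable_pos a N)]
  have h1 := abs_le.1 (h a)
  have h2 := abs_le.1 (h a')
  linarith

/-- The initial potential is at most linear in the initial distance. -/
lemma survivingPotential_zero_le {a a' : ℤ} (ha : a < a') (N : ℕ) {R : ℝ} (hR : 0 ≤ R) :
    survivingPotential a a' N R 0 ≤ 2 * R * ((∫ ω, sep a a' N ω ∂law) + 9) + 82 := by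
  have hi : Integrable (fun ω => 2 * R * (meanSep a a' N 0 ω + 9) + 82) law :=
    (((integrable_meanSep a a' N 0).add (integrable_const _)).const_mul _).add (integrable_const _)
  have h1 : survivingPotential a a' N R 0 ≤
      ∫ ω in surviving a a' N R 0, (2 * R * (meanSep a a' N 0 ω + 9) + 82) ∂law := by
    refine integral_mono ((integrable_potential_meanSep ha hR 0).add
      (integrable_const _)).integrableOn hi.integrableOn fun ω => ?_
    have := potential_le hR (meanSep a a' N 0 ω)
    simp only
    linarith
  have h2 : ∫ ω in surviving a a' N R 0, (2 * R * (meanSep a a' N 0 ω + 9) + 82) ∂law ≤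
      ∫ ω, (2 * R * (meanSep a a' N 0 ω + 9) + 82) ∂law := by
    refine setIntegral_le_integral hi ?_
    filter_upwards [neg_nine_le_meanSep ha N 0] with ω hω
    have : 0 ≤ 2 * R * (meanSep a a' N 0 ω + 9) := mul_nonneg (by linarith) (by linarith)
    simp only [Pi.zero_apply]
    linarith
  refine h1.trans (h2.trans (le_of_eq ?_))
  rw [integral_add (f := fun ω => 2 * R * (meanSep a a' N 0 ω + 9))
    (((integrable_meanSep a a' N 0).add (integrable_const _)).const_mul _)
    (integrable_const _), integral_const_mul, integral_add (integrable_meanSep a a' N 0)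
    (integrable_const _), integral_meanSep]
  simp

/-- The maximal inequality for the expected distance. -/
lemma mul_law_exceed_le {a a' : ℤ} (ha : a < a') (N : ℕ) {R : ℝ} (hR : 0 ≤ R) :
    R * law.real {ω | ∃ i ≤ N, R ≤ meanSep a a' N i ω + 9} ≤ (∫ ω, sep a a' N ω ∂law) + 9 := by
  let ℱ : Filtration ℕ (MeasurableSpace.pi : MeasurableSpace Config) :=
    ⟨past, past_mono, past_le⟩
  have hmart : Martingale (fun i ω => meanSep a a' N i ω + 9) ℱ law := by
    have h := (martingale_condExp (sep a a' N) ℱ law).add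
      (martingale_const ℱ law (9 : ℝ))
    exact h
  set f : ℕ → Config → ℝ := (fun i ω => meanSep a a' N i ω + 9)⁺ with hf
  have hfapp : ∀ i ω, f i ω = max (meanSep a a' N i ω + 9) 0 := fun _ _ => rfl
  have hmax := maximal_ineq hmart.submartingale.pos (posPart_nonneg _) (ε := ⟨R, hR⟩) N
  have hint : Integrable (fun ω => meanSep a a' N N ω + 9) law :=
    (integrable_meanSep a a' N N).add (integrable_const _)
  have hnn : 0 ≤ᵐ[law] fun ω => meanSep a a' N N ω + 9 := by
    filter_upwards [neg_nine_le_meanSep ha N N] with ω hω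
    simp only [Pi.zero_apply]
    linarith
  have hle : ∀ D : Set Config, ∫ ω in D, f N ω ∂law ≤ (∫ ω, sep a a' N ω ∂law) + 9 := by
    intro D
    have h1 : ∫ ω in D, f N ω ∂law = ∫ ω in D, (meanSep a a' N N ω + 9) ∂law := by
      refine integral_congr_ae (ae_restrict_of_ae ?_)
      filter_upwards [hnn] with ω hω
      have hω' : 0 ≤ meanSep a a' N N ω + 9 := hω
      rw [hfapp, max_eq_left hω']
    rw [h1]
    refine (setIntegral_le_integral hint hnn).trans (le_of_eq ?_)
    rw [integral_add (integrable_meanSep a a' N N) (integrable_const _), integral_meanSep]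
    simp
  have h0 : 0 ≤ (∫ ω, sep a a' N ω ∂law) + 9 :=
    le_trans (integral_nonneg fun ω => by rw [hfapp]; exact le_max_right _ _) (hle univ)
  have hsub : {ω | ∃ i ≤ N, R ≤ meanSep a a' N i ω + 9} ⊆
      {ω | R ≤ (Finset.range (N + 1)).sup' Finset.nonempty_range_add_one fun k => f k ω} := by
    rintro ω ⟨i, hi, hRi⟩
    exact (hRi.trans (le_max_left _ 0)).trans
      (Finset.le_sup' (fun k => f k ω) (Finset.mem_range.2 (Nat.lt_succ_iff.2 hi)))
  have h2 := hmax.trans (ENNReal.ofReal_le_ofReal (hle _))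
  have h3 := ENNReal.toReal_mono ENNReal.ofReal_ne_top h2
  rw [ENNReal.toReal_mul, ENNReal.toReal_ofReal h0] at h3
  exact (mul_le_mul_of_nonneg_left (measureReal_mono hsub) hR).trans h3

/-- The probability that two paths have not merged by level `N` is at most of order
`N ^ (-1 / 2)`. -/
theorem exists_law_compl_merged_le : ∃ C : ℝ, 0 < C ∧ ∀ (a a' : ℤ) (N : ℕ), a < a' → 1 ≤ N →
    law.real (merged a a' N)ᶜ ≤ C * ((a' : ℝ) - a) / √N := by
  obtain ⟨C₁, hC₁, h₁⟩ := exists_sum_law_surviving_le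
  obtain ⟨C₂, hC₂, h₂⟩ := exists_integral_sep_le
  refine ⟨C₁ * (2 * (C₂ + 10) + 83) + (C₂ + 10), by positivity, fun a a' N ha hN => ?_⟩
  -- the optimal threshold for the expected distance
  set R := √(N : ℝ) with hR
  have hN' : (1 : ℝ) ≤ N := by exact_mod_cast hN
  have hR1 : 1 ≤ R := Real.one_le_sqrt.2 hN'
  have hRR : R * R = N := Real.mul_self_sqrt (by linarith)
  set d : ℝ := (a' : ℝ) - a with hd
  have hd1 : 1 ≤ d := by
    have : (a : ℝ) + 1 ≤ a' := by exact_mod_cast ha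
    linarith
  have hsep : (∫ ω, sep a a' N ω ∂law) + 9 ≤ (C₂ + 10) * d := by
    have := h₂ a a' N
    nlinarith
  have hS : law.real (surviving a a' N R N) ≤ C₁ * (2 * (C₂ + 10) + 83) * d / R := by
    have e1 : (N : ℝ) * law.real (surviving a a' N R N) ≤
        ∑ j ∈ Finset.range N, law.real (surviving a a' N R j) := by
      have e0 := Finset.card_nsmul_le_sum (Finset.range N)
        (fun j => law.real (surviving a a' N R j)) (law.real (surviving a a' N R N))
        fun j hj => measureReal_mono (surviving_anti a a' N R (Finset.mem_range.1 hj).le)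
      rwa [Finset.card_range, nsmul_eq_mul] at e0
    have e2 := h₁ a a' N R ha (by linarith)
    have e3 := survivingPotential_zero_le ha N (R := R) (by linarith)
    have e4 : survivingPotential a a' N R 0 + 1 ≤ (2 * (C₂ + 10) + 83) * (R * d) := by
      have e5 : 1 ≤ R * d := one_le_mul_of_one_le_of_one_le hR1 hd1
      have e6 := mul_le_mul_of_nonneg_left hsep (show 0 ≤ 2 * R by linarith)
      linarith
    have e7 : (N : ℝ) * law.real (surviving a a' N R N) ≤
        C₁ * ((2 * (C₂ + 10) + 83) * (R * d)) :=
      e1.trans (e2.trans (mul_le_mul_of_nonneg_left e4 hC₁.le))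
    rw [le_div_iff₀ (by linarith)]
    rw [← hRR] at e7
    have e8 : R * (law.real (surviving a a' N R N) * R) ≤
        R * (C₁ * (2 * (C₂ + 10) + 83) * d) := by linarith
    exact le_of_mul_le_mul_left e8 (by linarith)
  have hE : law.real {ω | ∃ i ≤ N, R ≤ meanSep a a' N i ω + 9} ≤ (C₂ + 10) * d / R := by
    rw [le_div_iff₀ (by linarith), mul_comm]
    exact (mul_law_exceed_le ha N (by linarith)).trans hsep
  have hcov : law.real (merged a a' N)ᶜ ≤ law.real (surviving a a' N R N ∪
      {ω | ∃ i ≤ N, R ≤ meanSep a a' N i ω + 9}) := by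
    refine ENNReal.toReal_mono (measure_ne_top _ _) (measure_mono_ae ?_)
    filter_upwards [typical_ae] with ω hω hm
    by_cases h : ∃ i ≤ N, R ≤ meanSep a a' N i ω + 9
    · exact Or.inr h
    · push Not at h
      refine Or.inl (mem_surviving.2 fun i hi => ⟨fun hmi => hm (hω.merged_mono hi hmi), ?_⟩)
      have := h i hi
      linarith
  refine hcov.trans ((measureReal_union_le _ _).trans ((add_le_add hS hE).trans (le_of_eq ?_)))
  ring

/-! ### Vertical translation -/

/-- The vertical translation of the plane by `h`. -/
def translate (h : ℝ) (x : ℝ × ℝ) : ℝ × ℝ := (x.1, x.2 + h)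

lemma l1Dist_translate (h : ℝ) (x y : ℝ × ℝ) :
    l1Dist (translate h x) (translate h y) = l1Dist x y := by
  simp [l1Dist, translate]

lemma isNextStep_translate {V : Set (ℝ × ℝ)} (h : ℝ) {x y : ℝ × ℝ} :
    IsNextStep (translate h '' V) (translate h x) (translate h y) ↔ IsNextStep V x y := by
  have hlt : ∀ z w : ℝ × ℝ, (translate h z).2 < (translate h w).2 ↔ z.2 < w.2 := fun z w => by
    simp [translate]
  have hinj : Function.Injective (translate h) := fun z w hzw => by
    simpa [translate, Prod.ext_iff] using hzw
  rw [IsNextStep, IsNextStep, hinj.mem_set_image, hlt, forall_mem_image]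
  simp only [hlt, l1Dist_translate]

lemma nextStep_translate (V : Set (ℝ × ℝ)) (h : ℝ) (x : ℝ × ℝ) :
    nextStep (translate h '' V) (translate h x) = translate h (nextStep V x) := by
  have hsurj : ∀ {y}, IsNextStep (translate h '' V) (translate h x) y →
      ∃ z, translate h z = y ∧ IsNextStep V x z := by
    intro y hy
    obtain ⟨z, -, rfl⟩ := hy.1
    exact ⟨z, rfl, (isNextStep_translate h).1 hy⟩
  by_cases hex : ∃! y, IsNextStep V x y
  · have hz := nextStep_spec hex
    refine nextStep_eq ⟨_, (isNextStep_translate h).2 hz, fun y hy => ?_⟩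
      ((isNextStep_translate h).2 hz)
    obtain ⟨z, rfl, hz'⟩ := hsurj hy
    rw [hex.unique hz' hz]
  · have hex' : ¬ ∃! y, IsNextStep (translate h '' V) (translate h x) y := by
      rintro ⟨y, hy, hu⟩
      obtain ⟨z, rfl, hz⟩ := hsurj hy
      refine hex ⟨z, hz, fun w hw => ?_⟩
      have h1 := hu _ ((isNextStep_translate h).2 hw)
      simpa [translate, Prod.ext_iff] using h1
    rw [nextStep, dif_neg hex', nextStep, dif_neg hex]

lemma exitPoint_translate (V : Set (ℝ × ℝ)) (h s : ℝ) (x : ℝ × ℝ) :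
    exitPoint (translate h '' V) (s + h) (translate h x) = translate h (exitPoint V s x) := by
  have key : ∀ k, (nextStep (translate h '' V))^[k] (translate h x) =
      translate h ((nextStep V)^[k] x) := by
    intro k
    induction k with
    | zero => rfl
    | succ k ih => rw [Function.iterate_succ_apply', ih, nextStep_translate,
        ← Function.iterate_succ_apply' (nextStep V)]
  have e : {k | s + h < ((nextStep (translate h '' V))^[k] (translate h x)).2} =
      {k | s < ((nextStep V)^[k] x).2} := by
    ext k
    rw [mem_ofPred_eq, mem_ofPred_eq, key]
    simp [translate]
  rw [exitPoint, exitPoint, e, key]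

/-! ### Transfer to an arbitrary perturbed lattice -/

lemma vertexSet_shift (U : ℤ × ℤ → ℝ × ℝ) (h : ℤ) :
    vertexSet U = translate h '' vertexSet fun w => U (w.1, w.2 + h) := by
  ext z
  constructor
  · rintro ⟨w, rfl⟩
    refine ⟨_, ⟨(w.1, w.2 - h), rfl⟩, ?_⟩
    simp only [translate, latticePoint, sub_add_cancel]
    refine Prod.ext rfl ?_
    simp only [Prod.snd_add]
    push_cast
    ring
  · rintro ⟨_, ⟨w, rfl⟩, rfl⟩
    refine ⟨(w.1, w.2 + h), ?_⟩
    simp only [translate, latticePoint]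
    refine Prod.ext rfl ?_
    simp only [Prod.snd_add]
    push_cast
    ring

lemma perturb_eq_self {ω : Config} (h : ∀ w, ω w ∈ box) : perturb ω = ω :=
  funext fun w => clamp_of_mem (h w)

/-- Paths that have merged by level `N` have met by the height `20 N - 2`, counted from their
starting points. -/
lemma coalescingTime_le_of_merged {U : ℤ × ℤ → ℝ × ℝ} {h a a' : ℤ} {N : ℕ} (hN : 1 ≤ N)
    (hbox : ∀ w : ℤ × ℤ, U (w.1, w.2 + h) ∈ box)
    (hty : Typical fun w => U (w.1, w.2 + h))
    (hm : (fun w => U (w.1, w.2 + h)) ∈ merged a a' N) :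
    coalescingTime (vertexSet U) (latticePoint (a, h)) (latticePoint (a', h)) ≤
      ((h + (20 * N - 2) : ℝ) : EReal) := by
  have hp := perturb_eq_self (ω := fun w => U (w.1, w.2 + h)) hbox
  have hbase : ∀ b : ℤ, latticePoint (b, h) = translate h (base b) := fun b =>
    Prod.ext rfl (by simp [translate, latticePoint])
  have hm' : exitPoint (vertexSet fun w => U (w.1, w.2 + h)) (20 * N - 7) (base a) =
      exitPoint (vertexSet fun w => U (w.1, w.2 + h)) (20 * N - 7) (base a') := by
    have hm1 : levelPoint (base a) N (fun w => U (w.1, w.2 + h)) =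
      levelPoint (base a') N (fun w => U (w.1, w.2 + h)) := hm
    rwa [levelPoint, levelPoint, hp] at hm1
  have hG := hty.1
  have hUp := perturb_mem (fun w => U (w.1, w.2 + h))
  rw [hp] at hG hUp
  have hN' : (1 : ℝ) ≤ N := by exact_mod_cast hN
  have hle := hG.exitPoint_snd_le hUp (base_mem a _) (s := 20 * N - 7)
    (by simp only [latticePoint]; push_cast; linarith)
  rw [vertexSet_shift U h, hbase, hbase]
  refine (coalescingTime_le_of_exitPoint_eq (s := 20 * N - 7 + h) ?_).trans ?_
  · rw [exitPoint_translate, exitPoint_translate, hm']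
  · rw [exitPoint_translate, EReal.coe_le_coe_iff, translate]
    simp only
    linarith

lemma exists_level {t : ℝ} (ht : 18 ≤ t) :
    ∃ N : ℕ, 1 ≤ N ∧ 20 * (N : ℝ) - 2 ≤ t ∧ t ≤ 49 * N := by
  refine ⟨⌊(t + 2) / 20⌋₊, Nat.one_le_floor_iff _ |>.2 (by linarith), ?_, ?_⟩
  · have := Nat.floor_le (show 0 ≤ (t + 2) / 20 by linarith)
    linarith
  · have h1 := Nat.lt_floor_add_one ((t + 2) / 20)
    have h2 : (1 : ℝ) ≤ ⌊(t + 2) / 20⌋₊ := by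
      exact_mod_cast (Nat.one_le_floor_iff ((t + 2) / 20)).2 (by linarith)
    linarith

end PerturbedDSF

theorem mainTheorem4 :
    ∃ C₀ : ℝ, 0 < C₀ ∧
      ∀ (Ω : Type*) [MeasurableSpace Ω] (μ : Measure Ω) [IsProbabilityMeasure μ]
        (U : ℤ × ℤ → Ω → ℝ × ℝ),
        (∀ w, Measurable (U w)) →
        iIndepFun U μ →
        (∀ w, pdf.IsUniform (U w) PerturbedDSF.box μ volume) →
        ∀ u v : ℤ × ℤ, u.1 < v.1 → u.2 = v.2 →
          ∀ t : ℝ, 0 < t →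
            μ {ω | (((u.2 : ℝ) + t : ℝ) : EReal) <
                PerturbedDSF.coalescingTime (PerturbedDSF.vertexSet fun w => U w ω)
                  (PerturbedDSF.latticePoint u) (PerturbedDSF.latticePoint v)}
              ≤ ENNReal.ofReal (C₀ * ((v.1 : ℝ) - (u.1 : ℝ)) / √t) := by
  open PerturbedDSF in
  obtain ⟨C, hC, hmerge⟩ := exists_law_compl_merged_le
  refine ⟨7 * C + 5, by positivity, fun Ω _ μ _ U hU hind hunif u v huv huv2 t ht => ?_⟩
  have hd : (1 : ℝ) ≤ (v.1 : ℝ) - u.1 := by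
    have : (u.1 : ℝ) + 1 ≤ v.1 := by exact_mod_cast huv
    linarith
  have hst : 0 < √t := Real.sqrt_pos.2 ht
  rcases lt_or_ge t 18 with ht18 | ht18
  · -- for small times the bound exceeds `1`
    refine prob_le_one.trans ?_
    rw [← ENNReal.ofReal_one]
    refine ENNReal.ofReal_le_ofReal ?_
    rw [le_div_iff₀ hst, one_mul]
    have h5 : √t ≤ 5 := Real.sqrt_le_iff.2 ⟨by norm_num, by linarith⟩
    nlinarith
  obtain ⟨N, hN, hNt, htN⟩ := exists_level ht18
  -- the configuration seen from the height of the starting points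
  let Φ : Ω → Config := fun ω w => U (w.1, w.2 + u.2) ω
  have hΦm : Measurable Φ := measurable_pi_iff.2 fun w => hU _
  have hinj : Function.Injective fun w : ℤ × ℤ => (w.1, w.2 + u.2) := fun w w' h => by
    simpa [Prod.ext_iff] using h
  have hΦ : μ.map Φ = law :=
    map_eq_law (U := fun w => U (w.1, w.2 + u.2)) (fun w => hU _) (hind.precomp hinj)
      fun w => hunif _
  have hbox : ∀ᵐ ω ∂μ, ∀ w, U w ω ∈ box := by
    refine ae_all_iff.2 fun w => ?_
    have h0 : ∀ᵐ z ∂(μ.map (U w)), z ∈ box := by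
      rw [show μ.map (U w) = unif from hunif w]
      exact unif_compl_box
    exact ae_of_ae_map (hU w).aemeasurable h0
  have hty : ∀ᵐ ω ∂μ, Typical (Φ ω) := ae_of_ae_map hΦm.aemeasurable (hΦ ▸ typical_ae)
  have hM : MeasurableSet (merged u.1 v.1 N)ᶜ := (past_le N _ (measurableSet_merged _ _ _)).compl
  calc μ {ω | (((u.2 : ℝ) + t : ℝ) : EReal) <
          coalescingTime (vertexSet fun w => U w ω) (latticePoint u) (latticePoint v)}
      ≤ μ (Φ ⁻¹' (merged u.1 v.1 N)ᶜ) := by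
        refine measure_mono_ae ?_
        filter_upwards [hbox, hty] with ω h1 h2 h3 h4
        have h5 := coalescingTime_le_of_merged (U := fun w => U w ω) hN (fun w => h1 _) h2 h4
        have h6 : latticePoint (v.1, u.2) = latticePoint v := by rw [huv2]
        rw [h6] at h5
        refine absurd (lt_of_lt_of_le h3 h5) (not_lt.2 (EReal.coe_le_coe_iff.2 ?_))
        linarith
    _ = law (merged u.1 v.1 N)ᶜ := by rw [← hΦ, Measure.map_apply hΦm hM]
    _ = ENNReal.ofReal (law.real (merged u.1 v.1 N)ᶜ) := by
        rw [measureReal_def, ENNReal.ofReal_toReal (measure_ne_top _ _)]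
    _ ≤ _ := by
        refine ENNReal.ofReal_le_ofReal ((hmerge u.1 v.1 N huv hN).trans ?_)
        have hsN : 0 < √(N : ℝ) := Real.sqrt_pos.2 (by exact_mod_cast hN)
        have h7 : √t ≤ 7 * √(N : ℝ) := by
          rw [Real.sqrt_le_iff]
          refine ⟨by positivity, ?_⟩
          rw [mul_pow, Real.sq_sqrt (Nat.cast_nonneg N)]
          linarith
        rw [div_le_div_iff₀ hsN hst]
        have h8 : 0 ≤ C * ((v.1 : ℝ) - u.1) := by positivity
        have h9 := mul_le_mul_of_nonneg_left h7 h8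
        have h10 : 0 ≤ 5 * ((v.1 : ℝ) - u.1) * √(N : ℝ) := by positivity
        linarith
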